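/- Let $F_\varepsilon(x,y)$ be an analytic (or $C^\infty$, or formal) family of area-preserving orientation-reversing maps of the plane, defined for $(x,y,\varepsilon)$ in a neighbourhood of the origin of $\mathbb R^3$, that is, $\det DF_\varepsilon=-1$, where $D$ is the derivative in $(x,y)$. Assume that $F_0(0)=0$ and that $DF_0(0)$ has the eigenvalues $-1$ and $1$. An analytic or $C^\infty$ family is identified with its Taylor series at the origin, an individual map is regarded as a family that does not depend on $\varepsilon$, and all equalities below are equalities of formal power series in $(x,y,\varepsilon)$. Notation. Let $R=\mathrm{Diag}(-1,1)$. A canonical formal change of variables $\phi_\varepsilon$ is a pair of formal power series in $(x,y,\varepsilon)$ without constant term with $\det D\phi_\varepsilon=1$. Assign the orders $1,1,3$ to $x,y,\varepsilon$. For a formal Hamiltonian $h$ all of whose monomials have order at least $3$, let $\Phi^1_h=(\exp(L_h)x,\exp(L_h)y)$ be its formal time-one map, where $L_hg=\partial_xg\,\partial_yh-\partial_yg\,\partial_xh$. A Takens Hamiltonian of $F_\varepsilon$ is a formal Hamiltonian $h$ that is odd in $x$, has only monomials of order at least $3$, and satisfies $F_\varepsilon=\phi_\varepsilon^{-1}\circ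 R\circ\Phi^1_h\circ\phi_\varepsilon$ for some canonical formal change of variables $\phi_\varepsilon$; at $\varepsilon=0$ its leading order is $bxy^2+ax^3$. Assume that the leading order of the normal form is non-degenerate, i.e., $b\neq0$ (for every Takens Hamiltonian of $F_\varepsilon$). Then there exists a canonical formal change of variables $\phi_\varepsilon$ such that $$F_\varepsilon=\phi_\varepsilon^{-1}\circ \mathrm{Diag}(-1,1)\circ\Phi^1_{h_\varepsilon}\circ\phi_\varepsilon,$$ where $$h_\varepsilon(x,y)=xy^2+ax^3+A(x,\varepsilon)+y\,B(xy^2,\varepsilon),$$ $a\in\mathbb R$, and $A$ and $B$ are real formal series of the form $$A(x,\varepsilon)=\sum_{\substack{k\ge1,\ m\ge0\\ (2k-1)+3m\ge4}}a_{mk}\,x^{2k-1}\varepsilon^m,\qquad B(xy^2,\varepsilon)=\sum_{k\ge1,\ m\ge0}b_{mk}\,(xy^2)^{2k-1}\varepsilon^m .$$ The number $a$ and all the coefficients $a_{mk}$, $b_{mk}$ are defined uniquely by the family $F_\varepsilon$ (they do not depend on the choice of $\phi_\varepsilon$). -/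

import Mathlib

namespace ReversingMaps

open MvPowerSeries

noncomputable section

/-! ### Formal families of planar maps

The variables with indices `0`, `1`, `2` are `x`, `y` and the parameter `ε`. -/

/-- Real formal power series in `x, y, ε`. -/
abbrev FSeries := MvPowerSeries (Fin 3) ℝ

/-- A formal family `F_ε` of maps of the plane: its two components. -/
abbrev FormalMap := Fin 2 → FSeries

/-- The exponent of the monomial `x^k y^l ε^m`. -/
def expo (k l m : ℕ) : Fin 3 →₀ ℕ := Finsupp.equivFunOnFinite.symm ![k, l, m]

/-- The composition `F_ε ∘ G_ε`, that is `F(G₁, G₂, ε)` (for `G` without constant term). -/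
def comp (F G : FormalMap) : FormalMap :=
  fun i => subst (![G 0, G 1, X 2] : Fin 3 → FSeries) (F i)

/-- The identity family. -/
def idMap : FormalMap := ![X 0, X 1]

/-- The linear map `Diag(-1, 1)`. -/
def reflection : FormalMap := ![-X 0, X 1]

/-- The Jacobian determinant of `F_ε` with respect to `(x, y)`. -/
def jacDet (F : FormalMap) : FSeries :=
  pderiv ℝ 0 (F 0) * pderiv ℝ 1 (F 1) - pderiv ℝ 1 (F 0) * pderiv ℝ 0 (F 1)

/-- `F_0(0) = 0`. -/
def FixesOrigin (F : FormalMap) : Prop := ∀ i, constantCoeff (F i) = 0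

/-- The matrix `DF_0(0)` of first derivatives in `(x, y)`. -/
def linearPart (F : FormalMap) : Matrix (Fin 2) (Fin 2) ℝ :=
  Matrix.of fun i j => coeff (Finsupp.single j.castSucc 1) (F i)

/-- The numbers `-1` and `1` are eigenvalues of the matrix `J`. -/
def HasEigenvaluesNegOneOne (J : Matrix (Fin 2) (Fin 2) ℝ) : Prop :=
  Module.End.HasEigenvalue (Matrix.toLin' J) (-1) ∧
    Module.End.HasEigenvalue (Matrix.toLin' J) 1

/-- A canonical formal change of the variables `(x, y)`, depending on `ε`. -/
structure IsCanonical (φ : FormalMap) : Prop where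
  fixesOrigin : FixesOrigin φ
  jacDet_eq : jacDet φ = 1

/-! ### Time-one maps of formal Hamiltonians -/

/-- The Poisson bracket `{g, χ} = ∂g/∂x ∂χ/∂y - ∂g/∂y ∂χ/∂x`. -/
def bracket (g χ : FSeries) : FSeries :=
  pderiv ℝ 0 g * pderiv ℝ 1 χ - pderiv ℝ 1 g * pderiv ℝ 0 χ

/-- The Lie derivative `L_χ g = {g, χ}`. -/
def lieD (χ g : FSeries) : FSeries := bracket g χ

/-- `exp(L_χ) g = ∑ₖ L_χ^k g / k!`, summed coefficient by coefficient. When `χ` has order at least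
three, as defined below, only finitely many `k` contribute to each coefficient. -/
def expLie (χ g : FSeries) : FSeries :=
  fun d => ∑ᶠ k : ℕ, ((k.factorial : ℝ))⁻¹ * coeff d ((lieD χ)^[k] g)

/-- The time-one map `Φ¹_χ = (exp(L_χ) x, exp(L_χ) y)`. -/
def timeOne (χ : FSeries) : FormalMap := ![expLie χ (X 0), expLie χ (X 1)]

/-- All monomials of `h` have order at least three, where `x`, `y`, `ε` have orders `1, 1, 3`. -/
def OrderAtLeastThree (h : FSeries) : Prop :=
  ∀ d : Fin 3 →₀ ℕ, coeff d h ≠ 0 → 3 ≤ d 0 + d 1 + 3 * d 2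

/-- `h(-x, y, ε) = -h(x, y, ε)`. -/
def OddInX (h : FSeries) : Prop := ∀ d : Fin 3 →₀ ℕ, coeff d h ≠ 0 → Odd (d 0)

/-- `F = φ⁻¹ ∘ Diag(-1, 1) ∘ Φ¹_h ∘ φ` for some canonical formal change of variables `φ`;
here `ψ` is `φ⁻¹`. -/
def ConjToReflectedFlow (F : FormalMap) (h : FSeries) : Prop :=
  ∃ φ ψ : FormalMap, IsCanonical φ ∧ IsCanonical ψ ∧
    comp φ ψ = idMap ∧ comp ψ φ = idMap ∧
    F = comp ψ (comp reflection (comp (timeOne h) φ))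

/-- `h` is the Hamiltonian of a Takens normal form vector field of `F`: it is odd in `x`, starts
with cubic terms, and `F` is canonically conjugate to `Diag(-1, 1) ∘ Φ¹_h`. At `ε = 0` its leading
part is `b x y² + a x³`. -/
def IsTakensHamiltonian (F : FormalMap) (h : FSeries) : Prop :=
  OddInX h ∧ OrderAtLeastThree h ∧ ConjToReflectedFlow F h

/-- The leading order `b x y² + a x³` of the Takens normal form is non-degenerate: `b ≠ 0`. The
number `b` is determined by `F` up to a non-zero factor, which depends on the scaling of the
normalising coordinates; the condition is required of every choice. -/
def NondegenerateLeadingOrder (F : FormalMap) : Prop :=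
  ∀ h : FSeries, IsTakensHamiltonian F h → coeff (expo 1 2 0) h ≠ 0

/-! ### The simplified Hamiltonian -/

/-- `A(u, ε)` is a sum of terms `a_{mk} u^(2k-1) ε^m` with `k ≥ 1` and `(2k-1) + 3m ≥ 4`. -/
def AdmissibleA (A : MvPowerSeries (Fin 2) ℝ) : Prop :=
  ∀ d : Fin 2 →₀ ℕ, coeff d A ≠ 0 → Odd (d 0) ∧ 4 ≤ d 0 + 3 * d 1

/-- `B(u, ε)` is a sum of terms `b_{mk} u^(2k-1) ε^m` with `k ≥ 1` and `m ≥ 0`. -/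
def AdmissibleB (B : MvPowerSeries (Fin 2) ℝ) : Prop :=
  ∀ d : Fin 2 →₀ ℕ, coeff d B ≠ 0 → Odd (d 0)

/-- `h = x y² + a x³ + A(x, ε) + y B(x y², ε)`. -/
def normalHam (a : ℝ) (A B : MvPowerSeries (Fin 2) ℝ) : FSeries :=
  X 0 * X 1 ^ 2 + C a * X 0 ^ 3 + subst (![X 0, X 2] : Fin 2 → FSeries) A +
    X 1 * subst (![X 0 * X 1 ^ 2, X 2] : Fin 2 → FSeries) B

/-! ### The classes of families -/

/-- A formal family of area-preserving, orientation-reversing maps with `F_0(0) = 0` such that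
`DF_0(0)` has the eigenvalues `-1` and `1`. -/
structure IsFormalReversingFamily (F : FormalMap) : Prop where
  jacDet_eq : jacDet F = -1
  fixesOrigin : FixesOrigin F
  eigenvalues : HasEigenvaluesNegOneOne (linearPart F)

/-- The matrix of first derivatives of `F_ε` in `(x, y)` at the point `p = (x, y, ε)`. -/
def jacobian (F : (Fin 3 → ℝ) → Fin 2 → ℝ) (p : Fin 3 → ℝ) : Matrix (Fin 2) (Fin 2) ℝ :=
  Matrix.of fun i j => fderiv ℝ F p (Pi.single j.castSucc 1) i

/-- A family `(x, y, ε) ↦ F_ε(x, y)` of area-preserving, orientation-reversing maps of class `C^r`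
on a neighbourhood `U` of the origin, with `F_0(0) = 0`, such that `DF_0(0)` has the eigenvalues
`-1` and `1`. -/
structure IsReversingFamilyOn (r : WithTop ℕ∞) (U : Set (Fin 3 → ℝ))
    (F : (Fin 3 → ℝ) → Fin 2 → ℝ) : Prop where
  isOpen : IsOpen U
  zero_mem : (0 : Fin 3 → ℝ) ∈ U
  contDiffOn : ContDiffOn ℝ r F U
  det_jacobian : ∀ p ∈ U, (jacobian F p).det = -1
  map_zero : F 0 = 0
  eigenvalues : HasEigenvaluesNegOneOne (jacobian F 0)

/-- The partial derivative with respect to the `i`-th variable. -/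
def partialD (i : Fin 3) (f : (Fin 3 → ℝ) → ℝ) : (Fin 3 → ℝ) → ℝ :=
  fun p => fderiv ℝ f p (Pi.single i 1)

/-- The Taylor series of a function at the origin. -/
def taylorSeries (f : (Fin 3 → ℝ) → ℝ) : FSeries := fun d =>
  ((partialD 0)^[d 0] ((partialD 1)^[d 1] ((partialD 2)^[d 2] f))) 0 /
    ((d 0).factorial * (d 1).factorial * (d 2).factorial : ℝ)

/-- The Taylor series of a family of maps at the origin. -/
def taylorMap (F : (Fin 3 → ℝ) → Fin 2 → ℝ) : FormalMap :=
  fun i => taylorSeries fun p => F p i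

end

end ReversingMaps

namespace ReversingMaps

open MvPowerSeries

noncomputable section

/-! ### Exponents and the weight filtration -/

/-! A family is replaced by its pull-back, an endomorphism of the algebra of series in x, y, ε that
fixes ε and respects the filtration by order (x, y, ε have orders 1, 1, 3). Area preservation up to
sign says that the pull-back multiplies the Poisson bracket by 1 or -1. Since pull-back reverses
composition, F = φ⁻¹ ∘ R ∘ Φ¹_h ∘ φ becomes α β = β exp(L_h) R*, with α and β the pull-backs by F
and φ (`conjToReflectedFlow_iff`). A Hamiltonian of order k + 2 raises orders by k under L_h, so
exponentials and infinite products of near-identity factors converge in the filtration, and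
equalities are proved modulo every order.

Takens normal form (`takens_step`, `exists_takens`). Linear algebra brings α to R* at lowest order.
If α agrees with R* exp(L_h) up to conjugacy modulo a certain order, the defect is canonical and
near the identity, hence to leading order the flow of some g. As R reverses the bracket, R* commutes
with flows of Hamiltonians odd in x and inverts flows of even ones. So conjugation removes the even
part of g, while the odd part is added to h.

Simplification (`simplify_step`, `exists_simplified`). Canonical changes δ that commute with R act
by h ↦ δ h. A scaling makes the leading part h₀ = xy² + ax³. The homological operator χ ↦ {h₀, χ}
sends x^k y^l to (l - 2k) x^k y^(l+1) + 3al x^(k+2) y^(l-1). It is triangular in the power of x,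
with zero diagonal only for l = 2k. Hence every term divisible by y can be removed, except x^k
y^(2k+1) ε^m; the terms x^k ε^m also stay.

Uniqueness. Squaring R* exp(L_h) with h odd gives exp(L_{2h}), and a flow determines its Hamiltonian
up to a function of ε (`flow_injective`). So a conjugacy between two reflected flows commutes with R
and maps one Hamiltonian to the other (`symmetric_of_conj`). Let δ g = g' with both simplified. The
linear part of δ is the identity, and δ is to leading order the flow of some q. The resonant terms
(xy²)^i ε^m of q can be matched by those of a polynomial f in g and ε. Since {f, g} = 0, composing δ
with exp(-L_f) changes neither g nor g'. What remains of q has no resonant terms; the absence of the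
removed monomials in g' - g then forces it to vanish at leading order. Thus g' - g gains an order
and the argument repeats (`uniqueness_step`).

Smooth and analytic families reduce to formal ones because the Taylor map respects products and
derivatives. -/

@[simp] lemma expo_zero (k l m : ℕ) : expo k l m 0 = k := rfl
@[simp] lemma expo_one (k l m : ℕ) : expo k l m 1 = l := rfl
@[simp] lemma expo_two (k l m : ℕ) : expo k l m 2 = m := rfl

lemma expo_eta (d : Fin 3 →₀ ℕ) : expo (d 0) (d 1) (d 2) = d := by
  ext i; fin_cases i <;> rfl

lemma expo_add (k l m k' l' m' : ℕ) :
    expo k l m + expo k' l' m' = expo (k + k') (l + l') (m + m') := by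
  ext i; fin_cases i <;> rfl

lemma expo_inj {k l m k' l' m' : ℕ} :
    expo k l m = expo k' l' m' ↔ k = k' ∧ l = l' ∧ m = m' := by
  constructor
  · intro h
    exact ⟨congrArg (· 0) h, congrArg (· 1) h, congrArg (· 2) h⟩
  · rintro ⟨rfl, rfl, rfl⟩; rfl

lemma single_zero_eq (n : ℕ) : (Finsupp.single 0 n : Fin 3 →₀ ℕ) = expo n 0 0 := by
  ext i; fin_cases i <;> simp [expo]
lemma single_one_eq (n : ℕ) : (Finsupp.single 1 n : Fin 3 →₀ ℕ) = expo 0 n 0 := by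
  ext i; fin_cases i <;> simp [expo]
lemma single_two_eq (n : ℕ) : (Finsupp.single 2 n : Fin 3 →₀ ℕ) = expo 0 0 n := by
  ext i; fin_cases i <;> simp [expo]

lemma series_ext {f g : FSeries} (h : ∀ k l m, coeff (expo k l m) f = coeff (expo k l m) g) :
    f = g := by
  ext d; rw [← expo_eta d]; exact h _ _ _

/-- The series with prescribed coefficients. -/
def ofCoeffs (c : ℕ → ℕ → ℕ → ℝ) : FSeries := fun d => c (d 0) (d 1) (d 2)

@[simp] lemma coeff_ofCoeffs (c : ℕ → ℕ → ℕ → ℝ) (k l m : ℕ) :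
    coeff (expo k l m) (ofCoeffs c) = c k l m := rfl

lemma coeff_pderiv_zero (f : FSeries) (k l m : ℕ) :
    coeff (expo k l m) (pderiv ℝ 0 f) = coeff (expo (k + 1) l m) f * (k + 1) := by
  rw [coeff_pderiv, single_zero_eq, expo_add]; rfl

lemma coeff_pderiv_one (f : FSeries) (k l m : ℕ) :
    coeff (expo k l m) (pderiv ℝ 1 f) = coeff (expo k (l + 1) m) f * (l + 1) := by
  rw [coeff_pderiv, single_one_eq, expo_add]; rfl

lemma coeff_monomial_mul_expo (i j n : ℕ) (a : ℝ) (f : FSeries) (k l m : ℕ) :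
    coeff (expo k l m) (monomial (expo i j n) a * f) =
      if i ≤ k ∧ j ≤ l ∧ n ≤ m then a * coeff (expo (k - i) (l - j) (m - n)) f else 0 := by
  classical
  rw [coeff_monomial_mul]
  have h1 : expo i j n ≤ expo k l m ↔ i ≤ k ∧ j ≤ l ∧ n ≤ m := by
    constructor
    · intro h; exact ⟨h 0, h 1, h 2⟩
    · rintro ⟨h0, h1, h2⟩ i; fin_cases i <;> assumption
  have h2 : expo k l m - expo i j n = expo (k - i) (l - j) (m - n) := by
    ext i; fin_cases i <;> rfl
  simp only [h1, h2]

lemma X_zero_eq : (X 0 : FSeries) = monomial (expo 1 0 0) 1 := by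
  rw [X_def, single_zero_eq]
lemma X_one_eq : (X 1 : FSeries) = monomial (expo 0 1 0) 1 := by
  rw [X_def, single_one_eq]
lemma X_two_eq : (X 2 : FSeries) = monomial (expo 0 0 1) 1 := by
  rw [X_def, single_two_eq]

lemma coeff_C_expo (a : ℝ) (k l m : ℕ) :
    coeff (expo k l m) (C a : FSeries) = if k = 0 ∧ l = 0 ∧ m = 0 then a else 0 := by
  classical
  have : (0 : Fin 3 →₀ ℕ) = expo 0 0 0 := by ext i; fin_cases i <;> rfl
  rw [coeff_C, this]
  simp only [expo_inj]

/-- The order of the monomial with exponent `d`, where `x`, `y`, `ε` have orders `1`, `1`, `3`. -/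
def wt (d : Fin 3 →₀ ℕ) : ℕ := d 0 + d 1 + 3 * d 2

lemma wt_add (d e : Fin 3 →₀ ℕ) : wt (d + e) = wt d + wt e := by
  simp only [wt, Finsupp.add_apply]; ring

/-- The ideal of series all of whose monomials have order at least `n`. -/
def ordIdeal (n : ℕ) : Ideal FSeries where
  carrier := {f | ∀ d, wt d < n → coeff d f = 0}
  add_mem' hf hg d hd := by rw [map_add, hf d hd, hg d hd, add_zero]
  zero_mem' d _ := by simp
  smul_mem' c f hf d hd := by
    classical
    rw [smul_eq_mul, coeff_mul]
    refine Finset.sum_eq_zero fun p hp => ?_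
    have : p.1 + p.2 = d := Finset.HasAntidiagonal.mem_antidiagonal.1 hp
    rw [hf p.2 (by rw [← this, wt_add] at hd; omega), mul_zero]

lemma mem_ordIdeal_expo {n : ℕ} {f : FSeries} :
    f ∈ ordIdeal n ↔ ∀ k l m, k + l + 3 * m < n → coeff (expo k l m) f = 0 := by
  refine ⟨fun h k l m hd => h _ hd, fun h d hd => ?_⟩
  rw [← expo_eta d]; exact h _ _ _ hd

lemma orderAtLeastThree_iff {h : FSeries} : OrderAtLeastThree h ↔ h ∈ ordIdeal 3 := by
  refine forall_congr' fun d => ?_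
  rw [show d 0 + d 1 + 3 * d 2 = wt d from rfl, ← not_lt]
  tauto

lemma ordIdeal_anti {m n : ℕ} (h : m ≤ n) : ordIdeal n ≤ ordIdeal m :=
  fun _ hf d hd => hf d (hd.trans_le h)

lemma mem_of_le {m n : ℕ} {f : FSeries} (hf : f ∈ ordIdeal n) (h : m ≤ n) : f ∈ ordIdeal m :=
  ordIdeal_anti h hf

@[simp] lemma mem_ordIdeal_zero (f : FSeries) : f ∈ ordIdeal 0 := fun _ h => by omega

lemma smul_mem_ordIdeal {n : ℕ} {f : FSeries} (r : ℝ) (hf : f ∈ ordIdeal n) :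
    r • f ∈ ordIdeal n := by
  rw [smul_eq_C_mul]; exact Ideal.mul_mem_left _ _ hf

lemma mul_mem_ordIdeal {m n : ℕ} {f g : FSeries} (hf : f ∈ ordIdeal m) (hg : g ∈ ordIdeal n) :
    f * g ∈ ordIdeal (m + n) := by
  classical
  intro d hd
  rw [coeff_mul]
  refine Finset.sum_eq_zero fun p hp => ?_
  have : p.1 + p.2 = d := Finset.HasAntidiagonal.mem_antidiagonal.1 hp
  rw [← this, wt_add] at hd
  by_cases h : wt p.1 < m
  · rw [hf _ h, zero_mul]
  · rw [hg p.2 (by omega), mul_zero]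

lemma pow_mem_ordIdeal {n : ℕ} {f : FSeries} (hf : f ∈ ordIdeal n) (k : ℕ) :
    f ^ k ∈ ordIdeal (n * k) := by
  induction k with
  | zero => simp
  | succ k ih => rw [pow_succ]; exact mul_mem_ordIdeal ih hf

lemma eq_zero_of_forall_mem {f : FSeries} (h : ∀ n, f ∈ ordIdeal n) : f = 0 := by
  ext d; exact h (wt d + 1) d (Nat.lt_succ_self _)

lemma eq_of_forall_sub_mem {f g : FSeries} (h : ∀ n, f - g ∈ ordIdeal n) : f = g :=
  sub_eq_zero.1 (eq_zero_of_forall_mem h)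

lemma monomial_mem_ordIdeal (k l m : ℕ) (a : ℝ) :
    (monomial (expo k l m) a : FSeries) ∈ ordIdeal (k + l + 3 * m) := by
  classical
  intro d hd
  rw [coeff_monomial, if_neg]
  rintro rfl
  simp [wt] at hd

lemma X_zero_mem : (X 0 : FSeries) ∈ ordIdeal 1 := X_zero_eq ▸ monomial_mem_ordIdeal 1 0 0 1
lemma X_one_mem : (X 1 : FSeries) ∈ ordIdeal 1 := X_one_eq ▸ monomial_mem_ordIdeal 0 1 0 1
lemma X_two_mem : (X 2 : FSeries) ∈ ordIdeal 3 := X_two_eq ▸ monomial_mem_ordIdeal 0 0 1 1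

lemma mem_ordIdeal_one {f : FSeries} : f ∈ ordIdeal 1 ↔ constantCoeff f = 0 := by
  have h0 : (0 : Fin 3 →₀ ℕ) = expo 0 0 0 := by ext i; fin_cases i <;> rfl
  rw [mem_ordIdeal_expo, ← coeff_zero_eq_constantCoeff_apply, h0]
  refine ⟨fun h => h 0 0 0 (by omega), fun h k l m hd => ?_⟩
  obtain ⟨rfl, rfl, rfl⟩ : k = 0 ∧ l = 0 ∧ m = 0 := by omega
  exact h

lemma pderiv_zero_mem {n : ℕ} {f : FSeries} (hf : f ∈ ordIdeal n) :
    pderiv ℝ 0 f ∈ ordIdeal (n - 1) := by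
  rw [mem_ordIdeal_expo] at hf ⊢
  intro k l m hd
  rw [coeff_pderiv_zero, hf _ _ _ (by omega), zero_mul]

lemma pderiv_one_mem {n : ℕ} {f : FSeries} (hf : f ∈ ordIdeal n) :
    pderiv ℝ 1 f ∈ ordIdeal (n - 1) := by
  rw [mem_ordIdeal_expo] at hf ⊢
  intro k l m hd
  rw [coeff_pderiv_one, hf _ _ _ (by omega), zero_mul]

/-- Hadamard's lemma for the weight filtration. -/
lemma exists_eq_add_X_mul {n : ℕ} {f : FSeries} (hf : f ∈ ordIdeal n) :
    ∃ (c : ℝ) (f₀ f₁ f₂ : FSeries), f = C c + X 0 * f₀ + X 1 * f₁ + X 2 * f₂ ∧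
      f₀ ∈ ordIdeal (n - 1) ∧ f₁ ∈ ordIdeal (n - 1) ∧ f₂ ∈ ordIdeal (n - 3) := by
  rw [mem_ordIdeal_expo] at hf
  -- Each non-constant monomial goes to the first of x, y, ε that divides it, so the pieces have
  -- disjoint supports and inherit the bounds on the order.
  refine ⟨coeff (expo 0 0 0) f, ofCoeffs fun k l m => coeff (expo (k + 1) l m) f,
    ofCoeffs fun k l m => if k = 0 then coeff (expo k (l + 1) m) f else 0,
    ofCoeffs fun k l m => if k = 0 ∧ l = 0 then coeff (expo k l (m + 1)) f else 0,
    series_ext fun k l m => ?_, ?_, ?_, ?_⟩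
  · rw [X_zero_eq, X_one_eq, X_two_eq]
    simp only [map_add, coeff_monomial_mul_expo, coeff_ofCoeffs, coeff_C_expo]
    rcases k with _ | k
    · rcases l with _ | l
      · rcases m with _ | m <;> simp
      · simp
    · simp
  · rw [mem_ordIdeal_expo]
    intro k l m hd
    rw [coeff_ofCoeffs, hf _ _ _ (by omega)]
  · rw [mem_ordIdeal_expo]
    intro k l m hd
    rw [coeff_ofCoeffs, hf _ _ _ (by omega), ite_self]
  · rw [mem_ordIdeal_expo]
    intro k l m hd
    rw [coeff_ofCoeffs, hf _ _ _ (by omega), ite_self]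

/-! ### The Poisson bracket -/

lemma pderiv_mul' (i : Fin 3) (f g : FSeries) :
    pderiv ℝ i (f * g) = f * pderiv ℝ i g + g * pderiv ℝ i f := by
  rw [Derivation.leibniz]; rfl

lemma pderiv_comm (f : FSeries) :
    pderiv ℝ 0 (pderiv ℝ 1 f) = pderiv ℝ 1 (pderiv ℝ 0 f) := by
  refine series_ext fun k l m => ?_
  simp only [coeff_pderiv_zero, coeff_pderiv_one]
  ring

/-- The Lie derivative as a linear operator. -/
def lieOp (h : FSeries) : Module.End ℝ FSeries where
  toFun := lieD h
  map_add' f g := by simp only [lieD, bracket, map_add]; ring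
  map_smul' r f := by
    simp only [lieD, bracket, Derivation.map_smul, RingHom.id_apply, smul_mul_assoc, smul_sub]

lemma lieOp_apply (h f : FSeries) :
    lieOp h f = pderiv ℝ 0 f * pderiv ℝ 1 h - pderiv ℝ 1 f * pderiv ℝ 0 h := rfl

lemma lieOp_add (g h : FSeries) : lieOp (g + h) = lieOp g + lieOp h := by
  ext1 f; simp only [lieOp_apply, LinearMap.add_apply, map_add]; ring

lemma lieOp_smul (r : ℝ) (h : FSeries) : lieOp (r • h) = r • lieOp h := by
  ext1 f
  simp only [lieOp_apply, LinearMap.smul_apply, Derivation.map_smul, mul_smul_comm, smul_sub]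

lemma lieOp_antisymm (f g : FSeries) : lieOp f g = -lieOp g f := by
  simp only [lieOp_apply]; ring

lemma lieOp_self (f : FSeries) : lieOp f f = 0 := by
  simp only [lieOp_apply]; ring

lemma lieOp_mul (h f g : FSeries) : lieOp h (f * g) = lieOp h f * g + f * lieOp h g := by
  simp only [lieOp_apply, pderiv_mul']; ring

lemma lieOp_bracket (h f g : FSeries) :
    lieOp h (bracket f g) = bracket (lieOp h f) g + bracket f (lieOp h g) := by
  simp only [lieOp_apply, bracket, pderiv_mul', map_sub, pderiv_comm]; ring

lemma lieOp_X_zero (h : FSeries) : lieOp h (X 0) = pderiv ℝ 1 h := by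
  rw [lieOp_apply, pderiv_X_self, pderiv_X_of_ne (by decide)]; ring

lemma lieOp_X_one (h : FSeries) : lieOp h (X 1) = -pderiv ℝ 0 h := by
  rw [lieOp_apply, pderiv_X_self, pderiv_X_of_ne (by decide)]; ring

lemma lieOp_X_two (h : FSeries) : lieOp h (X 2) = 0 := by
  rw [lieOp_apply, pderiv_X_of_ne (by decide), pderiv_X_of_ne (by decide)]; ring

lemma bracket_X : bracket (X 0) (X 1) = 1 := by
  rw [bracket, pderiv_X_self, pderiv_X_self, pderiv_X_of_ne (by decide),
    pderiv_X_of_ne (by decide)]; ring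

lemma bracket_mem {m n : ℕ} {f g : FSeries} (hf : f ∈ ordIdeal m) (hg : g ∈ ordIdeal n) :
    bracket f g ∈ ordIdeal (m + n - 2) :=
  sub_mem (mem_of_le (mul_mem_ordIdeal (pderiv_zero_mem hf) (pderiv_one_mem hg)) (by omega))
    (mem_of_le (mul_mem_ordIdeal (pderiv_one_mem hf) (pderiv_zero_mem hg)) (by omega))

/-- The two derivatives cost two orders. Hence a Hamiltonian of order at least three raises orders
strictly, which is what makes its exponential converge. -/
lemma lieOp_mem {k n : ℕ} {h f : FSeries} (hh : h ∈ ordIdeal (k + 2)) (hf : f ∈ ordIdeal n) :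
    lieOp h f ∈ ordIdeal (n + k) :=
  mem_of_le (bracket_mem hf hh) (by omega)

lemma lieOp_pow_mem {k n : ℕ} {h f : FSeries} (hh : h ∈ ordIdeal (k + 2)) (hf : f ∈ ordIdeal n)
    (j : ℕ) : (lieOp h ^ j) f ∈ ordIdeal (n + j * k) := by
  induction j with
  | zero => simpa using hf
  | succ j ih =>
    rw [pow_succ', Module.End.mul_apply]
    exact mem_of_le (lieOp_mem hh ih) (by rw [Nat.succ_mul]; omega)

/-! ### Filtered endomorphisms -/

/-- Endomorphisms of the algebra of formal power series. -/
abbrev SeriesEnd := FSeries →ₐ[ℝ] FSeries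

/-- Endomorphisms that respect the weight filtration and fix the parameter. -/
structure IsFiltered (α : SeriesEnd) : Prop where
  mem : ∀ {n f}, f ∈ ordIdeal n → α f ∈ ordIdeal n
  X_two : α (X 2) = X 2

lemma IsFiltered.one : IsFiltered 1 := ⟨fun h => h, rfl⟩

lemma IsFiltered.mul {α β : SeriesEnd} (hα : IsFiltered α) (hβ : IsFiltered β) :
    IsFiltered (α * β) :=
  ⟨fun h => hα.mem (hβ.mem h), by rw [AlgHom.mul_apply, hβ.X_two, hα.X_two]⟩

lemma map_C' (α : SeriesEnd) (c : ℝ) : α (C c) = C c := α.commutes c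

/-- No continuity of `α` is assumed, so values on the variables do not formally determine `α`.
Repeated division by the variables does: each division puts the image of a variable in front and
gains an order. -/
lemma isFiltered_of_generators {α : SeriesEnd} (h0 : α (X 0) ∈ ordIdeal 1)
    (h1 : α (X 1) ∈ ordIdeal 1) (h2 : α (X 2) = X 2) : IsFiltered α := by
  refine ⟨fun {n f} hf => ?_, h2⟩
  have key : ∀ j n f, f ∈ ordIdeal n → α f ∈ ordIdeal (min j n) := by
    intro j
    induction j with
    | zero => intro n f _; simp
    | succ j ih =>
      intro n f hf
      obtain ⟨c, f₀, f₁, f₂, rfl, hf0, hf1, hf2⟩ := exists_eq_add_X_mul hf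
      have hc : (C c : FSeries) ∈ ordIdeal n := by
        have := sub_mem (sub_mem (sub_mem hf
          (mem_of_le (mul_mem_ordIdeal X_zero_mem hf0) (m := n) (by omega)))
          (mem_of_le (mul_mem_ordIdeal X_one_mem hf1) (m := n) (by omega)))
          (mem_of_le (mul_mem_ordIdeal X_two_mem hf2) (m := n) (by omega))
        convert this using 1; ring
      rw [map_add, map_add, map_add, map_mul, map_mul, map_mul, map_C', h2]
      refine add_mem (add_mem (add_mem (mem_of_le hc (by omega)) ?_) ?_) ?_
      · exact mem_of_le (mul_mem_ordIdeal h0 (ih _ _ hf0)) (by omega)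
      · exact mem_of_le (mul_mem_ordIdeal h1 (ih _ _ hf1)) (by omega)
      · exact mem_of_le (mul_mem_ordIdeal X_two_mem (ih _ _ hf2)) (by omega)
  simpa using key n n f hf

/-- Congruence of endomorphisms: `α - β` raises the order by at least `k`. -/
def Cong (k : ℕ) (α β : SeriesEnd) : Prop :=
  ∀ ⦃n f⦄, f ∈ ordIdeal n → α f - β f ∈ ordIdeal (n + k)

lemma Cong.refl (k : ℕ) (α : SeriesEnd) : Cong k α α := fun n f _ => by simp

lemma Cong.symm {k : ℕ} {α β : SeriesEnd} (h : Cong k α β) : Cong k β α := fun n f hf => by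
  rw [← neg_sub]; exact neg_mem (h hf)

lemma Cong.trans {k : ℕ} {α β γ : SeriesEnd} (h : Cong k α β) (h' : Cong k β γ) :
    Cong k α γ := fun n f hf => by
  rw [← sub_add_sub_cancel]; exact add_mem (h hf) (h' hf)

lemma Cong.mono {j k : ℕ} {α β : SeriesEnd} (h : Cong k α β) (hjk : j ≤ k) : Cong j α β :=
  fun _ _ hf => mem_of_le (h hf) (by omega)

lemma Cong.mul_left {k : ℕ} {α β : SeriesEnd} (h : Cong k α β) {γ : SeriesEnd}
    (hγ : IsFiltered γ) : Cong k (γ * α) (γ * β) := fun n f hf => by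
  rw [AlgHom.mul_apply, AlgHom.mul_apply, ← map_sub]; exact hγ.mem (h hf)

lemma Cong.mul_right {k : ℕ} {α β : SeriesEnd} (h : Cong k α β) {γ : SeriesEnd}
    (hγ : IsFiltered γ) : Cong k (α * γ) (β * γ) := fun _ _ hf => h (hγ.mem hf)

lemma Cong.mul {k : ℕ} {α β α' β' : SeriesEnd} (h : Cong k α β) (h' : Cong k α' β')
    (hβ : IsFiltered β) (hα' : IsFiltered α') : Cong k (α * α') (β * β') :=
  (h.mul_right hα').trans (h'.mul_left hβ)

lemma eq_of_forall_cong {α β : SeriesEnd} (h : ∀ k, Cong k α β) : α = β := by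
  ext1 f
  refine eq_of_forall_sub_mem fun n => ?_
  simpa using h n (mem_ordIdeal_zero f)

lemma cong_of_generators {k : ℕ} {α β : SeriesEnd} (hα : IsFiltered α) (hβ : IsFiltered β)
    (h0 : α (X 0) - β (X 0) ∈ ordIdeal (1 + k)) (h1 : α (X 1) - β (X 1) ∈ ordIdeal (1 + k)) :
    Cong k α β := by
  -- Induction on `n` alone would be circular at `n = 0`, where the cofactors again have order at
  -- least 0 only. The cap `j` grows with each division.
  have key : ∀ j n f, f ∈ ordIdeal n → α f - β f ∈ ordIdeal (min j (n + k)) := by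
    intro j
    induction j with
    | zero => intro n f _; simp
    | succ j ih =>
      intro n f hf
      obtain ⟨c, f₀, f₁, f₂, rfl, hf0, hf1, hf2⟩ := exists_eq_add_X_mul hf
      simp only [map_add, map_mul, map_C', hα.X_two, hβ.X_two]
      have : ∀ p q r : FSeries, ∀ p' q' r' : FSeries,
          C c + p + q + r - (C c + p' + q' + r') = (p - p') + (q - q') + (r - r') := by
        intros; ring
      rw [this]
      have h2 : ∀ p q r s : FSeries, p * q - r * s = (p - r) * q + r * (q - s) := by
        intros; ring
      refine add_mem (add_mem ?_ ?_) ?_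
      · rw [h2]
        exact add_mem (mem_of_le (mul_mem_ordIdeal h0 (hα.mem hf0)) (by omega))
          (mem_of_le (mul_mem_ordIdeal (hβ.mem X_zero_mem) (ih _ _ hf0)) (by omega))
      · rw [h2]
        exact add_mem (mem_of_le (mul_mem_ordIdeal h1 (hα.mem hf1)) (by omega))
          (mem_of_le (mul_mem_ordIdeal (hβ.mem X_one_mem) (ih _ _ hf1)) (by omega))
      · rw [← mul_sub]
        exact mem_of_le (mul_mem_ordIdeal X_two_mem (ih _ _ hf2)) (by omega)
  intro n f hf
  simpa using key (n + k) n f hf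

lemma eq_of_generators {α β : SeriesEnd} (hα : IsFiltered α) (hβ : IsFiltered β)
    (h0 : α (X 0) = β (X 0)) (h1 : α (X 1) = β (X 1)) : α = β :=
  eq_of_forall_cong fun k => cong_of_generators hα hβ (by simp [h0]) (by simp [h1])

/-! ### Bracket-preserving endomorphisms -/

lemma bracket_sub_left (f g h : FSeries) : bracket (f - g) h = bracket f h - bracket g h := by
  simp only [bracket, map_sub]; ring

lemma bracket_sub_right (f g h : FSeries) : bracket f (g - h) = bracket f g - bracket f h := by
  simp only [bracket, map_sub]; ring

/-- `α` multiplies the Poisson bracket by the constant `s`. -/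
def ScalesBracket (s : ℝ) (α : SeriesEnd) : Prop :=
  ∀ f g, bracket (α f) (α g) = s • α (bracket f g)

lemma ScalesBracket.mul {s t : ℝ} {α β : SeriesEnd} (hα : ScalesBracket s α)
    (hβ : ScalesBracket t β) : ScalesBracket (s * t) (α * β) := fun f g => by
  simp only [AlgHom.mul_apply]
  rw [hα, hβ, map_smul, smul_smul]

/-- Canonical automorphisms: those induced by canonical changes of variables. -/
structure IsCanonicalAut (β : SeriesEndˣ) : Prop where
  filtered : IsFiltered (β : SeriesEnd)
  filtered_inv : IsFiltered (↑β⁻¹ : SeriesEnd)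
  bracket : ScalesBracket 1 (β : SeriesEnd)

lemma units_inv_apply (β : SeriesEndˣ) (f : FSeries) :
    (↑β⁻¹ : SeriesEnd) ((β : SeriesEnd) f) = f := by
  rw [← AlgHom.mul_apply, Units.inv_mul, AlgHom.one_apply]

lemma units_apply_inv (β : SeriesEndˣ) (f : FSeries) :
    (β : SeriesEnd) ((↑β⁻¹ : SeriesEnd) f) = f := by
  rw [← AlgHom.mul_apply, Units.mul_inv, AlgHom.one_apply]

lemma IsCanonicalAut.map_bracket {β : SeriesEndˣ} (h : IsCanonicalAut β) (f g : FSeries) :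
    (β : SeriesEnd) (ReversingMaps.bracket f g) =
      ReversingMaps.bracket ((β : SeriesEnd) f) ((β : SeriesEnd) g) := by
  rw [h.bracket, one_smul]

lemma IsCanonicalAut.one : IsCanonicalAut 1 :=
  ⟨IsFiltered.one, by simpa using IsFiltered.one, fun f g => by simp⟩

lemma IsCanonicalAut.inv {β : SeriesEndˣ} (h : IsCanonicalAut β) : IsCanonicalAut β⁻¹ := by
  refine ⟨h.filtered_inv, by simpa using h.filtered, fun f g => ?_⟩
  have h1 : ∀ p : FSeries, (↑β⁻¹ : SeriesEnd) ((β : SeriesEnd) p) = p := units_inv_apply β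
  rw [one_smul, ← h1 (ReversingMaps.bracket _ _), h.map_bracket, units_apply_inv,
    units_apply_inv]

lemma IsCanonicalAut.mul {α β : SeriesEndˣ} (hα : IsCanonicalAut α) (hβ : IsCanonicalAut β) :
    IsCanonicalAut (α * β) := by
  refine ⟨hα.filtered.mul hβ.filtered, ?_, ?_⟩
  · rw [mul_inv_rev]; exact hβ.filtered_inv.mul hα.filtered_inv
  · have := hα.bracket.mul hβ.bracket
    rwa [one_mul] at this

lemma Cong.inv {k : ℕ} {α β : SeriesEndˣ} (hα : IsCanonicalAut α) (hβ : IsCanonicalAut β)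
    (h : Cong k (α : SeriesEnd) β) : Cong k (↑α⁻¹ : SeriesEnd) ↑β⁻¹ := by
  have := (h.symm.mul_left hα.filtered_inv).mul_right hβ.filtered_inv
  rwa [mul_assoc, Units.mul_inv, mul_one, Units.inv_mul, one_mul] at this

/-! ### Limits -/

lemma cong_of_le {α : ℕ → SeriesEnd} (h : ∀ n, Cong n (α (n + 1)) (α n)) {m n : ℕ}
    (hmn : m ≤ n) : Cong m (α n) (α m) := by
  induction n, hmn using Nat.le_induction with
  | base => exact Cong.refl _ _
  | succ n hn ih => exact ((h n).mono hn).trans ih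

/-- The coefficient at `d` of `α n f` is constant for `n > wt d`, which defines the limit. The
algebra identities hold for it modulo every order, hence exactly. -/
lemma exists_limit {α : ℕ → SeriesEnd} (hα : ∀ n, IsFiltered (α n))
    (h : ∀ n, Cong n (α (n + 1)) (α n)) :
    ∃ β : SeriesEnd, IsFiltered β ∧ ∀ n, Cong n β (α n) := by
  let b : FSeries → FSeries := fun f d => coeff d (α (wt d + 1) f)
  have hb : ∀ f N, b f - α N f ∈ ordIdeal N := by
    intro f N d hd
    have h1 : coeff d (b f) = coeff d (α (wt d + 1) f) := rfl
    have h2 := cong_of_le h (show wt d + 1 ≤ N from hd) (mem_ordIdeal_zero f) d (by omega)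
    rw [map_sub] at h2
    rw [map_sub, h1, ← neg_sub, h2, neg_zero]
  have hb' : ∀ f c, (∀ N, c - α N f ∈ ordIdeal N) → b f = c := by
    intro f c hc
    refine eq_of_forall_sub_mem fun N => ?_
    rw [← sub_sub_sub_cancel_right _ _ (α N f)]
    exact sub_mem (hb f N) (hc N)
  let β : SeriesEnd :=
    { toFun := b
      map_one' := hb' _ _ fun N => by simp
      map_zero' := hb' _ _ fun N => by simp
      map_mul' := fun f g => hb' _ _ fun N => by
        rw [map_mul, show b f * b g - α N f * α N g =
          (b f - α N f) * b g + α N f * (b g - α N g) by ring]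
        exact add_mem (Ideal.mul_mem_right _ _ (hb f N)) (Ideal.mul_mem_left _ _ (hb g N))
      map_add' := fun f g => hb' _ _ fun N => by
        rw [map_add, add_sub_add_comm]; exact add_mem (hb f N) (hb g N)
      commutes' := fun r => hb' _ _ fun N => by simp }
  have hβ : ∀ n, Cong n β (α n) := fun n m f hf => by
    rw [← sub_add_sub_cancel _ (α (m + n) f)]
    exact add_mem (hb f (m + n)) (cong_of_le h (Nat.le_add_left n m) hf)
  refine ⟨β, ⟨fun {n f} hf => ?_, hb' _ _ fun N => by simp [(hα N).X_two]⟩, hβ⟩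
  rw [← sub_add_cancel (β f) (α 0 f)]
  exact add_mem (hβ 0 hf) ((hα 0).mem hf)

lemma ScalesBracket.of_limit {s : ℝ} {α : ℕ → SeriesEnd} {β : SeriesEnd}
    (hα : ∀ n, ScalesBracket s (α n)) (h : ∀ n, Cong n β (α n)) : ScalesBracket s β := by
  intro f g
  refine eq_of_forall_sub_mem fun n => ?_
  -- Two orders are spent by the derivatives in the bracket.
  have hf := h (n + 2) (mem_ordIdeal_zero f)
  have hg := h (n + 2) (mem_ordIdeal_zero g)
  have hfg := h (n + 2) (mem_ordIdeal_zero (bracket f g))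
  have h1 : bracket (β f) (β g) - s • β (bracket f g) =
      bracket (β f - α (n + 2) f) (β g) + bracket (α (n + 2) f) (β g - α (n + 2) g)
        - s • (β (bracket f g) - α (n + 2) (bracket f g)) := by
    rw [bracket_sub_left, bracket_sub_right, hα (n + 2) f g, smul_sub]; ring
  rw [h1]
  exact sub_mem (add_mem (mem_of_le (bracket_mem hf (mem_ordIdeal_zero _)) (by omega))
    (mem_of_le (bracket_mem (mem_ordIdeal_zero _) hg) (by omega)))
    (smul_mem_ordIdeal _ (mem_of_le hfg (by omega)))

/-- Congruences pass to inverses, so the inverses converge as well, and the two limits are inverse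
to each other modulo every order. -/
lemma exists_limit_canonical {α : ℕ → SeriesEndˣ} (hα : ∀ n, IsCanonicalAut (α n))
    (h : ∀ n, Cong n (α (n + 1) : SeriesEnd) (α n)) :
    ∃ β : SeriesEndˣ, IsCanonicalAut β ∧ ∀ n, Cong n (β : SeriesEnd) (α n) := by
  have h' : ∀ n, Cong n (↑(α (n + 1))⁻¹ : SeriesEnd) ↑(α n)⁻¹ :=
    fun n => Cong.inv (hα _) (hα _) (h n)
  obtain ⟨β, hβ, hl⟩ := exists_limit (fun n => (hα n).filtered) h
  obtain ⟨γ, hγ, hl'⟩ := exists_limit (fun n => (hα n).filtered_inv) h'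
  refine ⟨⟨β, γ, eq_of_forall_cong fun k => ?_, eq_of_forall_cong fun k => ?_⟩,
    ⟨hβ, hγ, ScalesBracket.of_limit (fun n => (hα n).bracket) hl⟩, hl⟩
  · have := (hl k).mul (hl' k) (hα k).filtered hγ
    rwa [Units.mul_inv] at this
  · have := (hl' k).mul (hl k) (hα k).filtered_inv hβ
    rwa [Units.inv_mul] at this

/-! ### The exponential of a Lie derivative -/

/-- The partial sums of the exponential series of an operator. -/
def expSum (N : ℕ) (D : Module.End ℝ FSeries) : Module.End ℝ FSeries :=
  ∑ k ∈ Finset.range N, ((k.factorial : ℝ)⁻¹) • D ^ k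

lemma expSum_apply (N : ℕ) (D : Module.End ℝ FSeries) (f : FSeries) :
    expSum N D f = ∑ k ∈ Finset.range N, ((k.factorial : ℝ)⁻¹) • (D ^ k) f := by
  simp [expSum, LinearMap.sum_apply]

/-- Every application of L_h gains `k` orders, so the terms from index `N` on are invisible below
order `n + N * k`. Below that order the `finsum` therefore has finite support and is a genuine sum.
-/
lemma expLie_sub_expSum_mem {k n : ℕ} {h f : FSeries} (hh : h ∈ ordIdeal (k + 2))
    (hf : f ∈ ordIdeal n) (N : ℕ) :
    expLie h f - expSum N (lieOp h) f ∈ ordIdeal (n + N * k) := by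
  intro d hd
  have hz : ∀ j, N ≤ j → coeff d ((lieD h)^[j] f) = 0 := by
    intro j hj
    have h1 : (lieD h)^[j] f = (lieOp h ^ j) f := by
      rw [Module.End.pow_apply]; rfl
    rw [h1]
    exact lieOp_pow_mem hh hf j d (hd.trans_le (by gcongr))
  have h2 : coeff d (expLie h f) =
      ∑ j ∈ Finset.range N, ((j.factorial : ℝ))⁻¹ * coeff d ((lieD h)^[j] f) := by
    refine finsum_eq_sum_of_support_subset _ fun j hj => ?_
    rw [Finset.coe_range, Set.mem_Iio]
    by_contra hlt
    exact hj (by simp only [hz j (not_lt.1 hlt), mul_zero])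
  rw [map_sub, h2, expSum_apply, map_sum, sub_eq_zero]
  refine Finset.sum_congr rfl fun j _ => ?_
  rw [map_smul, smul_eq_mul, Module.End.pow_apply]; rfl

/-- The two surplus terms of the partial sum pay for the two orders that a bracket may lose in
`expLie_bilinear`. -/
lemma expLie_eq_of_forall {h : FSeries} (hh : h ∈ ordIdeal 3) {f c : FSeries}
    (H : ∀ N, c - expSum (N + 2) (lieOp h) f ∈ ordIdeal N) : expLie h f = c := by
  refine eq_of_forall_sub_mem fun N => ?_
  have h1 := expLie_sub_expSum_mem (k := 1) hh (mem_ordIdeal_zero f) (N + 2)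
  rw [← sub_sub_sub_cancel_right _ _ (expSum (N + 2) (lieOp h) f)]
  exact sub_mem (mem_of_le h1 (by omega)) (H N)

lemma expLie_sub_expSum_mem' {h : FSeries} (hh : h ∈ ordIdeal 3) (f : FSeries) (N : ℕ) :
    expLie h f - expSum N (lieOp h) f ∈ ordIdeal N := by
  simpa using expLie_sub_expSum_mem (k := 1) hh (mem_ordIdeal_zero f) N

lemma inv_factorial_smul_choose {V : Type*} [AddCommGroup V] [Module ℝ V] {k : ℕ} {p : ℕ × ℕ}
    (hp : p ∈ Finset.HasAntidiagonal.antidiagonal k) (v : V) :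
    ((k.factorial : ℝ)⁻¹) • (k.choose p.1 • v) =
      (((p.1.factorial : ℝ)⁻¹) * ((p.2.factorial : ℝ)⁻¹)) • v := by
  have hp' : p.1 + p.2 = k := Finset.HasAntidiagonal.mem_antidiagonal.1 hp
  subst hp'
  rw [← Nat.cast_smul_eq_nsmul ℝ, smul_smul]
  congr 1
  have := Nat.add_choose_mul_factorial_mul_factorial p.1 p.2
  have h1 : ((p.1 + p.2).choose p.1 : ℝ) * p.1.factorial * p.2.factorial =
      (p.1 + p.2).factorial := by
    rw [Nat.choose_symm_add]; exact_mod_cast this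
  have := Nat.factorial_ne_zero p.1
  have := Nat.factorial_ne_zero p.2
  have := Nat.factorial_ne_zero (p.1 + p.2)
  field_simp
  linarith

/-- Comparison of a triangular with a square partial sum of a double series. -/
lemma sum_antidiagonal_sub_sum_mem {c : ℕ → ℕ → FSeries}
    (hc : ∀ i j, c i j ∈ ordIdeal (i + j - 2)) (N : ℕ) :
    (∑ k ∈ Finset.range N, ∑ p ∈ Finset.HasAntidiagonal.antidiagonal k, c p.1 p.2) -
      ∑ i ∈ Finset.range N, ∑ j ∈ Finset.range N, c i j ∈ ordIdeal (N - 2) := by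
  have h1 : (∑ k ∈ Finset.range N, ∑ p ∈ Finset.HasAntidiagonal.antidiagonal k, c p.1 p.2) =
      ∑ i ∈ Finset.range N, ∑ j ∈ Finset.range (N - i), c i j := by
    rw [← Finset.sum_range_diag_flip N c]
    refine Finset.sum_congr rfl fun k _ => ?_
    rw [Finset.Nat.sum_antidiagonal_eq_sum_range_succ]
  rw [h1, ← Finset.sum_sub_distrib]
  refine sum_mem fun i hi => ?_
  rw [← Finset.sum_range_add_sum_Ico (c i) (Nat.sub_le N i), sub_add_cancel_left]
  refine neg_mem (sum_mem fun j hj => mem_of_le (hc i j) ?_)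
  have := (Finset.mem_Ico.1 hj).1
  omega

/-- On the tensor square the operator becomes D ⊗ 1 + 1 ⊗ D, a sum of commuting operators, and the
Leibniz formula is the binomial theorem for it. -/
lemma leibniz_pow {D : Module.End ℝ FSeries} (μ : FSeries →ₗ[ℝ] FSeries →ₗ[ℝ] FSeries)
    (hμ : ∀ f g, D (μ f g) = μ (D f) g + μ f (D g)) (k : ℕ) (f g : FSeries) :
    (D ^ k) (μ f g) = ∑ p ∈ Finset.HasAntidiagonal.antidiagonal k,
      k.choose p.1 • μ ((D ^ p.1) f) ((D ^ p.2) g) := by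
  let A : Module.End ℝ (TensorProduct ℝ FSeries FSeries) := TensorProduct.map D LinearMap.id
  let B : Module.End ℝ (TensorProduct ℝ FSeries FSeries) := TensorProduct.map LinearMap.id D
  have hAB : Commute A B := by
    refine TensorProduct.ext' fun x y => ?_
    simp [A, B]
  have hD : ∀ t, D (TensorProduct.lift μ t) = TensorProduct.lift μ ((A + B) t) := by
    intro t
    refine LinearMap.congr_fun (f := D ∘ₗ TensorProduct.lift μ)
      (g := TensorProduct.lift μ ∘ₗ (A + B)) (TensorProduct.ext' fun x y => ?_) t
    simp [A, B, hμ]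
  have hDk : ∀ t, (D ^ k) (TensorProduct.lift μ t) = TensorProduct.lift μ (((A + B) ^ k) t) := by
    induction k with
    | zero => intro t; simp
    | succ k ih =>
      intro t
      rw [pow_succ', pow_succ', Module.End.mul_apply, Module.End.mul_apply, ih, hD]
  have hA : ∀ i x y, (A ^ i) (x ⊗ₜ[ℝ] y) = ((D ^ i) x) ⊗ₜ[ℝ] y := by
    intro i
    induction i with
    | zero => simp
    | succ i ih =>
      intro x y; rw [pow_succ', pow_succ', Module.End.mul_apply, ih]; simp [A]
  have hB : ∀ i x y, (B ^ i) (x ⊗ₜ[ℝ] y) = x ⊗ₜ[ℝ] ((D ^ i) y) := by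
    intro i
    induction i with
    | zero => simp
    | succ i ih =>
      intro x y; rw [pow_succ', pow_succ', Module.End.mul_apply, ih]; simp [B]
  have := hDk (f ⊗ₜ[ℝ] g)
  rw [TensorProduct.lift.tmul, hAB.add_pow', LinearMap.sum_apply, map_sum] at this
  rw [this]
  refine Finset.sum_congr rfl fun p _ => ?_
  rw [LinearMap.smul_apply, map_nsmul, Module.End.mul_apply, hB, hA, TensorProduct.lift.tmul]

/-- The exponential of a derivation of a bilinear operation respects that operation. -/
lemma expLie_bilinear {h : FSeries} (hh : h ∈ ordIdeal 3)
    (μ : FSeries →ₗ[ℝ] FSeries →ₗ[ℝ] FSeries)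
    (hμ : ∀ f g, lieOp h (μ f g) = μ (lieOp h f) g + μ f (lieOp h g))
    (hmem : ∀ {m n f g}, f ∈ ordIdeal m → g ∈ ordIdeal n → μ f g ∈ ordIdeal (m + n - 2))
    (f g : FSeries) : expLie h (μ f g) = μ (expLie h f) (expLie h g) := by
  refine expLie_eq_of_forall hh fun N => ?_
  have h1 : expSum (N + 2) (lieOp h) (μ f g) = ∑ k ∈ Finset.range (N + 2),
      ∑ p ∈ Finset.HasAntidiagonal.antidiagonal k,
        (((p.1.factorial : ℝ)⁻¹) * ((p.2.factorial : ℝ)⁻¹)) •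
          μ ((lieOp h ^ p.1) f) ((lieOp h ^ p.2) g) := by
    rw [expSum_apply]
    refine Finset.sum_congr rfl fun k _ => ?_
    rw [leibniz_pow μ hμ, Finset.smul_sum]
    exact Finset.sum_congr rfl fun p hp => inv_factorial_smul_choose hp _
  have h2 : μ (expSum (N + 2) (lieOp h) f) (expSum (N + 2) (lieOp h) g) =
      ∑ i ∈ Finset.range (N + 2), ∑ j ∈ Finset.range (N + 2),
        (((i.factorial : ℝ)⁻¹) * ((j.factorial : ℝ)⁻¹)) •
          μ ((lieOp h ^ i) f) ((lieOp h ^ j) g) := by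
    simp only [expSum_apply, map_sum, LinearMap.sum_apply, map_smul, LinearMap.smul_apply,
      Finset.smul_sum, smul_smul]
    rw [Finset.sum_comm]
    simp only [mul_comm]
  have h3 := sum_antidiagonal_sub_sum_mem (c := fun i j =>
    (((i.factorial : ℝ)⁻¹) * ((j.factorial : ℝ)⁻¹)) • μ ((lieOp h ^ i) f) ((lieOp h ^ j) g))
    (fun i j => smul_mem_ordIdeal _ (mem_of_le (hmem
      (lieOp_pow_mem (k := 1) hh (mem_ordIdeal_zero f) i)
      (lieOp_pow_mem (k := 1) hh (mem_ordIdeal_zero g) j)) (by omega))) (N + 2)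
  rw [← h1, ← h2] at h3
  -- The tails of the two factors and the difference between triangular and square partial sums are
  -- all of high order.
  have h4 : μ (expLie h f) (expLie h g) - expSum (N + 2) (lieOp h) (μ f g) =
      μ (expLie h f - expSum (N + 2) (lieOp h) f) (expLie h g)
      + μ (expSum (N + 2) (lieOp h) f) (expLie h g - expSum (N + 2) (lieOp h) g)
      - (expSum (N + 2) (lieOp h) (μ f g) -
          μ (expSum (N + 2) (lieOp h) f) (expSum (N + 2) (lieOp h) g)) := by
    simp only [map_sub, LinearMap.sub_apply]; abel
  rw [h4]
  refine sub_mem (add_mem ?_ ?_) (mem_of_le h3 (by omega))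
  · exact mem_of_le (hmem (expLie_sub_expSum_mem' hh f _) (mem_ordIdeal_zero _)) (by omega)
  · exact mem_of_le (hmem (mem_ordIdeal_zero _) (expLie_sub_expSum_mem' hh g _)) (by omega)

/-- The time-one flow `exp(L_h)` as an endomorphism of the algebra of series. -/
def flow {h : FSeries} (hh : h ∈ ordIdeal 3) : SeriesEnd where
  toFun := expLie h
  map_one' := expLie_eq_of_forall hh fun N => by
    have h1 : lieOp h 1 = 0 := by simp [lieOp_apply]
    rw [expSum_apply, Finset.sum_range_succ', Finset.sum_eq_zero, zero_add]
    · simp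
    · intro k _
      rw [pow_succ, Module.End.mul_apply, h1, map_zero, smul_zero]
  map_zero' := expLie_eq_of_forall hh fun N => by simp
  map_mul' f g := expLie_bilinear hh (LinearMap.mul ℝ FSeries) (fun f g => lieOp_mul h f g)
    (fun hf hg => mem_of_le (mul_mem_ordIdeal hf hg) (by omega)) f g
  map_add' f g := expLie_eq_of_forall hh fun N => by
    rw [map_add, add_sub_add_comm]
    exact add_mem (mem_of_le (expLie_sub_expSum_mem' hh f _) (by omega))
      (mem_of_le (expLie_sub_expSum_mem' hh g _) (by omega))
  commutes' r := expLie_eq_of_forall hh fun N => by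
    have h1 : lieOp h (algebraMap ℝ FSeries r) = 0 := by
      simp [lieOp_apply]
    rw [expSum_apply, Finset.sum_range_succ', Finset.sum_eq_zero, zero_add]
    · simp
    · intro k _
      rw [pow_succ, Module.End.mul_apply, h1, map_zero, smul_zero]

lemma flow_congr {g h : FSeries} (hg : g ∈ ordIdeal 3) (hh : h ∈ ordIdeal 3) (e : g = h) :
    flow hg = flow hh := by subst e; rfl

lemma flow_sub_expSum_mem {k n : ℕ} {h f : FSeries} (hh : h ∈ ordIdeal 3)
    (hhk : h ∈ ordIdeal (k + 2)) (hf : f ∈ ordIdeal n) (N : ℕ) :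
    flow hh f - expSum N (lieOp h) f ∈ ordIdeal (n + N * k) :=
  expLie_sub_expSum_mem hhk hf N

lemma flow_eq_of_forall {h : FSeries} (hh : h ∈ ordIdeal 3) {f c : FSeries}
    (H : ∀ N, c - expSum N (lieOp h) f ∈ ordIdeal N) : flow hh f = c :=
  expLie_eq_of_forall hh fun N => mem_of_le (H _) (by omega)

lemma flow_apply_of_lieOp_eq_zero {h f : FSeries} (hh : h ∈ ordIdeal 3) (h0 : lieOp h f = 0) :
    flow hh f = f := by
  refine expLie_eq_of_forall hh fun N => ?_
  rw [expSum_apply, Finset.sum_range_succ', Finset.sum_eq_zero, zero_add]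
  · simp
  · intro k _
    rw [pow_succ, Module.End.mul_apply, h0, map_zero, smul_zero]

lemma cong_flow_one {k : ℕ} {h : FSeries} (hh : h ∈ ordIdeal 3)
    (hhk : h ∈ ordIdeal (k + 2)) : Cong k (flow hh) 1 := fun n f hf => by
  simpa [expSum_apply] using flow_sub_expSum_mem hh hhk hf 1

lemma flow_sub_sub_lieOp_mem {k n : ℕ} {h f : FSeries} (hh : h ∈ ordIdeal 3)
    (hhk : h ∈ ordIdeal (k + 2)) (hf : f ∈ ordIdeal n) :
    flow hh f - f - lieOp h f ∈ ordIdeal (n + 2 * k) := by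
  have h2 : expSum 2 (lieOp h) f = f + lieOp h f := by
    simp [expSum_apply, Finset.sum_range_succ]
  rw [sub_sub, ← h2]
  exact flow_sub_expSum_mem hh hhk hf 2

lemma flow_filtered {h : FSeries} (hh : h ∈ ordIdeal 3) : IsFiltered (flow hh) := by
  refine ⟨fun {n f} hf => ?_, flow_apply_of_lieOp_eq_zero hh (lieOp_X_two h)⟩
  rw [← sub_add_cancel (flow hh f) f]
  exact add_mem (mem_of_le (cong_flow_one (k := 1) hh hh hf) (by omega)) hf

/-- The Poisson bracket as a bilinear map. -/
def bracketLin : FSeries →ₗ[ℝ] FSeries →ₗ[ℝ] FSeries :=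
  LinearMap.mk₂ ℝ bracket
    (fun f g h => by simp only [bracket, map_add]; ring)
    (fun r f g => by simp only [bracket, Derivation.map_smul, smul_mul_assoc, smul_sub])
    (fun f g h => by simp only [bracket, map_add]; ring)
    (fun r f g => by simp only [bracket, Derivation.map_smul, mul_smul_comm, smul_sub])

lemma flow_scalesBracket {h : FSeries} (hh : h ∈ ordIdeal 3) : ScalesBracket 1 (flow hh) :=
  fun f g => by
    rw [one_smul]
    exact (expLie_bilinear hh bracketLin (fun f g => lieOp_bracket h f g)
      (fun hf hg => bracket_mem hf hg) f g).symm

/-- The operators L_{sh} and L_{th} commute, so the binomial theorem gives the one-parameter group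
law. It is needed for the inverse and the square of a flow. -/
lemma flow_smul_mul_flow_smul {h : FSeries} (hh : h ∈ ordIdeal 3) (s t : ℝ) :
    flow (smul_mem_ordIdeal s hh) * flow (smul_mem_ordIdeal t hh) =
      flow (smul_mem_ordIdeal (s + t) hh) := by
  ext1 f
  rw [AlgHom.mul_apply]
  symm
  refine expLie_eq_of_forall (smul_mem_ordIdeal (s + t) hh) fun N => ?_
  set S := lieOp (s • h)
  set T := lieOp (t • h)
  have hST : Commute S T := by
    simp only [S, T, lieOp_smul]
    exact ((Commute.refl (lieOp h)).smul_left s).smul_right t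
  have hadd : lieOp ((s + t) • h) = S + T := by rw [add_smul, lieOp_add]
  have h1 : expSum (N + 2) (lieOp ((s + t) • h)) f = ∑ k ∈ Finset.range (N + 2),
      ∑ p ∈ Finset.HasAntidiagonal.antidiagonal k,
        (((p.1.factorial : ℝ)⁻¹) * ((p.2.factorial : ℝ)⁻¹)) • ((S ^ p.1) ((T ^ p.2) f)) := by
    rw [expSum_apply, hadd]
    refine Finset.sum_congr rfl fun k _ => ?_
    rw [hST.add_pow', LinearMap.sum_apply, Finset.smul_sum]
    exact Finset.sum_congr rfl fun p hp => inv_factorial_smul_choose hp _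
  have h2 : expSum (N + 2) S (expSum (N + 2) T f) =
      ∑ i ∈ Finset.range (N + 2), ∑ j ∈ Finset.range (N + 2),
        (((i.factorial : ℝ)⁻¹) * ((j.factorial : ℝ)⁻¹)) • ((S ^ i) ((T ^ j) f)) := by
    simp only [expSum_apply, map_sum, map_smul, smul_smul, Finset.smul_sum]
    rw [Finset.sum_comm]
    simp only [mul_comm]
  have hS := smul_mem_ordIdeal s hh
  have hT := smul_mem_ordIdeal t hh
  have h3 := sum_antidiagonal_sub_sum_mem (c := fun i j =>
    (((i.factorial : ℝ)⁻¹) * ((j.factorial : ℝ)⁻¹)) • ((S ^ i) ((T ^ j) f)))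
    (fun i j => smul_mem_ordIdeal _ (mem_of_le (lieOp_pow_mem (k := 1) hS
      (lieOp_pow_mem (k := 1) hT (mem_ordIdeal_zero f) j) i) (by omega))) (N + 2)
  rw [← h1, ← h2] at h3
  have h4 : flow hS (flow hT f) - expSum (N + 2) (lieOp ((s + t) • h)) f =
      flow hS (flow hT f - expSum (N + 2) T f) +
      (flow hS (expSum (N + 2) T f) - expSum (N + 2) S (expSum (N + 2) T f))
      - (expSum (N + 2) (lieOp ((s + t) • h)) f - expSum (N + 2) S (expSum (N + 2) T f)) := by
    rw [map_sub]; ring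
  rw [h4]
  refine sub_mem (add_mem ?_ ?_) (mem_of_le h3 (by omega))
  · exact (flow_filtered hS).mem (mem_of_le (expLie_sub_expSum_mem' hT f (N + 2)) (by omega))
  · exact mem_of_le (expLie_sub_expSum_mem' hS _ (N + 2)) (by omega)

lemma flow_zero (h0 : (0 : FSeries) ∈ ordIdeal 3) : flow h0 = 1 := by
  ext1 f
  exact flow_apply_of_lieOp_eq_zero _ (by simp [lieOp_apply])

lemma flow_mul_flow_neg {h : FSeries} (hh : h ∈ ordIdeal 3) :
    flow hh * flow (neg_mem hh) = 1 := by
  rw [flow_congr hh (smul_mem_ordIdeal 1 hh) (one_smul _ _).symm,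
    flow_congr (neg_mem hh) (smul_mem_ordIdeal (-1) hh) (neg_one_smul _ _).symm,
    flow_smul_mul_flow_smul hh, flow_congr _ (zero_mem _) (by simp), flow_zero]

lemma flow_neg_mul_flow {h : FSeries} (hh : h ∈ ordIdeal 3) :
    flow (neg_mem hh) * flow hh = 1 := by
  have := flow_mul_flow_neg (neg_mem hh)
  rwa [flow_congr (neg_mem (neg_mem hh)) hh (neg_neg h)] at this

lemma flow_mul_self {h : FSeries} (hh : h ∈ ordIdeal 3) :
    flow hh * flow hh = flow (smul_mem_ordIdeal 2 hh) := by
  rw [flow_congr hh (smul_mem_ordIdeal 1 hh) (one_smul _ _).symm, flow_smul_mul_flow_smul hh]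
  exact flow_congr _ _ (by norm_num)

/-- The flow as a unit of the monoid of endomorphisms. -/
def flowUnit {h : FSeries} (hh : h ∈ ordIdeal 3) : SeriesEndˣ :=
  ⟨flow hh, flow (neg_mem hh), flow_mul_flow_neg hh, flow_neg_mul_flow hh⟩

@[simp] lemma coe_flowUnit {h : FSeries} (hh : h ∈ ordIdeal 3) :
    (flowUnit hh : SeriesEnd) = flow hh := rfl

lemma flowUnit_canonical {h : FSeries} (hh : h ∈ ordIdeal 3) : IsCanonicalAut (flowUnit hh) :=
  ⟨flow_filtered hh, flow_filtered (neg_mem hh), flow_scalesBracket hh⟩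

/-- Because s² = 1, `α` intertwines L_h with L_{s α h}, hence their exponentials. With s = -1 and
the reflection, odd Hamiltonians have flows that commute with it, and even ones have flows that it
inverts. -/
lemma mul_flow {α : SeriesEnd} (hα : IsFiltered α) {s : ℝ} (hs : s * s = 1)
    (hb : ScalesBracket s α) {h : FSeries} (hh : h ∈ ordIdeal 3) :
    α * flow hh = flow (smul_mem_ordIdeal s (hα.mem hh)) * α := by
  ext1 f
  rw [AlgHom.mul_apply, AlgHom.mul_apply]
  symm
  refine flow_eq_of_forall _ fun N => ?_
  have h1 : ∀ g, α (lieOp h g) = lieOp (s • α h) (α g) := by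
    intro g
    rw [lieOp_smul]
    change α (bracket g h) = s • bracket (α g) (α h)
    rw [hb, smul_smul, hs, one_smul]
  have h2 : ∀ k, α ((lieOp h ^ k) f) = (lieOp (s • α h) ^ k) (α f) := by
    intro k
    induction k with
    | zero => simp
    | succ k ih => rw [pow_succ', pow_succ', Module.End.mul_apply, Module.End.mul_apply, h1, ih]
  have h3 : expSum N (lieOp (s • α h)) (α f) = α (expSum N (lieOp h) f) := by
    simp only [expSum_apply, map_sum, map_smul, h2]
  rw [h3, ← map_sub]
  exact hα.mem (expLie_sub_expSum_mem' hh f N)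

/-- In the telescoped difference each product contains at least one factor L_b, gaining `k`, while
each of the other `j` factors gains at least one. -/
lemma lieOp_pow_add_sub_mem {k n : ℕ} {a b f : FSeries} (ha : a ∈ ordIdeal 3)
    (hb : b ∈ ordIdeal (k + 2)) (hk : 1 ≤ k) (hf : f ∈ ordIdeal n) (j : ℕ) :
    (lieOp (a + b) ^ (j + 1)) f - (lieOp a ^ (j + 1)) f ∈ ordIdeal (n + k + j) := by
  have hab : a + b ∈ ordIdeal (1 + 2) := add_mem ha (mem_of_le hb (by omega))
  induction j with
  | zero =>
    simp only [zero_add, pow_one, lieOp_add, LinearMap.add_apply, add_sub_cancel_left]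
    exact mem_of_le (lieOp_mem hb hf) (by omega)
  | succ j ih =>
    rw [pow_succ', pow_succ' (lieOp a), Module.End.mul_apply, Module.End.mul_apply]
    have : lieOp (a + b) ((lieOp (a + b) ^ (j + 1)) f) - lieOp a ((lieOp a ^ (j + 1)) f) =
        lieOp (a + b) ((lieOp (a + b) ^ (j + 1)) f - (lieOp a ^ (j + 1)) f) +
          lieOp b ((lieOp a ^ (j + 1)) f) := by
      rw [map_sub, lieOp_add, LinearMap.add_apply, LinearMap.add_apply]; ring
    rw [this]
    exact add_mem (mem_of_le (lieOp_mem hab ih) (by omega))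
      (mem_of_le (lieOp_mem hb (lieOp_pow_mem (k := 1) ha hf (j + 1))) (by omega))

/-- First-order expansion of the exponential in `b`: the terms of index 0 and 1 cancel exactly
against `lieOp b f`, and all later ones gain an extra order. -/
lemma flow_add_sub_sub_lieOp_mem {k n : ℕ} {a b f : FSeries} (ha : a ∈ ordIdeal 3)
    (hb : b ∈ ordIdeal (k + 2)) (hk : 1 ≤ k) (hab : a + b ∈ ordIdeal 3) (hf : f ∈ ordIdeal n) :
    flow hab f - flow ha f - lieOp b f ∈ ordIdeal (n + k + 1) := by
  have h1 := flow_sub_expSum_mem (k := 1) hab hab hf (k + 2)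
  have h2 := flow_sub_expSum_mem (k := 1) ha ha hf (k + 2)
  have h3 : expSum (k + 2) (lieOp (a + b)) f - expSum (k + 2) (lieOp a) f - lieOp b f ∈
      ordIdeal (n + k + 1) := by
    rw [expSum_apply, expSum_apply, ← Finset.sum_sub_distrib, Finset.sum_range_succ',
      Finset.sum_range_succ']
    have : ∀ p : FSeries, p + ((((0 + 1).factorial : ℝ)⁻¹) • ((lieOp (a + b) ^ (0 + 1)) f) -
        (((0 + 1).factorial : ℝ)⁻¹) • ((lieOp a ^ (0 + 1)) f)) +
        ((((0).factorial : ℝ)⁻¹) • ((lieOp (a + b) ^ 0) f) -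
        (((0).factorial : ℝ)⁻¹) • ((lieOp a ^ 0) f)) - lieOp b f = p := by
      intro p
      simp [lieOp_add]
    rw [this]
    refine sum_mem fun j _ => ?_
    rw [← smul_sub]
    exact smul_mem_ordIdeal _ (mem_of_le (lieOp_pow_add_sub_mem ha hb hk hf (j + 1)) (by omega))
  have h4 : flow hab f - flow ha f - lieOp b f =
      (flow hab f - expSum (k + 2) (lieOp (a + b)) f) - (flow ha f - expSum (k + 2) (lieOp a) f)
      + (expSum (k + 2) (lieOp (a + b)) f - expSum (k + 2) (lieOp a) f - lieOp b f) := by ring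
  rw [h4]
  exact add_mem (sub_mem (mem_of_le h1 (by omega)) (mem_of_le h2 (by omega))) h3

/-- The Baker–Campbell–Hausdorff formula to leading order: L_a gains at least one order and L_b
gains `k`, so their commutator is negligible. The next lemma is the same for the other order of the
factors. -/
lemma flow_mul_flow_cong {k : ℕ} {a b : FSeries} (ha : a ∈ ordIdeal 3)
    (hb : b ∈ ordIdeal 3) (hbk : b ∈ ordIdeal (k + 2)) (hk : 1 ≤ k) (hab : a + b ∈ ordIdeal 3) :
    Cong (k + 1) (flow ha * flow hb) (flow hab) := fun n f hf => by
  have h1 := flow_add_sub_sub_lieOp_mem ha hbk hk hab hf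
  have h2 := (flow_filtered ha).mem (flow_sub_sub_lieOp_mem hb hbk hf)
  have h3 := cong_flow_one (k := 1) ha ha (lieOp_mem hbk hf)
  rw [AlgHom.one_apply] at h3
  rw [map_sub, map_sub] at h2
  have : (flow ha * flow hb) f - flow hab f =
      (flow ha (flow hb f) - flow ha f - flow ha (lieOp b f)) + (flow ha (lieOp b f) - lieOp b f)
      - (flow hab f - flow ha f - lieOp b f) := by rw [AlgHom.mul_apply]; ring
  rw [this]
  exact sub_mem (add_mem (mem_of_le h2 (by omega)) (mem_of_le h3 (by omega)))
    (mem_of_le h1 (by omega))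

lemma flow_mul_flow_cong' {k : ℕ} {a b : FSeries} (ha : a ∈ ordIdeal 3)
    (hb : b ∈ ordIdeal 3) (hbk : b ∈ ordIdeal (k + 2)) (hk : 1 ≤ k) (hab : a + b ∈ ordIdeal 3) :
    Cong (k + 1) (flow hb * flow ha) (flow hab) := fun n f hf => by
  have h1 := flow_add_sub_sub_lieOp_mem ha hbk hk hab hf
  have h2 := flow_sub_sub_lieOp_mem hb hbk ((flow_filtered ha).mem hf)
  have h3 := lieOp_mem hbk (cong_flow_one (k := 1) ha ha hf)
  rw [AlgHom.one_apply, map_sub] at h3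
  have : (flow hb * flow ha) f - flow hab f =
      (flow hb (flow ha f) - flow ha f - lieOp b (flow ha f)) +
      (lieOp b (flow ha f) - lieOp b f)
      - (flow hab f - flow ha f - lieOp b f) := by rw [AlgHom.mul_apply]; ring
  rw [this]
  exact sub_mem (add_mem (mem_of_le h2 (by omega)) (mem_of_le h3 (by omega)))
    (mem_of_le h1 (by omega))

/-! ### The chain rule -/

/-- Dividing by the variables moves the derivation onto the cofactors, with an image of a variable
in front; every division gains an order. -/
lemma derivation_along_eq_zero {α : SeriesEnd} (hα : IsFiltered α) (D : FSeries →ₗ[ℝ] FSeries)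
    (hmul : ∀ f g, D (f * g) = α f * D g + D f * α g) (h0 : D (X 0) = 0) (h1 : D (X 1) = 0)
    (h2 : D (X 2) = 0) : D = 0 := by
  ext1 f
  rw [LinearMap.zero_apply]
  refine eq_zero_of_forall_mem fun n => ?_
  have hone : D 1 = 0 := by
    have := hmul 1 1
    simpa using this
  induction n generalizing f with
  | zero => simp
  | succ n ih =>
    obtain ⟨c, f₀, f₁, f₂, rfl, -, -, -⟩ := exists_eq_add_X_mul (mem_ordIdeal_zero f)
    have hc : D (C c) = 0 := by
      rw [show (C c : FSeries) = c • 1 by rw [smul_eq_C_mul, mul_one], map_smul, hone, smul_zero]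
    simp only [map_add, hmul, hc, h0, h1, h2, zero_mul, add_zero, zero_add]
    refine add_mem (add_mem ?_ ?_) ?_
    · exact mem_of_le (mul_mem_ordIdeal (hα.mem X_zero_mem) (ih _)) (by omega)
    · exact mem_of_le (mul_mem_ordIdeal (hα.mem X_one_mem) (ih _)) (by omega)
    · exact mem_of_le (mul_mem_ordIdeal (hα.mem X_two_mem) (ih _)) (by omega)

/-- Both sides are derivations along `α` and agree on the variables. There is no term for ε because
`α` fixes it and the derivative is in x or y. -/
lemma pderiv_map {α : SeriesEnd} (hα : IsFiltered α) {i : Fin 3} (hi : i ≠ 2) (f : FSeries) :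
    pderiv ℝ i (α f) = α (pderiv ℝ 0 f) * pderiv ℝ i (α (X 0)) +
      α (pderiv ℝ 1 f) * pderiv ℝ i (α (X 1)) := by
  let D : FSeries →ₗ[ℝ] FSeries :=
    (pderiv ℝ i).toLinearMap ∘ₗ α.toLinearMap -
      (LinearMap.mulRight ℝ (pderiv ℝ i (α (X 0))) ∘ₗ α.toLinearMap ∘ₗ
          (pderiv ℝ 0).toLinearMap +
        LinearMap.mulRight ℝ (pderiv ℝ i (α (X 1))) ∘ₗ α.toLinearMap ∘ₗ
          (pderiv ℝ 1).toLinearMap)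
  have hD : ∀ f, D f = pderiv ℝ i (α f) - (α (pderiv ℝ 0 f) * pderiv ℝ i (α (X 0)) +
      α (pderiv ℝ 1 f) * pderiv ℝ i (α (X 1))) := fun f => rfl
  have := derivation_along_eq_zero hα D
    (fun f g => by simp only [hD, map_mul, pderiv_mul', map_add]; ring)
    (by rw [hD, pderiv_X_self, pderiv_X_of_ne (by decide), map_one, map_zero]; ring)
    (by rw [hD, pderiv_X_self, pderiv_X_of_ne (by decide), map_one, map_zero]; ring)
    (by rw [hD, hα.X_two, pderiv_X_of_ne hi.symm, pderiv_X_of_ne (by decide),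
          pderiv_X_of_ne (by decide), map_zero]; ring)
  have h := LinearMap.congr_fun this f
  rw [hD, LinearMap.zero_apply] at h
  exact sub_eq_zero.1 h

lemma bracket_map {α : SeriesEnd} (hα : IsFiltered α) (f g : FSeries) :
    bracket (α f) (α g) = bracket (α (X 0)) (α (X 1)) * α (bracket f g) := by
  simp only [bracket]
  rw [pderiv_map hα (by decide : (0 : Fin 3) ≠ 2) f, pderiv_map hα (by decide : (1 : Fin 3) ≠ 2) f,
    pderiv_map hα (by decide : (0 : Fin 3) ≠ 2) g, pderiv_map hα (by decide : (1 : Fin 3) ≠ 2) g]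
  simp only [map_sub, map_mul]
  ring

lemma scalesBracket_of_generators {α : SeriesEnd} (hα : IsFiltered α) {s : ℝ}
    (h : bracket (α (X 0)) (α (X 1)) = C s) : ScalesBracket s α := fun f g => by
  rw [bracket_map hα, h, smul_eq_C_mul]

/-! ### Pull-backs -/

lemma hasSubst_of_fixesOrigin {G : FormalMap} (hG : FixesOrigin G) :
    HasSubst (![G 0, G 1, X 2] : Fin 3 → FSeries) := by
  refine hasSubst_of_constantCoeff_zero fun i => ?_
  fin_cases i
  · exact hG 0
  · exact hG 1
  · exact constantCoeff_X _

/-- The pull-back `f ↦ f ∘ G` by a family `G` without constant term. -/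
def pull {G : FormalMap} (hG : FixesOrigin G) : SeriesEnd :=
  substAlgHom (hasSubst_of_fixesOrigin hG)

lemma pull_apply {G : FormalMap} (hG : FixesOrigin G) (f : FSeries) :
    pull hG f = subst (![G 0, G 1, X 2] : Fin 3 → FSeries) f := by
  rw [pull, substAlgHom_apply]

lemma pull_X_zero {G : FormalMap} (hG : FixesOrigin G) : pull hG (X 0) = G 0 :=
  substAlgHom_X _ 0
lemma pull_X_one {G : FormalMap} (hG : FixesOrigin G) : pull hG (X 1) = G 1 :=
  substAlgHom_X _ 1
lemma pull_X_two {G : FormalMap} (hG : FixesOrigin G) : pull hG (X 2) = X 2 :=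
  substAlgHom_X _ 2

lemma pull_filtered {G : FormalMap} (hG : FixesOrigin G) : IsFiltered (pull hG) := by
  refine isFiltered_of_generators ?_ ?_ (pull_X_two hG)
  · rw [pull_X_zero, mem_ordIdeal_one]; exact hG 0
  · rw [pull_X_one, mem_ordIdeal_one]; exact hG 1

lemma comp_apply (F : FormalMap) {G : FormalMap} (hG : FixesOrigin G) (i : Fin 2) :
    comp F G i = pull hG (F i) := by rw [pull_apply]; rfl

lemma FixesOrigin.comp {F G : FormalMap} (hF : FixesOrigin F) (hG : FixesOrigin G) :
    FixesOrigin (comp F G) := fun i => by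
  rw [comp_apply F hG, ← mem_ordIdeal_one]
  exact (pull_filtered hG).mem (mem_ordIdeal_one.2 (hF i))

lemma pull_eq {G : FormalMap} (hG : FixesOrigin G) {α : SeriesEnd} (hα : IsFiltered α)
    (h0 : G 0 = α (X 0)) (h1 : G 1 = α (X 1)) : pull hG = α :=
  eq_of_generators (pull_filtered hG) hα (by rw [pull_X_zero, h0]) (by rw [pull_X_one, h1])

lemma pull_comp {F G : FormalMap} (hF : FixesOrigin F) (hG : FixesOrigin G) :
    pull (hF.comp hG) = pull hG * pull hF := by
  refine pull_eq _ ((pull_filtered hG).mul (pull_filtered hF)) ?_ ?_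
  · rw [comp_apply F hG, AlgHom.mul_apply, pull_X_zero]
  · rw [comp_apply F hG, AlgHom.mul_apply, pull_X_one]

lemma pull_congr {F G : FormalMap} (hF : FixesOrigin F) (hG : FixesOrigin G) (h : F = G) :
    pull hF = pull hG := by subst h; rfl

lemma pull_inj {F G : FormalMap} (hF : FixesOrigin F) (hG : FixesOrigin G)
    (h : pull hF = pull hG) : F = G := by
  ext1 i
  fin_cases i
  · rw [Fin.zero_eta, ← pull_X_zero hF, h, pull_X_zero]
  · rw [Fin.mk_one, ← pull_X_one hF, h, pull_X_one]

lemma idMap_fixesOrigin : FixesOrigin idMap := fun i => by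
  fin_cases i <;> simp [idMap]

lemma pull_idMap : pull idMap_fixesOrigin = 1 := pull_eq _ IsFiltered.one rfl rfl

lemma pull_scalesBracket {G : FormalMap} (hG : FixesOrigin G) {s : ℝ} (h : jacDet G = C s) :
    ScalesBracket s (pull hG) :=
  scalesBracket_of_generators (pull_filtered hG) (by rw [pull_X_zero, pull_X_one]; exact h)

/-- The map with prescribed pull-back. -/
def toMap (α : SeriesEnd) : FormalMap := ![α (X 0), α (X 1)]

lemma toMap_fixesOrigin {α : SeriesEnd} (hα : IsFiltered α) : FixesOrigin (toMap α) := fun i => by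
  rw [← mem_ordIdeal_one]
  fin_cases i
  · exact hα.mem X_zero_mem
  · exact hα.mem X_one_mem

lemma pull_toMap {α : SeriesEnd} (hα : IsFiltered α) : pull (toMap_fixesOrigin hα) = α :=
  pull_eq _ hα rfl rfl

lemma toMap_isCanonical {α : SeriesEnd} (hα : IsFiltered α) (hb : ScalesBracket 1 α) :
    IsCanonical (toMap α) := by
  refine ⟨toMap_fixesOrigin hα, ?_⟩
  have := hb (X 0) (X 1)
  rwa [bracket_X, one_smul, map_one] at this

/-! ### The reflection -/

lemma reflection_fixesOrigin : FixesOrigin reflection := fun i => by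
  fin_cases i <;> simp [reflection]

/-- The pull-back by the reflection `Diag(-1, 1)`. -/
def reflEnd : SeriesEnd := pull reflection_fixesOrigin

lemma reflEnd_filtered : IsFiltered reflEnd := pull_filtered _

lemma reflEnd_X_zero : reflEnd (X 0) = -X 0 := pull_X_zero _
lemma reflEnd_X_one : reflEnd (X 1) = X 1 := pull_X_one _

lemma reflEnd_mul_self : reflEnd * reflEnd = 1 :=
  eq_of_generators (reflEnd_filtered.mul reflEnd_filtered) IsFiltered.one
    (by simp [AlgHom.mul_apply, reflEnd_X_zero]) (by simp [AlgHom.mul_apply, reflEnd_X_one])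

lemma reflEnd_scalesBracket : ScalesBracket (-1) reflEnd := by
  refine scalesBracket_of_generators reflEnd_filtered ?_
  have h1 : bracket (-X 0) (X 1) = -bracket (X 0) (X 1) := by simp only [bracket, map_neg]; ring
  rw [reflEnd_X_zero, reflEnd_X_one, h1, bracket_X, map_neg, map_one]

lemma coeff_of_diagonal {α : SeriesEnd} (hα : IsFiltered α) {a b : ℝ}
    (h0 : α (X 0) = a • X 0) (h1 : α (X 1) = b • X 1) (k l m : ℕ) (f : FSeries) :
    coeff (expo k l m) (α f) = a ^ k * b ^ l * coeff (expo k l m) f := by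
  have e : rescaleAlgHom (![a, b, 1] : Fin 3 → ℝ) = α := by
    have hX : ∀ i, rescaleAlgHom (![a, b, 1] : Fin 3 → ℝ) (X i : FSeries) =
        (![a, b, 1] : Fin 3 → ℝ) i • X i := by
      intro i
      rw [rescaleAlgHom_apply, rescale_eq_subst, subst_X (HasSubst.smul_X _)]; rfl
    refine eq_of_generators (isFiltered_of_generators ?_ ?_ ?_) hα ?_ ?_
    · rw [hX]; exact smul_mem_ordIdeal _ X_zero_mem
    · rw [hX]; exact smul_mem_ordIdeal _ X_one_mem
    · rw [hX]; simp
    · rw [hX, h0]; simp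
    · rw [hX, h1]; simp
  rw [← e, rescaleAlgHom_apply, coeff_rescale]
  congr 1
  rw [Finsupp.prod_fintype _ _ (fun i => pow_zero _)]
  simp [Fin.prod_univ_three]

lemma coeff_reflEnd (k l m : ℕ) (f : FSeries) :
    coeff (expo k l m) (reflEnd f) = (-1) ^ k * coeff (expo k l m) f := by
  have := coeff_of_diagonal reflEnd_filtered (a := -1) (b := 1)
    (by rw [reflEnd_X_zero, neg_one_smul]) (by rw [reflEnd_X_one, one_smul]) k l m f
  rwa [one_pow, mul_one] at this

lemma oddInX_iff_coeff {h : FSeries} :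
    OddInX h ↔ ∀ k l m, ¬ Odd k → coeff (expo k l m) h = 0 := by
  constructor
  · intro H k l m hk
    by_contra h0
    exact hk (H _ h0)
  · intro H d hd
    by_contra h0
    rw [← expo_eta d] at hd
    exact hd (H _ _ _ h0)

lemma oddInX_iff {h : FSeries} : OddInX h ↔ reflEnd h = -h := by
  rw [oddInX_iff_coeff]
  constructor
  · intro H
    refine series_ext fun k l m => ?_
    rw [coeff_reflEnd, map_neg]
    by_cases hk : Odd k
    · rw [hk.neg_one_pow]; ring
    · rw [H k l m hk]; ring
  · intro H k l m hk
    have := coeff_reflEnd k l m h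
    rw [H, (Nat.not_odd_iff_even.1 hk).neg_one_pow, map_neg] at this
    linarith

lemma reflEnd_mul_flow {h : FSeries} (hh : h ∈ ordIdeal 3) (ho : OddInX h) :
    reflEnd * flow hh = flow hh * reflEnd := by
  rw [mul_flow reflEnd_filtered (by norm_num) reflEnd_scalesBracket]
  congr 1
  exact flow_congr _ _ (by rw [oddInX_iff.1 ho]; simp)

/-! ### Conjugacy in terms of pull-backs -/

lemma timeOne_fixesOrigin {h : FSeries} (hh : h ∈ ordIdeal 3) : FixesOrigin (timeOne h) :=
  toMap_fixesOrigin (flow_filtered hh)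

lemma pull_timeOne {h : FSeries} (hh : h ∈ ordIdeal 3) :
    pull (timeOne_fixesOrigin hh) = flow hh := pull_toMap (flow_filtered hh)

/-- The unit β is the pull-back by φ, and its inverse the pull-back by ψ. From here on no
composition of maps is needed. -/
lemma conjToReflectedFlow_iff {F : FormalMap} (hF : FixesOrigin F) {h : FSeries}
    (hh : h ∈ ordIdeal 3) : ConjToReflectedFlow F h ↔
      ∃ β : SeriesEndˣ, IsCanonicalAut β ∧ pull hF * β = β * (flow hh * reflEnd) := by
  have hcomp : ∀ {φ ψ : FormalMap} (hφ : FixesOrigin φ) (hψ : FixesOrigin ψ),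
      pull (hψ.comp (reflection_fixesOrigin.comp ((timeOne_fixesOrigin hh).comp hφ))) =
        pull hφ * (flow hh * reflEnd) * pull hψ := by
    intro φ ψ hφ hψ
    have h1 := (timeOne_fixesOrigin hh).comp hφ
    rw [pull_comp hψ (reflection_fixesOrigin.comp h1), pull_comp reflection_fixesOrigin h1,
      pull_comp (timeOne_fixesOrigin hh) hφ, pull_timeOne hh, mul_assoc (pull hφ)]; rfl
  constructor
  · rintro ⟨φ, ψ, hφ, hψ, h1, h2, rfl⟩
    have e1 : pull hψ.fixesOrigin * pull hφ.fixesOrigin = 1 := by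
      rw [← pull_comp hφ.fixesOrigin hψ.fixesOrigin, ← pull_idMap]; exact pull_congr _ _ h1
    have e2 : pull hφ.fixesOrigin * pull hψ.fixesOrigin = 1 := by
      rw [← pull_comp hψ.fixesOrigin hφ.fixesOrigin, ← pull_idMap]; exact pull_congr _ _ h2
    refine ⟨⟨pull hφ.fixesOrigin, pull hψ.fixesOrigin, e2, e1⟩, ⟨pull_filtered hφ.fixesOrigin,
      pull_filtered hψ.fixesOrigin, pull_scalesBracket hφ.fixesOrigin
        (by rw [hφ.jacDet_eq, map_one])⟩, ?_⟩
    rw [hcomp hφ.fixesOrigin hψ.fixesOrigin, mul_assoc, Units.val_mk, e1, mul_one]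
  · rintro ⟨β, hβ, e⟩
    have hφ := toMap_fixesOrigin hβ.filtered
    have hψ := toMap_fixesOrigin hβ.filtered_inv
    refine ⟨toMap β, toMap (↑β⁻¹ : SeriesEnd), toMap_isCanonical hβ.filtered hβ.bracket,
      toMap_isCanonical hβ.filtered_inv hβ.inv.bracket, ?_, ?_, ?_⟩
    · refine pull_inj (hφ.comp hψ) idMap_fixesOrigin ?_
      rw [pull_comp hφ hψ, pull_toMap hβ.filtered, pull_toMap hβ.filtered_inv, Units.inv_mul,
        pull_idMap]
    · refine pull_inj (hψ.comp hφ) idMap_fixesOrigin ?_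
      rw [pull_comp hψ hφ, pull_toMap hβ.filtered, pull_toMap hβ.filtered_inv, Units.mul_inv,
        pull_idMap]
    · refine pull_inj hF
        (hψ.comp (reflection_fixesOrigin.comp ((timeOne_fixesOrigin hh).comp hφ))) ?_
      rw [hcomp hφ hψ, pull_toMap hβ.filtered, pull_toMap hβ.filtered_inv, ← e, mul_assoc,
        Units.mul_inv, mul_one]

/-! ### Leading Hamiltonians of canonical endomorphisms -/

/-- A Hamiltonian `g` with `∂g/∂y = u` and, on the line `y = 0`, `∂g/∂x = -v`. -/
def potential (u v : FSeries) : FSeries := ofCoeffs fun i j m =>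
  match j, i with
  | j + 1, i => coeff (expo i j m) u / (j + 1)
  | 0, i + 1 => -coeff (expo i 0 m) v / (i + 1)
  | 0, 0 => 0

lemma pderiv_one_potential (u v : FSeries) : pderiv ℝ 1 (potential u v) = u := by
  refine series_ext fun k l m => ?_
  rw [coeff_pderiv_one, potential, coeff_ofCoeffs]
  have : (l : ℝ) + 1 ≠ 0 := by positivity
  field_simp

lemma potential_mem {k : ℕ} {u v : FSeries} (hu : u ∈ ordIdeal (k + 1))
    (hv : v ∈ ordIdeal (k + 1)) : potential u v ∈ ordIdeal (k + 2) := by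
  rw [mem_ordIdeal_expo] at hu hv ⊢
  intro i j m hd
  rw [potential, coeff_ofCoeffs]
  rcases j with _ | j
  · rcases i with _ | i
    · rfl
    · simp only [hv i 0 m (by omega), neg_zero, zero_div]
  · simp only [hu i j m (by omega), zero_div]

/-- On y = 0 the equation holds by construction. Elsewhere it is tested after differentiation in y,
which turns the left side into the divergence of (u, v); undoing the derivative gains one order. -/
lemma pderiv_zero_potential_add_mem {k : ℕ} {u v : FSeries}
    (h : pderiv ℝ 0 u + pderiv ℝ 1 v ∈ ordIdeal (k + 1)) :
    pderiv ℝ 0 (potential u v) + v ∈ ordIdeal (k + 2) := by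
  rw [mem_ordIdeal_expo]
  intro i j m hd
  rcases j with _ | j
  · rw [map_add, coeff_pderiv_zero, potential, coeff_ofCoeffs]
    have : (i : ℝ) + 1 ≠ 0 := by positivity
    simp only
    field_simp
    ring
  · have h1 : pderiv ℝ 1 (pderiv ℝ 0 (potential u v) + v) ∈ ordIdeal (k + 1) := by
      rwa [map_add, ← pderiv_comm, pderiv_one_potential]
    have h2 := mem_ordIdeal_expo.1 h1 i j m (by omega)
    rw [coeff_pderiv_one] at h2
    have : (j : ℝ) + 1 ≠ 0 := by positivity
    simpa [this] using h2

lemma oddInX_potential {u v : FSeries} (hu : reflEnd u = -u) (hv : reflEnd v = v) :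
    OddInX (potential u v) := by
  rw [oddInX_iff_coeff]
  intro i j m hi
  rw [potential, coeff_ofCoeffs]
  rcases j with _ | j
  · rcases i with _ | i
    · rfl
    · have hi' : Odd i := by
        rw [Nat.odd_add_one, not_not] at hi; exact hi
      have h1 := coeff_reflEnd i 0 m v
      rw [hv, hi'.neg_one_pow] at h1
      have h2 : coeff (expo i 0 m) v = 0 := by linarith
      simp only [h2, neg_zero, zero_div]
  · simp only [oddInX_iff_coeff.1 (oddInX_iff.2 hu) i j m hi, zero_div]

/-- A canonical endomorphism that is close to the identity is, to leading order, the time-one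
flow of a Hamiltonian. -/
lemma exists_cong_flow {k : ℕ} (hk : 1 ≤ k) {γ : SeriesEnd} (hγ : IsFiltered γ)
    (hb : ScalesBracket 1 γ) (hc : Cong k γ 1) :
    ∃ g : FSeries, g ∈ ordIdeal (k + 2) ∧ (reflEnd * γ = γ * reflEnd → OddInX g) ∧
      ∀ hg : g ∈ ordIdeal 3, Cong (k + 1) γ (flow hg) := by
  set u := γ (X 0) - X 0 with hu
  set v := γ (X 1) - X 1 with hv
  have hum : u ∈ ordIdeal (k + 1) := mem_of_le (hc X_zero_mem) (by omega)
  have hvm : v ∈ ordIdeal (k + 1) := mem_of_le (hc X_one_mem) (by omega)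
  have hx : γ (X 0) = X 0 + u := by rw [hu]; ring
  have hy : γ (X 1) = X 1 + v := by rw [hv]; ring
  -- The Jacobian condition for id + (u, v) makes the divergence equal to -{u, v}, which has order
  -- at least 2k ≥ k + 1.
  have hdiv : pderiv ℝ 0 u + pderiv ℝ 1 v ∈ ordIdeal (k + 1) := by
    have h1 := hb (X 0) (X 1)
    rw [bracket_X, map_one, one_smul, hx, hy] at h1
    have h2 : pderiv ℝ 0 u + pderiv ℝ 1 v = -bracket u v := by
      simp only [bracket, map_add, pderiv_X_self, pderiv_X_of_ne (show (1 : Fin 3) ≠ 0 by decide),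
        pderiv_X_of_ne (show (0 : Fin 3) ≠ 1 by decide)] at h1 ⊢
      linear_combination h1
    rw [h2]
    exact neg_mem (mem_of_le (bracket_mem hum hvm) (by omega))
  have hgm := potential_mem hum hvm
  refine ⟨potential u v, hgm, fun hR => oddInX_potential ?_ ?_, fun hg => ?_⟩
  · have := DFunLike.congr_fun hR (X 0)
    rw [AlgHom.mul_apply, AlgHom.mul_apply, reflEnd_X_zero, map_neg] at this
    rw [hu, map_sub, this, reflEnd_X_zero]; ring
  · have := DFunLike.congr_fun hR (X 1)
    rw [AlgHom.mul_apply, AlgHom.mul_apply, reflEnd_X_one] at this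
    rw [hv, map_sub, this, reflEnd_X_one]
  · refine cong_of_generators hγ (flow_filtered hg) ?_ ?_
    · have h1 := flow_sub_sub_lieOp_mem hg hgm X_zero_mem
      rw [lieOp_X_zero, pderiv_one_potential] at h1
      have : γ (X 0) - flow hg (X 0) = -(flow hg (X 0) - X 0 - u) := by rw [hx]; ring
      rw [this]
      exact neg_mem (mem_of_le h1 (by omega))
    · have h1 := flow_sub_sub_lieOp_mem hg hgm X_one_mem
      rw [lieOp_X_one] at h1
      have : γ (X 1) - flow hg (X 1) = -(flow hg (X 1) - X 1 - -pderiv ℝ 0 (potential u v)) +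
          (pderiv ℝ 0 (potential u v) + v) := by rw [hy]; ring
      rw [this]
      exact add_mem (neg_mem (mem_of_le h1 (by omega)))
        (mem_of_le (pderiv_zero_potential_add_mem hdiv) (by omega))

lemma flow_cong {k : ℕ} (hk : 1 ≤ k) {a b : FSeries} (ha : a ∈ ordIdeal 3) (hb : b ∈ ordIdeal 3)
    (hab : a - b ∈ ordIdeal (k + 2)) : Cong k (flow ha) (flow hb) := by
  have hab3 : a - b ∈ ordIdeal 3 := sub_mem ha hb
  have e : b + (a - b) = a := by ring
  have h1 := flow_mul_flow_cong hb hab3 hab hk (e.symm ▸ ha)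
  rw [flow_congr _ ha e] at h1
  have h2 := (cong_flow_one hab3 hab).mul_left (flow_filtered hb)
  rw [mul_one] at h2
  exact (h1.mono (by omega)).symm.trans h2

/-! ### Successive approximation -/

/-- Dependent choice with an invariant `P` and a relation `Q` between successive terms. -/
lemma exists_seq_of_step {σ : Type*} {P : ℕ → σ → Prop} {Q : ℕ → σ → σ → Prop} {s₀ : σ}
    (h0 : P 0 s₀) (step : ∀ n s, P n s → ∃ s', P (n + 1) s' ∧ Q n s s') :
    ∃ u : ℕ → σ, u 0 = s₀ ∧ ∀ n, P n (u n) ∧ Q n (u n) (u (n + 1)) := by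
  choose f hf using step
  let v : ∀ n, {s // P n s} := fun n =>
    Nat.rec ⟨s₀, h0⟩ (fun n s => ⟨f n s.1 s.2, (hf n s.1 s.2).1⟩) n
  exact ⟨fun n => (v n).1, rfl, fun n => ⟨(v n).2, (hf n _ (v n).2).2⟩⟩

lemma exists_series_limit {h : ℕ → FSeries} (H : ∀ n, h (n + 1) - h n ∈ ordIdeal n) :
    ∃ g, ∀ n, g - h n ∈ ordIdeal n := by
  have H' : ∀ {m n}, m ≤ n → h n - h m ∈ ordIdeal m := by
    intro m n hmn
    induction n, hmn using Nat.le_induction with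
    | base => simp
    | succ n hn ih =>
      rw [← sub_add_sub_cancel]
      exact add_mem (mem_of_le (H n) hn) ih
  let g : FSeries := fun d => coeff d (h (wt d + 1))
  refine ⟨g, fun n d hd => ?_⟩
  have h1 : coeff d g = coeff d (h (wt d + 1)) := rfl
  have h2 := H' (show wt d + 1 ≤ n from hd) d (by omega)
  rw [map_sub] at h2
  rw [map_sub, h1, ← neg_sub, h2, neg_zero]

/-! ### The Takens normal form -/

lemma oddInX_of_limit {g : FSeries} {h : ℕ → FSeries} (ho : ∀ n, OddInX (h n))
    (H : ∀ n, g - h n ∈ ordIdeal n) : OddInX g := by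
  rw [oddInX_iff_coeff]
  intro k l m hk
  have h1 := mem_ordIdeal_expo.1 (H (k + l + 3 * m + 1)) k l m (by omega)
  rw [map_sub, oddInX_iff_coeff.1 (ho _) k l m hk, sub_zero] at h1
  exact h1

lemma OddInX.add {g h : FSeries} (hg : OddInX g) (hh : OddInX h) : OddInX (g + h) := by
  rw [oddInX_iff] at *
  rw [map_add, hg, hh]; ring

/-- The defect γ is canonical, since two sign changes of the bracket cancel, and it is to leading
order the flow of some g = o + 2χ, with o odd and χ even in x. Conjugation by exp(L_χ) subtracts χ
twice, because the reflection inverts this flow; the odd part o is added to `h`. -/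
lemma takens_step {α : SeriesEnd} (hα : IsFiltered α) (hαb : ScalesBracket (-1) α) {k : ℕ}
    (hk : 1 ≤ k) {β : SeriesEndˣ} (hβ : IsCanonicalAut β) {h : FSeries} (hh : h ∈ ordIdeal 3)
    (ho : OddInX h) (H : Cong k (α * β) (β * (flow hh * reflEnd))) :
    ∃ (β' : SeriesEndˣ) (h' : FSeries) (hh' : h' ∈ ordIdeal 3), IsCanonicalAut β' ∧ OddInX h' ∧
      Cong (k + 1) (α * β') (β' * (flow hh' * reflEnd)) ∧ Cong k (β' : SeriesEnd) β ∧
      h' - h ∈ ordIdeal (k + 2) := by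
  have hhn := neg_mem hh
  set γ : SeriesEnd := flow hhn * (↑β⁻¹ : SeriesEnd) * (α * β) * reflEnd with hγ
  have hγf : IsFiltered γ := (((flow_filtered _).mul hβ.filtered_inv).mul
    (hα.mul hβ.filtered)).mul reflEnd_filtered
  have hγb : ScalesBracket 1 γ := by
    have := (((flow_scalesBracket hhn).mul hβ.inv.bracket).mul
      (hαb.mul hβ.bracket)).mul reflEnd_scalesBracket
    norm_num at this
    exact this
  have hγc : Cong k γ 1 := by
    have h1 := (H.mul_left ((flow_filtered hhn).mul hβ.filtered_inv)).mul_right reflEnd_filtered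
    have e : flow hhn * (↑β⁻¹ : SeriesEnd) * (β * (flow hh * reflEnd)) * reflEnd = 1 := by
      calc _ = flow hhn * ((↑β⁻¹ : SeriesEnd) * β) * flow hh * (reflEnd * reflEnd) := by
            simp only [mul_assoc]
        _ = 1 := by rw [Units.inv_mul, mul_one, flow_neg_mul_flow, reflEnd_mul_self, mul_one]
    rwa [e] at h1
  obtain ⟨g, hg, -, hgc⟩ := exists_cong_flow hk hγf hγb hγc
  have hg3 : g ∈ ordIdeal 3 := mem_of_le hg (by omega)
  have hRg := reflEnd_filtered.mem hg
  have hRR : reflEnd (reflEnd g) = g := by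
    rw [← AlgHom.mul_apply, reflEnd_mul_self, AlgHom.one_apply]
  -- Half of the even part of `g`, as it acts from both sides of the conjugacy.
  set χ : FSeries := (4⁻¹ : ℝ) • (g + reflEnd g) with hχ
  set o : FSeries := (2⁻¹ : ℝ) • (g - reflEnd g) with ho'
  have hχm : χ ∈ ordIdeal (k + 2) := smul_mem_ordIdeal _ (add_mem hg hRg)
  have hom : o ∈ ordIdeal (k + 2) := smul_mem_ordIdeal _ (sub_mem hg hRg)
  have hχ3 : χ ∈ ordIdeal 3 := mem_of_le hχm (by omega)
  have ho3 : o ∈ ordIdeal 3 := mem_of_le hom (by omega)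
  have hoo : OddInX o := by
    rw [oddInX_iff, ho', map_smul, map_sub, hRR, ← smul_neg, neg_sub]
  have hRχ : reflEnd χ = χ := by rw [hχ, map_smul, map_add, hRR, add_comm]
  have hsum : g = o + χ + χ := by
    rw [ho', hχ]; module
  have hh' : h + o ∈ ordIdeal 3 := add_mem hh ho3
  refine ⟨β * flowUnit hχ3, h + o, hh', hβ.mul (flowUnit_canonical hχ3), ho.add hoo, ?_, ?_, ?_⟩
  · have e1 : α * β = β * (flow hh * (γ * reflEnd)) := by
      calc α * β = (β * ((flow hh * flow hhn) * (↑β⁻¹ : SeriesEnd))) * (α * β) *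
            (reflEnd * reflEnd) := by
            rw [flow_mul_flow_neg, one_mul, Units.mul_inv, one_mul, reflEnd_mul_self, mul_one]
        _ = _ := by rw [hγ]; simp only [mul_assoc]
    have e2 : reflEnd * flow hχ3 = flow (neg_mem hχ3) * reflEnd := by
      rw [mul_flow reflEnd_filtered (by norm_num) reflEnd_scalesBracket]
      congr 1
      exact flow_congr _ _ (by rw [hRχ]; simp)
    have hgg : h + g ∈ ordIdeal 3 := add_mem hh hg3
    have hggχ : h + g + -χ ∈ ordIdeal 3 := add_mem hgg (neg_mem hχ3)
    have hoχ : h + o + χ ∈ ordIdeal 3 := add_mem hh' hχ3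
    have c1 : Cong (k + 1) (flow hh * γ * flow (neg_mem hχ3)) (flow hggχ) :=
      (((hgc hg3).mul_left (flow_filtered hh)).trans
        (flow_mul_flow_cong hh hg3 hg hk hgg)).mul_right (flow_filtered _) |>.trans
        (flow_mul_flow_cong hgg (neg_mem hχ3) (neg_mem hχm) hk hggχ)
    have c2 : Cong (k + 1) (flow hχ3 * flow hh') (flow hoχ) :=
      flow_mul_flow_cong' hh' hχ3 hχm hk hoχ
    -- After cancellation both sides of the new conjugacy equation are the flow of h + o + χ to the
    -- required order, since h + g - χ = h + o + χ.
    rw [flow_congr hggχ hoχ (by rw [hsum]; ring)] at c1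
    have c3 := ((c1.trans c2.symm).mul_right reflEnd_filtered).mul_left hβ.filtered
    rw [Units.val_mul, coe_flowUnit, ← mul_assoc α, e1]
    convert c3 using 1
    · simp only [mul_assoc, e2]
    · simp only [mul_assoc]
  · have := (cong_flow_one hχ3 hχm).mul_left hβ.filtered
    rwa [mul_one] at this
  · rwa [add_sub_cancel_left]

/-- Existence of the Takens normal form. -/
lemma exists_takens {α : SeriesEnd} (hα : IsFiltered α) (hαb : ScalesBracket (-1) α)
    {β : SeriesEndˣ} (hβ : IsCanonicalAut β) (H : Cong 1 (α * β) (β * reflEnd)) :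
    ∃ (β : SeriesEndˣ) (h : FSeries) (hh : h ∈ ordIdeal 3), IsCanonicalAut β ∧ OddInX h ∧
      α * β = β * (flow hh * reflEnd) := by
  obtain ⟨u, -, hu⟩ := exists_seq_of_step
    (P := fun n (s : SeriesEndˣ × FSeries) => IsCanonicalAut s.1 ∧ OddInX s.2 ∧
      ∃ hh : s.2 ∈ ordIdeal 3, Cong (n + 1) (α * s.1) (s.1 * (flow hh * reflEnd)))
    (Q := fun n s s' => Cong (n + 1) (s'.1 : SeriesEnd) s.1 ∧ s'.2 - s.2 ∈ ordIdeal (n + 3))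
    (s₀ := (β, 0))
    ⟨hβ, oddInX_iff.2 (by simp), zero_mem _, by rw [flow_zero, one_mul]; exact H⟩
    (by
      rintro n ⟨β, h⟩ ⟨hβ, ho, hh, hc⟩
      obtain ⟨β', h', hh', h1, h2, h3, h4, h5⟩ :=
        takens_step hα hαb (Nat.le_add_left 1 n) hβ hh ho hc
      exact ⟨(β', h'), ⟨h1, h2, hh', h3⟩, h4, h5⟩)
  obtain ⟨b, hb, hbl⟩ := exists_limit_canonical (α := fun n => (u n).1) (fun n => (hu n).1.1)
    (fun n => (hu n).2.1.mono (Nat.le_succ n))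
  obtain ⟨h, hl⟩ := exists_series_limit (h := fun n => (u n).2)
    (fun n => mem_of_le (hu n).2.2 (by omega))
  have hh : h ∈ ordIdeal 3 := by
    obtain ⟨h3, -⟩ := (hu 3).1.2.2
    rw [← sub_add_cancel h (u 3).2]
    exact add_mem (hl 3) h3
  refine ⟨b, h, hh, hb, oddInX_of_limit (fun n => (hu n).1.2.1) hl, eq_of_forall_cong fun n => ?_⟩
  -- Index `n + 3` makes the Hamiltonians agree to order (n + 1) + 2, so that their flows agree
  -- modulo `n + 1`.
  obtain ⟨hN, hc⟩ := (hu (n + 3)).1.2.2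
  have c1 : Cong (n + 1) (α * b) (α * (u (n + 3)).1) :=
    ((hbl (n + 3)).mono (by omega)).mul_left hα
  have c2 := (flow_cong (Nat.le_add_left 1 n) hh hN (mem_of_le (hl (n + 3)) (by omega))).mul_right
    reflEnd_filtered
  have c3 := ((hbl (n + 3)).mono (show n + 1 ≤ n + 3 by omega)).mul c2 (hu (n + 3)).1.1.filtered
    ((flow_filtered hh).mul reflEnd_filtered)
  exact ((c1.trans (hc.mono (by omega))).trans c3.symm).mono (Nat.le_succ n)

/-! ### Linear changes of variables -/

/-- A linear map of the plane. -/
def linMap (a b c d : ℝ) : FormalMap := ![C a * X 0 + C b * X 1, C c * X 0 + C d * X 1]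

lemma linMap_zero (a b c d : ℝ) : linMap a b c d 0 = C a * X 0 + C b * X 1 := rfl
lemma linMap_one (a b c d : ℝ) : linMap a b c d 1 = C c * X 0 + C d * X 1 := rfl

lemma linMap_fixesOrigin (a b c d : ℝ) : FixesOrigin (linMap a b c d) := fun i => by
  fin_cases i <;> simp [linMap]

lemma exists_linear_canonical {a b c d : ℝ} (h : a * d - b * c = 1) :
    ∃ β : SeriesEndˣ, IsCanonicalAut β ∧ (β : SeriesEnd) (X 0) = C a * X 0 + C b * X 1 ∧
      (β : SeriesEnd) (X 1) = C c * X 0 + C d * X 1 := by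
  have hf := linMap_fixesOrigin
  have key : ∀ {a b c d : ℝ}, a * d - b * c = 1 →
      pull (hf a b c d) * pull (hf d (-b) (-c) a) = 1 := by
    intro a b c d h
    have hC : (C a * C d - C b * C c : FSeries) = 1 := by
      rw [← map_mul, ← map_mul, ← map_sub, h, map_one]
    refine eq_of_generators ((pull_filtered _).mul (pull_filtered _)) IsFiltered.one ?_ ?_
    · rw [AlgHom.mul_apply, pull_X_zero, linMap_zero, map_add, map_mul, map_mul,
        map_C', map_C', pull_X_zero, pull_X_one]
      simp only [linMap_zero, linMap_one, map_neg, AlgHom.one_apply]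
      linear_combination X 0 * hC
    · rw [AlgHom.mul_apply, pull_X_one, linMap_one, map_add, map_mul, map_mul, map_C',
        map_C', pull_X_zero, pull_X_one]
      simp only [linMap_zero, linMap_one, map_neg, AlgHom.one_apply]
      linear_combination X 1 * hC
  have key2 := key (a := d) (b := -b) (c := -c) (d := a) (by linear_combination h)
  simp only [neg_neg] at key2
  let β : SeriesEndˣ := ⟨pull (hf a b c d), pull (hf d (-b) (-c) a), key h, key2⟩
  refine ⟨β, ⟨pull_filtered (hf a b c d), pull_filtered (hf d (-b) (-c) a),
    pull_scalesBracket (hf a b c d) ?_⟩, pull_X_zero (hf a b c d), pull_X_one (hf a b c d)⟩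
  simp only [jacDet, linMap_zero, linMap_one, pderiv_mul', map_add,
    pderiv_C, pderiv_X_self, pderiv_X_of_ne (show (1 : Fin 3) ≠ 0 by decide),
    pderiv_X_of_ne (show (0 : Fin 3) ≠ 1 by decide), map_one]
  have hC : (C a * C d - C b * C c : FSeries) = 1 := by
    rw [← map_mul, ← map_mul, ← map_sub, h, map_one]
  linear_combination hC

/-- The parameter has order three, so below order two only the terms linear in x and y occur. -/
lemma sub_linear_mem {f : FSeries} (hf : f ∈ ordIdeal 1) :
    f - (C (coeff (expo 1 0 0) f) * X 0 + C (coeff (expo 0 1 0) f) * X 1) ∈ ordIdeal 2 := by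
  rw [mem_ordIdeal_expo] at hf ⊢
  intro k l m hd
  have e1 : ∀ c : ℝ, (C c : FSeries) = monomial (expo 0 0 0) c := by
    intro c
    rw [← monomial_zero_eq_C_apply]
    congr 2
    ext i; fin_cases i <;> rfl
  simp only [map_sub, map_add, e1, X_zero_eq, X_one_eq, coeff_monomial_mul_expo, coeff_monomial,
    expo_inj]
  obtain rfl : m = 0 := by omega
  rcases k with _ | k
  · rcases l with _ | l
    · simp [hf 0 0 0 (by omega)]
    · obtain rfl : l = 0 := by omega
      simp
  · obtain ⟨rfl, rfl⟩ : k = 0 ∧ l = 0 := by omega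
    simp

lemma exists_diagonalizing_matrix {J : Matrix (Fin 2) (Fin 2) ℝ}
    (hJ : HasEigenvaluesNegOneOne J) :
    ∃ a b c d : ℝ, a * d - b * c = 1 ∧ a * J 0 0 + b * J 1 0 = -a ∧ a * J 0 1 + b * J 1 1 = -b ∧
      c * J 0 0 + d * J 1 0 = c ∧ c * J 0 1 + d * J 1 1 = d := by
  obtain ⟨h1, h2⟩ := hJ
  obtain ⟨v, hv⟩ := h1.exists_hasEigenvector
  obtain ⟨w, hw⟩ := h2.exists_hasEigenvector
  have hv1 := hv.apply_eq_smul
  have hw1 := hw.apply_eq_smul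
  have hv0 := hv.2
  have hw0 := hw.2
  rw [Matrix.toLin'_apply] at hv1 hw1
  have E1 := congrFun hv1 0
  have E2 := congrFun hv1 1
  have E3 := congrFun hw1 0
  have E4 := congrFun hw1 1
  simp only [Matrix.mulVec, dotProduct, Fin.sum_univ_two, Pi.smul_apply, smul_eq_mul, neg_mul,
    one_mul] at E1 E2 E3 E4
  -- Eigenvectors for different eigenvalues are linearly independent.
  have hdet : v 0 * w 1 - w 0 * v 1 ≠ 0 := by
    intro h0
    have a1 : v 0 * w 1 + v 1 * w 0 = 0 := by
      linear_combination w 1 * E1 - v 1 * E3 - J 0 0 * h0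
    have a2 : v 0 * w 0 = 0 := by
      linear_combination (w 0 * E1 - v 0 * E3 + J 0 1 * h0) / 2
    have a3 : v 1 * w 1 = 0 := by
      linear_combination (w 1 * E2 - v 1 * E4 - J 1 0 * h0) / 2
    have a4 : v 0 * w 1 = 0 := by linarith
    have a5 : v 1 * w 0 = 0 := by linarith
    apply hv0
    by_cases hw00 : w 0 = 0
    · by_cases hw01 : w 1 = 0
      · exact absurd (by ext i; fin_cases i <;> assumption) hw0
      · ext i; fin_cases i
        · exact (mul_eq_zero.1 a4).resolve_right hw01
        · exact (mul_eq_zero.1 a3).resolve_right hw01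
    · ext i; fin_cases i
      · exact (mul_eq_zero.1 a2).resolve_right hw00
      · exact (mul_eq_zero.1 a5).resolve_right hw00
  set D := v 0 * w 1 - w 0 * v 1 with hD
  -- The row (w₁, -w₀) annihilates the eigenvector for 1, so it is a left eigenvector for -1;
  -- likewise (-v₁, v₀) for 1. Left eigenvectors are needed because coordinates are pulled back.
  -- Division by `D` makes the determinant one.
  refine ⟨w 1, -w 0, -v 1 / D, v 0 / D, ?_, ?_, ?_, ?_, ?_⟩
  · field_simp
    rw [hD]; ring
  · refine mul_left_cancel₀ hdet ?_
    rw [hD]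
    linear_combination w 1 * w 1 * E1 - v 1 * w 1 * E3 - w 0 * w 1 * E2 + w 0 * v 1 * E4
  · refine mul_left_cancel₀ hdet ?_
    rw [hD]
    linear_combination -w 0 * w 1 * E1 + v 0 * w 1 * E3 + w 0 * w 0 * E2 - w 0 * v 0 * E4
  · field_simp
    refine mul_left_cancel₀ hdet ?_
    rw [hD]
    linear_combination -v 1 * w 1 * E1 + v 1 * v 1 * E3 + v 0 * w 1 * E2 - v 0 * v 1 * E4
  · field_simp
    refine mul_left_cancel₀ hdet ?_
    rw [hD]
    linear_combination v 1 * w 0 * E1 - v 1 * v 0 * E3 - v 0 * w 0 * E2 + v 0 * v 0 * E4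

lemma exists_linear_normalisation {F : FormalMap} (hF : FixesOrigin F)
    (hJ : HasEigenvaluesNegOneOne (linearPart F)) :
    ∃ β : SeriesEndˣ, IsCanonicalAut β ∧ Cong 1 (pull hF * β) (β * reflEnd) := by
  obtain ⟨a, b, c, d, hdet, h1, h2, h3, h4⟩ := exists_diagonalizing_matrix hJ
  obtain ⟨β, hβ, hb0, hb1⟩ := exists_linear_canonical hdet
  have hlin : ∀ i, linearPart F i 0 = coeff (expo 1 0 0) (F i) ∧
      linearPart F i 1 = coeff (expo 0 1 0) (F i) := fun i =>
    ⟨by rw [← single_zero_eq]; rfl, by rw [← single_one_eq]; rfl⟩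
  have hF' : ∀ i, F i - (C (linearPart F i 0) * X 0 + C (linearPart F i 1) * X 1) ∈
      ordIdeal 2 := fun i => by
    rw [(hlin i).1, (hlin i).2]
    exact sub_linear_mem (mem_ordIdeal_one.2 (hF i))
  set J := linearPart F
  have hC : ∀ {p q r s t : ℝ}, p * q + r * s = t → (C p * C q + C r * C s : FSeries) = C t := by
    intro p q r s t h
    rw [← map_mul, ← map_mul, ← map_add, h]
  have g1 := hC h1
  have g2 := hC h2
  have g3 := hC h3
  have g4 := hC h4
  rw [map_neg] at g1 g2
  refine ⟨β, hβ, cong_of_generators ((pull_filtered hF).mul hβ.filtered)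
    (hβ.filtered.mul reflEnd_filtered) ?_ ?_⟩
  · simp only [AlgHom.mul_apply, reflEnd_X_zero, map_neg, hb0, map_add, map_mul, map_C',
      pull_X_zero, pull_X_one]
    have := add_mem (Ideal.mul_mem_left _ (C a) (hF' 0)) (Ideal.mul_mem_left _ (C b) (hF' 1))
    convert this using 1
    linear_combination X 0 * g1 + X 1 * g2
  · simp only [AlgHom.mul_apply, reflEnd_X_one, hb1, map_add, map_mul, map_C',
      pull_X_zero, pull_X_one]
    have := add_mem (Ideal.mul_mem_left _ (C c) (hF' 0)) (Ideal.mul_mem_left _ (C d) (hF' 1))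
    convert this using 1
    linear_combination X 0 * g3 + X 1 * g4

lemma exists_takens_of_family {F : FormalMap} (hF : IsFormalReversingFamily F) :
    ∃ (β : SeriesEndˣ) (h : FSeries) (hh : h ∈ ordIdeal 3), IsCanonicalAut β ∧ OddInX h ∧
      pull hF.fixesOrigin * β = β * (flow hh * reflEnd) := by
  obtain ⟨β, hβ, hc⟩ := exists_linear_normalisation hF.fixesOrigin hF.eigenvalues
  exact exists_takens (pull_filtered _)
    (pull_scalesBracket _ (by rw [hF.jacDet_eq, map_neg, map_one])) hβ hc

/-! ### Symmetric canonical changes of variables -/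

/-- Canonical automorphisms that commute with the reflection. -/
structure IsSymmetricAut (δ : SeriesEndˣ) : Prop extends IsCanonicalAut δ where
  comm : reflEnd * (δ : SeriesEnd) = δ * reflEnd

lemma IsSymmetricAut.one : IsSymmetricAut 1 :=
  ⟨IsCanonicalAut.one, by simp⟩

lemma IsSymmetricAut.mul {α β : SeriesEndˣ} (hα : IsSymmetricAut α) (hβ : IsSymmetricAut β) :
    IsSymmetricAut (α * β) := by
  refine ⟨hα.toIsCanonicalAut.mul hβ.toIsCanonicalAut, ?_⟩
  rw [Units.val_mul, ← mul_assoc, hα.comm, mul_assoc, hβ.comm, mul_assoc]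

lemma IsSymmetricAut.oddInX {δ : SeriesEndˣ} (hδ : IsSymmetricAut δ) {h : FSeries}
    (ho : OddInX h) : OddInX ((δ : SeriesEnd) h) := by
  rw [oddInX_iff] at *
  rw [← AlgHom.mul_apply, hδ.comm, AlgHom.mul_apply, ho, map_neg]

lemma flowUnit_symmetric {h : FSeries} (hh : h ∈ ordIdeal 3) (ho : OddInX h) :
    IsSymmetricAut (flowUnit hh) :=
  ⟨flowUnit_canonical hh, reflEnd_mul_flow hh ho⟩

lemma exists_limit_symmetric {α : ℕ → SeriesEndˣ} (hα : ∀ n, IsSymmetricAut (α n))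
    (h : ∀ n, Cong n (α (n + 1) : SeriesEnd) (α n)) :
    ∃ β : SeriesEndˣ, IsSymmetricAut β ∧ ∀ n, Cong n (β : SeriesEnd) (α n) := by
  obtain ⟨β, hβ, hl⟩ := exists_limit_canonical (fun n => (hα n).toIsCanonicalAut) h
  refine ⟨β, ⟨hβ, eq_of_forall_cong fun n => ?_⟩, hl⟩
  have h1 := (hl n).mul_left reflEnd_filtered
  rw [(hα n).comm] at h1
  exact h1.trans ((hl n).mul_right reflEnd_filtered).symm

/-- Transformation of the reflected flow by a symmetric canonical change of variables. -/
lemma IsSymmetricAut.conj {δ : SeriesEndˣ} (hδ : IsSymmetricAut δ) {h : FSeries}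
    (hh : h ∈ ordIdeal 3) (hh' : (δ : SeriesEnd) h ∈ ordIdeal 3) :
    (δ : SeriesEnd) * (flow hh * reflEnd) = flow hh' * reflEnd * δ := by
  rw [← mul_assoc, mul_flow hδ.filtered (by norm_num) hδ.bracket, mul_assoc, mul_assoc, hδ.comm]
  congr 1
  exact flow_congr _ _ (one_smul _ _)

/-- The change x ↦ bx, y ↦ y/b divides the coefficient of xy² by b, which normalises it to one. -/
lemma exists_scaling {b : ℝ} (hb : b ≠ 0) : ∃ δ : SeriesEndˣ, IsSymmetricAut δ ∧
    ∀ k l m f, coeff (expo k l m) ((δ : SeriesEnd) f) =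
      b ^ k * b⁻¹ ^ l * coeff (expo k l m) f := by
  obtain ⟨δ, hδ, h0, h1⟩ := exists_linear_canonical (a := b) (b := 0) (c := 0) (d := b⁻¹)
    (by field_simp; ring)
  rw [map_zero, zero_mul, add_zero, ← smul_eq_C_mul] at h0
  rw [map_zero, zero_mul, zero_add, ← smul_eq_C_mul] at h1
  refine ⟨δ, ⟨hδ, ?_⟩, coeff_of_diagonal hδ.filtered h0 h1⟩
  refine eq_of_generators (reflEnd_filtered.mul hδ.filtered) (hδ.filtered.mul reflEnd_filtered)
    ?_ ?_
  · simp only [AlgHom.mul_apply, h0, map_smul, reflEnd_X_zero, map_neg, smul_neg]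
  · simp only [AlgHom.mul_apply, h1, map_smul, reflEnd_X_one]

/-! ### The homological operator -/

/-- The leading part `x y² + a x³` of the normal form. -/
def leadingHam (a : ℝ) : FSeries := monomial (expo 1 2 0) 1 + monomial (expo 3 0 0) a

lemma coeff_leadingHam (a : ℝ) (k l m : ℕ) : coeff (expo k l m) (leadingHam a) =
    (if k = 1 ∧ l = 2 ∧ m = 0 then 1 else 0) + if k = 3 ∧ l = 0 ∧ m = 0 then a else 0 := by
  classical
  simp only [leadingHam, map_add, coeff_monomial, expo_inj]

lemma leadingHam_mem (a : ℝ) : leadingHam a ∈ ordIdeal 3 :=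
  add_mem (monomial_mem_ordIdeal 1 2 0 1) (monomial_mem_ordIdeal 3 0 0 a)

lemma oddInX_leadingHam (a : ℝ) : OddInX (leadingHam a) := by
  rw [oddInX_iff_coeff]
  intro k l m hk
  rw [coeff_leadingHam, if_neg, if_neg, add_zero]
  · rintro ⟨rfl, -⟩; exact hk (by decide)
  · rintro ⟨rfl, -⟩; exact hk (by decide)

lemma pderiv_monomial_zero (k l m : ℕ) (c : ℝ) :
    pderiv ℝ 0 (monomial (expo (k + 1) l m) c : FSeries) =
      monomial (expo k l m) (c * (k + 1)) := by
  classical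
  refine series_ext fun i j n => ?_
  rw [coeff_pderiv_zero, coeff_monomial, coeff_monomial]
  simp only [expo_inj, add_left_inj]
  split_ifs with h
  · rw [h.1]
  · rw [zero_mul]

lemma pderiv_monomial_one (k l m : ℕ) (c : ℝ) :
    pderiv ℝ 1 (monomial (expo k (l + 1) m) c : FSeries) =
      monomial (expo k l m) (c * (l + 1)) := by
  classical
  refine series_ext fun i j n => ?_
  rw [coeff_pderiv_one, coeff_monomial, coeff_monomial]
  simp only [expo_inj, add_left_inj]
  split_ifs with h
  · rw [h.2.1]
  · rw [zero_mul]

lemma pderiv_monomial_one_zero (k m : ℕ) (c : ℝ) :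
    pderiv ℝ 1 (monomial (expo k 0 m) c : FSeries) = 0 := by
  classical
  refine series_ext fun i j n => ?_
  rw [coeff_pderiv_one, coeff_monomial, if_neg, zero_mul, map_zero]
  rw [expo_inj]; omega

lemma lieOp_leadingHam (a : ℝ) (χ : FSeries) : lieOp χ (leadingHam a) =
    (monomial (expo 0 2 0) 1 + monomial (expo 2 0 0) (3 * a)) * pderiv ℝ 1 χ -
      monomial (expo 1 1 0) 2 * pderiv ℝ 0 χ := by
  have h0 : pderiv ℝ 0 (leadingHam a) =
      monomial (expo 0 2 0) 1 + monomial (expo 2 0 0) (3 * a) := by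
    rw [leadingHam, map_add, pderiv_monomial_zero 0, pderiv_monomial_zero 2]
    norm_num [mul_comm]
  have h1 : pderiv ℝ 1 (leadingHam a) = monomial (expo 1 1 0) 2 := by
    rw [leadingHam, map_add, pderiv_monomial_one 1 1, pderiv_monomial_one_zero]
    norm_num
  rw [lieOp_apply, h0, h1]

/-- The operator is triangular with respect to the power of x: besides the diagonal factor l - 2k,
only the coefficient at x^(k-2) y^(l+2) enters. The diagonal vanishes exactly on (xy²)^k ε^m. -/
lemma coeff_lieOp_leadingHam (a : ℝ) (χ : FSeries) (k l m : ℕ) :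
    coeff (expo k (l + 1) m) (lieOp χ (leadingHam a)) =
      ((l : ℝ) - 2 * k) * coeff (expo k l m) χ +
        if 2 ≤ k then 3 * a * (l + 2) * coeff (expo (k - 2) (l + 2) m) χ else 0 := by
  rw [lieOp_leadingHam, add_mul, map_sub, map_add]
  simp only [coeff_monomial_mul_expo, coeff_pderiv_one, coeff_pderiv_zero]
  have e1 : (if 0 ≤ k ∧ 2 ≤ l + 1 ∧ 0 ≤ m then (1 : ℝ) *
      (coeff (expo (k - 0) (l + 1 - 2 + 1) (m - 0)) χ * (((l + 1 - 2 : ℕ) : ℝ) + 1)) else 0) =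
      l * coeff (expo k l m) χ := by
    rcases l with _ | l
    · simp
    · simp [mul_comm]
  have e2 : (if 1 ≤ k ∧ 1 ≤ l + 1 ∧ 0 ≤ m then (2 : ℝ) *
      (coeff (expo (k - 1 + 1) (l + 1 - 1) (m - 0)) χ * (((k - 1 : ℕ) : ℝ) + 1)) else 0) =
      2 * k * coeff (expo k l m) χ := by
    rcases k with _ | k
    · simp
    · simp; ring
  rw [e1, e2]
  simp only [Nat.zero_le, and_true, Nat.sub_zero]
  split_ifs
  · push_cast; ring_nf
  · ring

/-- The coefficients of a solution of the homological equation with right-hand side `t`. At the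
resonances `l = 2 k` the denominator vanishes and the coefficient is zero. -/
def homSolCoeff (a : ℝ) (t : FSeries) : ℕ → ℕ → ℕ → ℝ
  | 0, l, m => coeff (expo 0 (l + 1) m) t / (2 * (0 : ℕ) - l)
  | 1, l, m => coeff (expo 1 (l + 1) m) t / (2 * (1 : ℕ) - l)
  | k + 2, l, m => (coeff (expo (k + 2) (l + 1) m) t +
      3 * a * (l + 2) * homSolCoeff a t k (l + 2) m) / (2 * (k + 2 : ℕ) - l)

/-- A solution of the homological equation, up to resonant terms. -/
def homSol (a : ℝ) (t : FSeries) : FSeries := ofCoeffs (homSolCoeff a t)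

/-- The recursion passes from (k + 2, l) to (k, l + 2). This preserves the order of the monomial and
the parity of the power of x, the two cases of `p` that are used. -/
lemma homSolCoeff_eq_zero {a : ℝ} {t : FSeries} (p : ℕ → ℕ → ℕ → Prop)
    (hp : ∀ k l m, p (k + 2) l m → p k (l + 2) m)
    (ht : ∀ k l m, p k l m → coeff (expo k (l + 1) m) t = 0) :
    ∀ k l m, p k l m → homSolCoeff a t k l m = 0
  | 0, l, m, h => by rw [homSolCoeff, ht _ _ _ h, zero_div]
  | 1, l, m, h => by rw [homSolCoeff, ht _ _ _ h, zero_div]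
  | k + 2, l, m, h => by
    rw [homSolCoeff, ht _ _ _ h, homSolCoeff_eq_zero p hp ht k (l + 2) m (hp _ _ _ h), mul_zero,
      add_zero, zero_div]

lemma homSol_mem {a : ℝ} {n : ℕ} {t : FSeries} (ht : t ∈ ordIdeal (n + 1)) :
    homSol a t ∈ ordIdeal n := by
  rw [mem_ordIdeal_expo] at ht ⊢
  exact homSolCoeff_eq_zero (fun k l m => k + l + 3 * m < n) (fun k l m h => by omega)
    (fun k l m h => ht _ _ _ (by omega))

lemma oddInX_homSol {a : ℝ} {t : FSeries} (ht : OddInX t) : OddInX (homSol a t) := by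
  rw [oddInX_iff_coeff] at ht ⊢
  refine homSolCoeff_eq_zero (fun k l m => ¬ Odd k) (fun k l m h => ?_)
    (fun k l m h => ht _ _ _ h)
  rwa [Nat.odd_add, iff_true_right even_two] at h

lemma coeff_lieOp_homSol (a : ℝ) (t : FSeries) {k l : ℕ} (hkl : l ≠ 2 * k) (m : ℕ) :
    coeff (expo k (l + 1) m) (lieOp (homSol a t) (leadingHam a)) =
      -coeff (expo k (l + 1) m) t := by
  rw [coeff_lieOp_leadingHam, homSol, coeff_ofCoeffs, coeff_ofCoeffs]
  have hne : (2 * (k : ℕ) - l : ℝ) ≠ 0 := by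
    rw [sub_ne_zero]; exact_mod_cast hkl.symm
  match k, hne with
  | 0, hne =>
    rw [if_neg (by omega), add_zero, homSolCoeff]
    field_simp
    ring
  | 1, hne =>
    rw [if_neg (by omega), add_zero, homSolCoeff]
    rw [Nat.cast_one, mul_one] at hne ⊢
    field_simp
    ring
  | k + 2, hne =>
    rw [homSolCoeff, if_pos (by omega), Nat.add_sub_cancel]
    field_simp
    ring

/-! ### Simplification of odd Hamiltonians -/

/-- The simplified Hamiltonians: besides the leading part `x y² + a x³`, only monomials
`x^k ε^m` and `x^k y^(2k+1) ε^m` with odd `k`, of order at least four. -/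
structure IsSimplified (a : ℝ) (g : FSeries) : Prop where
  odd : OddInX g
  sub_mem : g - leadingHam a ∈ ordIdeal 4
  coeff_eq_zero : ∀ k l m, l ≠ 2 * k → coeff (expo k (l + 1) m) (g - leadingHam a) = 0

lemma mem_of_sub_leadingHam_mem {a : ℝ} {g : FSeries} (h : g - leadingHam a ∈ ordIdeal 4) :
    g ∈ ordIdeal 3 := by
  rw [← sub_add_cancel g (leadingHam a)]
  exact add_mem (mem_of_le h (by omega)) (leadingHam_mem a)

lemma IsSimplified.mem {a : ℝ} {g : FSeries} (h : IsSimplified a g) : g ∈ ordIdeal 3 :=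
  mem_of_sub_leadingHam_mem h.sub_mem

/-- The action of a near-identity flow to leading order. -/
lemma flow_sub_sub_lieOp_leadingHam_mem {k : ℕ} (hk : 1 ≤ k) {a : ℝ} {g χ : FSeries}
    (hg : g - leadingHam a ∈ ordIdeal 4) (hχ3 : χ ∈ ordIdeal 3) (hχ : χ ∈ ordIdeal (k + 2)) :
    flow hχ3 g - g - lieOp χ (leadingHam a) ∈ ordIdeal (k + 4) := by
  have h1 := flow_sub_sub_lieOp_mem hχ3 hχ (mem_of_sub_leadingHam_mem hg)
  have h2 := lieOp_mem hχ hg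
  rw [map_sub] at h2
  have : flow hχ3 g - g - lieOp χ (leadingHam a) =
      (flow hχ3 g - g - lieOp χ g) + (lieOp χ g - lieOp χ (leadingHam a)) := by ring
  rw [this]
  exact add_mem (mem_of_le h1 (by omega)) (mem_of_le h2 (by omega))

lemma simplify_step {a : ℝ} {n : ℕ} {g : FSeries} (ho : OddInX g)
    (hg : g - leadingHam a ∈ ordIdeal 4)
    (hc : ∀ k l m, k + (l + 1) + 3 * m < n + 4 → l ≠ 2 * k →
      coeff (expo k (l + 1) m) (g - leadingHam a) = 0) :
    ∃ (χ : FSeries) (hχ3 : χ ∈ ordIdeal 3), χ ∈ ordIdeal (n + 3) ∧ OddInX χ ∧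
      flow hχ3 g - leadingHam a ∈ ordIdeal 4 ∧
      ∀ k l m, k + (l + 1) + 3 * m < n + 1 + 4 → l ≠ 2 * k →
        coeff (expo k (l + 1) m) (flow hχ3 g - leadingHam a) = 0 := by
  set r := g - leadingHam a with hr
  have hro : OddInX r := by
    rw [oddInX_iff] at *
    rw [hr, map_sub, ho, oddInX_iff.1 (oddInX_leadingHam a)]; ring
  -- All terms of order at least `n + 4` are kept, although only those of order exactly `n + 4` need
  -- to be cancelled now; the flow perturbs the others anyway.
  let t : FSeries := ofCoeffs fun k l m =>
    if k + l + 3 * m < n + 4 then 0 else coeff (expo k l m) r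
  have ht : t ∈ ordIdeal (n + 3 + 1) := by
    rw [mem_ordIdeal_expo]
    intro k l m h
    rw [coeff_ofCoeffs, if_pos (by omega)]
  have hto : OddInX t := by
    rw [oddInX_iff_coeff] at hro ⊢
    intro k l m h
    rw [coeff_ofCoeffs, hro _ _ _ h, ite_self]
  have hχ := homSol_mem (a := a) ht
  have hχ3 : homSol a t ∈ ordIdeal 3 := mem_of_le hχ (by omega)
  have h1 := flow_sub_sub_lieOp_leadingHam_mem (k := n + 1) (by omega) hg hχ3 (mem_of_le hχ le_rfl)
  have hL : lieOp (homSol a t) (leadingHam a) ∈ ordIdeal (n + 4) :=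
    mem_of_le (lieOp_mem (k := n + 1) hχ (leadingHam_mem a)) (by omega)
  have hdec : flow hχ3 g - leadingHam a = r + lieOp (homSol a t) (leadingHam a) +
      (flow hχ3 g - g - lieOp (homSol a t) (leadingHam a)) := by rw [hr]; ring
  refine ⟨homSol a t, hχ3, hχ, oddInX_homSol hto, ?_, fun k l m hw hkl => ?_⟩
  · rw [hdec]
    exact add_mem (add_mem hg (mem_of_le hL (by omega))) (mem_of_le h1 (by omega))
  · rw [hdec, map_add, map_add, mem_ordIdeal_expo.1 h1 k (l + 1) m (by omega), add_zero]
    by_cases hw' : k + (l + 1) + 3 * m < n + 4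
    · rw [hc k l m hw' hkl, mem_ordIdeal_expo.1 hL k (l + 1) m hw', add_zero]
    · rw [coeff_lieOp_homSol a t hkl, coeff_ofCoeffs, if_neg hw', add_neg_cancel]

lemma exists_simplified {a : ℝ} {g : FSeries} (ho : OddInX g)
    (hg : g - leadingHam a ∈ ordIdeal 4) :
    ∃ δ : SeriesEndˣ, IsSymmetricAut δ ∧ IsSimplified a ((δ : SeriesEnd) g) := by
  obtain ⟨u, -, hu⟩ := exists_seq_of_step
    (P := fun n (δ : SeriesEndˣ) => IsSymmetricAut δ ∧
      (δ : SeriesEnd) g - leadingHam a ∈ ordIdeal 4 ∧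
      ∀ k l m, k + (l + 1) + 3 * m < n + 4 → l ≠ 2 * k →
        coeff (expo k (l + 1) m) ((δ : SeriesEnd) g - leadingHam a) = 0)
    (Q := fun n δ δ' => Cong n (δ' : SeriesEnd) δ) (s₀ := 1)
    ⟨IsSymmetricAut.one, hg, fun k l m hw hkl => mem_ordIdeal_expo.1 hg _ _ _ hw⟩
    (by
      rintro n δ ⟨hδ, h1, h2⟩
      obtain ⟨χ, hχ3, hχ, hχo, h3, h4⟩ := simplify_step (hδ.oddInX ho) h1 h2
      refine ⟨flowUnit hχ3 * δ, ⟨(flowUnit_symmetric hχ3 hχo).mul hδ, h3, h4⟩, ?_⟩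
      have := (cong_flow_one (k := n) hχ3 (mem_of_le hχ (by omega))).mul_right hδ.filtered
      rwa [one_mul] at this)
  obtain ⟨δ, hδ, hl⟩ := exists_limit_symmetric (fun n => (hu n).1.1) (fun n => (hu n).2)
  have hδu : ∀ n, (δ : SeriesEnd) g - (u n : SeriesEnd) g ∈ ordIdeal n :=
    fun n => by simpa using hl n (mem_ordIdeal_zero g)
  refine ⟨δ, hδ, hδ.oddInX ho, ?_, fun k l m hkl => ?_⟩
  · rw [← sub_add_sub_cancel]
    exact add_mem (hδu 4) (hu 4).1.2.1
  · set N := k + (l + 1) + 3 * m + 1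
    rw [← sub_add_sub_cancel _ ((u N : SeriesEnd) g), map_add,
      mem_ordIdeal_expo.1 (hδu N) k (l + 1) m (by omega), zero_add]
    exact (hu N).1.2.2 k l m (by omega) hkl

/-- Normalisation of the leading part of an odd Hamiltonian. -/
lemma sub_leadingHam_mem {g : FSeries} (ho : OddInX g) (hg : g ∈ ordIdeal 3)
    (h1 : coeff (expo 1 2 0) g = 1) : g - leadingHam (coeff (expo 3 0 0) g) ∈ ordIdeal 4 := by
  rw [mem_ordIdeal_expo] at hg ⊢
  rw [oddInX_iff_coeff] at ho
  intro k l m hw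
  rw [map_sub, coeff_leadingHam]
  by_cases hk : Odd k
  · obtain ⟨j, rfl⟩ := hk
    by_cases hw3 : 2 * j + 1 + l + 3 * m < 3
    · rw [hg _ _ _ hw3, if_neg (by omega), if_neg (by omega)]; ring
    · obtain rfl : m = 0 := by omega
      obtain ⟨rfl, rfl⟩ | ⟨rfl, rfl⟩ : (j = 0 ∧ l = 2) ∨ (j = 1 ∧ l = 0) := by omega
      · simp [h1]
      · simp
  · rw [ho _ _ _ hk, if_neg, if_neg]
    · ring
    · rintro ⟨rfl, -⟩; exact hk (by decide)
    · rintro ⟨rfl, -⟩; exact hk (by decide)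

/-! ### The form of the simplified Hamiltonians -/

/-- The exponent of the monomial `u^k ε^m`. -/
def expoTwo (k m : ℕ) : Fin 2 →₀ ℕ := Finsupp.equivFunOnFinite.symm ![k, m]

lemma expoTwo_eta (d : Fin 2 →₀ ℕ) : expoTwo (d 0) (d 1) = d := by
  ext i; fin_cases i <;> rfl

@[simp] lemma expoTwo_zero (k m : ℕ) : expoTwo k m 0 = k := rfl
@[simp] lemma expoTwo_one (k m : ℕ) : expoTwo k m 1 = m := rfl

lemma monomial_pow_expo (i j n k : ℕ) :
    (monomial (expo i j n) (1 : ℝ) : FSeries) ^ k = monomial (expo (k * i) (k * j) (k * n)) 1 := by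
  rw [monomial_pow, one_pow]
  congr 2
  ext s; fin_cases s <;> rfl

/-- Since `i ≥ 1`, the monomials (x^i y^j)^s ε^n are distinct for distinct (s, n), so at most one
term contributes to a coefficient. -/
lemma coeff_subst_monomial (i j : ℕ) (hij : 1 ≤ i) (A : MvPowerSeries (Fin 2) ℝ) (k l m : ℕ) :
    coeff (expo k l m) (subst (![monomial (expo i j 0) 1, X 2] : Fin 2 → FSeries) A) =
      if i ∣ k ∧ l = k / i * j then coeff (expoTwo (k / i) m) A else 0 := by
  classical
  have hs : HasSubst (![monomial (expo i j 0) 1, X 2] : Fin 2 → FSeries) := by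
    refine hasSubst_of_constantCoeff_zero fun s => ?_
    fin_cases s
    · exact mem_ordIdeal_one.1 (mem_of_le (monomial_mem_ordIdeal i j 0 1) (by omega))
    · exact constantCoeff_X _
  rw [coeff_subst hs]
  have hterm : ∀ d : Fin 2 →₀ ℕ, coeff d A • coeff (expo k l m)
      (d.prod fun s e => (![monomial (expo i j 0) 1, X 2] : Fin 2 → FSeries) s ^ e) =
      if k = d 0 * i ∧ l = d 0 * j ∧ m = d 1 then coeff d A else 0 := by
    intro d
    rw [Finsupp.prod_fintype _ _ (fun i => pow_zero _), Fin.prod_univ_two]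
    simp only [Matrix.cons_val_zero, Matrix.cons_val_one]
    rw [X_two_eq, monomial_pow_expo, monomial_pow_expo, monomial_mul_monomial, expo_add]
    simp only [coeff_monomial, expo_inj]
    simp
  rw [finsum_congr hterm, finsum_eq_single _ (expoTwo (k / i) m)]
  · simp only [expoTwo_zero, expoTwo_one, and_true]
    congr 1
    rw [eq_iff_iff, Nat.dvd_iff_div_mul_eq, eq_comm]
  · intro d hd
    rw [if_neg]
    rintro ⟨rfl, -, rfl⟩
    exact hd (by rw [Nat.mul_div_cancel _ (by omega), expoTwo_eta])

lemma normalHam_eq (a : ℝ) (A B : MvPowerSeries (Fin 2) ℝ) : normalHam a A B - leadingHam a =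
    subst (![monomial (expo 1 0 0) 1, X 2] : Fin 2 → FSeries) A +
      monomial (expo 0 1 0) 1 *
        subst (![monomial (expo 1 2 0) 1, X 2] : Fin 2 → FSeries) B := by
  have h1 : (X 0 * X 1 ^ 2 : FSeries) = monomial (expo 1 2 0) 1 := by
    rw [X_zero_eq, X_one_eq, monomial_pow_expo, monomial_mul_monomial, expo_add, one_mul]
  have h2 : (C a * X 0 ^ 3 : FSeries) = monomial (expo 3 0 0) a := by
    rw [X_zero_eq, monomial_pow_expo, ← smul_eq_C_mul, ← map_smul, smul_eq_mul, mul_one, mul_one,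
      mul_zero]
  rw [normalHam, leadingHam, h1, h2, ← X_zero_eq, ← X_one_eq]
  ring

lemma coeff_normalHam_zero (a : ℝ) (A B : MvPowerSeries (Fin 2) ℝ) (k m : ℕ) :
    coeff (expo k 0 m) (normalHam a A B - leadingHam a) = coeff (expoTwo k m) A := by
  rw [normalHam_eq, map_add, coeff_subst_monomial 1 0 le_rfl, coeff_monomial_mul_expo]
  simp

lemma coeff_normalHam_succ (a : ℝ) (A B : MvPowerSeries (Fin 2) ℝ) (k l m : ℕ) :
    coeff (expo k (l + 1) m) (normalHam a A B - leadingHam a) =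
      if l = 2 * k then coeff (expoTwo k m) B else 0 := by
  rw [normalHam_eq, map_add, coeff_subst_monomial 1 0 le_rfl, coeff_monomial_mul_expo,
    coeff_subst_monomial 1 2 le_rfl]
  simp [mul_comm]

lemma isSimplified_normalHam {a : ℝ} {A B : MvPowerSeries (Fin 2) ℝ} (hA : AdmissibleA A)
    (hB : AdmissibleB B) : IsSimplified a (normalHam a A B) := by
  have hA' : ∀ k m, ¬ (Odd k ∧ 4 ≤ k + 3 * m) → coeff (expoTwo k m) A = 0 := fun k m h => by
    by_contra h0; exact h (hA _ h0)
  have hB' : ∀ k m, ¬ Odd k → coeff (expoTwo k m) B = 0 := fun k m h => by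
    by_contra h0; exact h (hB _ h0)
  have hodd : OddInX (normalHam a A B - leadingHam a) := by
    rw [oddInX_iff_coeff]
    intro k l m hk
    rcases l with _ | l
    · rw [coeff_normalHam_zero, hA' _ _ fun h => hk h.1]
    · rw [coeff_normalHam_succ, hB' _ _ hk, ite_self]
  refine ⟨?_, ?_, fun k l m hkl => by rw [coeff_normalHam_succ, if_neg hkl]⟩
  · have := hodd.add (oddInX_leadingHam a)
    rwa [sub_add_cancel] at this
  · rw [mem_ordIdeal_expo]
    intro k l m hw
    rcases l with _ | l
    · rw [coeff_normalHam_zero, hA' _ _ fun h => by omega]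
    · rw [coeff_normalHam_succ]
      split_ifs with hkl
      -- The monomial x^k y^(2k+1) ε^m has order 3k + 1 + 3m, which is below four only for k = 0, an
      -- even power.
      · exact hB' _ _ fun ⟨j, hj⟩ => by omega
      · rfl

lemma IsSimplified.exists_normalHam {a : ℝ} {g : FSeries} (h : IsSimplified a g) :
    ∃ A B, AdmissibleA A ∧ AdmissibleB B ∧ g = normalHam a A B := by
  set r := g - leadingHam a with hr
  have hro : ∀ k l m, ¬ Odd k → coeff (expo k l m) r = 0 := by
    rw [← oddInX_iff_coeff, oddInX_iff, hr, map_sub, oddInX_iff.1 h.odd,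
      oddInX_iff.1 (oddInX_leadingHam a)]
    ring
  let A : MvPowerSeries (Fin 2) ℝ := fun d => coeff (expo (d 0) 0 (d 1)) r
  let B : MvPowerSeries (Fin 2) ℝ := fun d => coeff (expo (d 0) (2 * d 0 + 1) (d 1)) r
  have hA : ∀ d, coeff d A = coeff (expo (d 0) 0 (d 1)) r := fun d => rfl
  have hB : ∀ d, coeff d B = coeff (expo (d 0) (2 * d 0 + 1) (d 1)) r := fun d => rfl
  refine ⟨A, B, fun d hd => ?_, fun d hd => ?_, ?_⟩
  · rw [hA] at hd
    refine ⟨by_contra fun h0 => hd (hro _ _ _ h0), by_contra fun h0 => hd ?_⟩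
    exact mem_ordIdeal_expo.1 h.sub_mem _ _ _ (by omega)
  · rw [hB] at hd
    exact by_contra fun h0 => hd (hro _ _ _ h0)
  · rw [← sub_left_inj (a := leadingHam a)]
    refine series_ext fun k l m => ?_
    rcases l with _ | l
    · rw [coeff_normalHam_zero, hA]; rfl
    · rw [coeff_normalHam_succ]
      split_ifs with hkl
      · rw [hB, hkl]; rfl
      · exact h.coeff_eq_zero k l m hkl

lemma normalHam_injective {a a' : ℝ} {A B A' B' : MvPowerSeries (Fin 2) ℝ} (hA : AdmissibleA A)
    (hB : AdmissibleB B) (hA' : AdmissibleA A') (hB' : AdmissibleB B')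
    (h : normalHam a A B = normalHam a' A' B') : a = a' ∧ A = A' ∧ B = B' := by
  -- The bound on the order keeps x³ out of `A`, so `a` can be read off.
  have h3 : ∀ {a A B}, AdmissibleA A → AdmissibleB B →
      coeff (expo 3 0 0) (normalHam a A B) = a := by
    intro a A B hA hB
    have := mem_ordIdeal_expo.1 (isSimplified_normalHam (a := a) hA hB).sub_mem 3 0 0 (by omega)
    rw [map_sub, coeff_leadingHam] at this
    simpa [sub_eq_zero] using this
  obtain rfl : a = a' := by rw [← h3 (a := a) hA hB, h, h3 hA' hB']
  refine ⟨rfl, ?_, ?_⟩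
  · ext d
    rw [← expoTwo_eta d, ← coeff_normalHam_zero a A B, h, coeff_normalHam_zero]
  · ext d
    have h1 := coeff_normalHam_succ a A B (d 0) (2 * d 0) (d 1)
    rw [h, coeff_normalHam_succ, if_pos rfl, if_pos rfl, expoTwo_eta] at h1
    exact h1.symm

/-! ### The Hamiltonian is determined by its flow -/

/-- If a - b has order k + 3, the flows differ on x and y by its derivatives to leading order. These
must vanish at that order, so a - b gains an order unless it has a term in ε alone, which is
excluded. -/
lemma flow_injective {a b : FSeries} (ha : a ∈ ordIdeal 3) (hb : b ∈ ordIdeal 3)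
    (ha0 : ∀ m, coeff (expo 0 0 m) a = 0) (hb0 : ∀ m, coeff (expo 0 0 m) b = 0)
    (h : flow ha = flow hb) : a = b := by
  have key : ∀ k, a - b ∈ ordIdeal (k + 3) := by
    intro k
    induction k with
    | zero => exact sub_mem ha hb
    | succ k ih =>
      have e : b + (a - b) = a := by ring
      have h3 : b + (a - b) ∈ ordIdeal 3 := e.symm ▸ ha
      have hE : ∀ f, flow h3 f - flow hb f = 0 := fun f => by
        rw [flow_congr h3 ha e, h, sub_self]
      have h0 := flow_add_sub_sub_lieOp_mem (k := k + 1) hb ih (by omega) h3 X_zero_mem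
      have h1 := flow_add_sub_sub_lieOp_mem (k := k + 1) hb ih (by omega) h3 X_one_mem
      rw [hE, zero_sub, neg_mem_iff, lieOp_X_zero] at h0
      rw [hE, zero_sub, neg_mem_iff, lieOp_X_one, neg_mem_iff] at h1
      rw [mem_ordIdeal_expo] at h0 h1 ⊢
      intro i j m hw
      rcases i with _ | i
      · rcases j with _ | j
        · rw [map_sub, ha0, hb0, sub_zero]
        · have h2 := h0 0 j m (by omega)
          rw [coeff_pderiv_one] at h2
          have : (j : ℝ) + 1 ≠ 0 := by positivity
          simpa [this] using h2
      · have h2 := h1 i j m (by omega)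
        rw [coeff_pderiv_zero] at h2
        have : (i : ℝ) + 1 ≠ 0 := by positivity
        simpa [this] using h2
  exact eq_of_forall_sub_mem fun n => mem_of_le (key n) (by omega)

/-- Removal of the terms that depend only on the parameter. -/
def dropConst (f : FSeries) : FSeries :=
  ofCoeffs fun k l m => if k = 0 ∧ l = 0 then 0 else coeff (expo k l m) f

lemma coeff_dropConst_zero (f : FSeries) (m : ℕ) : coeff (expo 0 0 m) (dropConst f) = 0 := by
  rw [dropConst, coeff_ofCoeffs, if_pos ⟨rfl, rfl⟩]

lemma dropConst_mem {n : ℕ} {f : FSeries} (hf : f ∈ ordIdeal n) : dropConst f ∈ ordIdeal n := by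
  rw [mem_ordIdeal_expo] at hf ⊢
  intro k l m hw
  rw [dropConst, coeff_ofCoeffs, hf _ _ _ hw, ite_self]

lemma lieOp_dropConst (f : FSeries) : lieOp (dropConst f) = lieOp f := by
  have h0 : pderiv ℝ 0 (dropConst f) = pderiv ℝ 0 f := series_ext fun k l m => by
    rw [coeff_pderiv_zero, coeff_pderiv_zero, dropConst, coeff_ofCoeffs, if_neg (by omega)]
  have h1 : pderiv ℝ 1 (dropConst f) = pderiv ℝ 1 f := series_ext fun k l m => by
    rw [coeff_pderiv_one, coeff_pderiv_one, dropConst, coeff_ofCoeffs, if_neg (by omega)]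
  ext1 g
  rw [lieOp_apply, lieOp_apply, h0, h1]

lemma flow_congr_lieOp {a b : FSeries} (ha : a ∈ ordIdeal 3) (hb : b ∈ ordIdeal 3)
    (h : lieOp a = lieOp b) : flow ha = flow hb := by
  ext1 f
  refine flow_eq_of_forall ha fun N => ?_
  rw [h]
  exact expLie_sub_expSum_mem' hb f N

lemma OddInX.dropConst_eq {f : FSeries} (h : OddInX f) : dropConst f = f := by
  refine series_ext fun k l m => ?_
  rw [dropConst, coeff_ofCoeffs]
  split_ifs with h0
  · rw [oddInX_iff_coeff.1 h]; rw [h0.1]; decide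
  · rfl

/-- A canonical conjugacy between reflected flows of odd Hamiltonians is symmetric and maps one
Hamiltonian to the other. -/
lemma symmetric_of_conj {δ : SeriesEndˣ} (hδ : IsCanonicalAut δ) {h h' : FSeries}
    (hh : h ∈ ordIdeal 3) (hh' : h' ∈ ordIdeal 3) (ho : OddInX h) (ho' : OddInX h')
    (H : (δ : SeriesEnd) * (flow hh * reflEnd) = flow hh' * reflEnd * δ) :
    IsSymmetricAut δ ∧ (δ : SeriesEnd) h = h' := by
  -- Squaring eliminates the reflection, which commutes with flows of odd Hamiltonians.
  have hsq : ∀ {h : FSeries} (hh : h ∈ ordIdeal 3), OddInX h →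
      flow hh * reflEnd * (flow hh * reflEnd) = flow (smul_mem_ordIdeal 2 hh) := by
    intro h hh ho
    rw [mul_assoc, ← mul_assoc reflEnd, reflEnd_mul_flow hh ho, mul_assoc (flow hh),
      reflEnd_mul_self, mul_one, flow_mul_self]
  have hδh : (δ : SeriesEnd) h ∈ ordIdeal 3 := hδ.filtered.mem hh
  have h1 : (δ : SeriesEnd) * flow (smul_mem_ordIdeal 2 hh) =
      flow (smul_mem_ordIdeal 2 hh') * δ := by
    rw [← hsq hh ho, ← hsq hh' ho', ← mul_assoc, H, mul_assoc, H]
    simp only [mul_assoc]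
  have e2 : (1 : ℝ) • (δ : SeriesEnd) ((2 : ℝ) • h) = (2 : ℝ) • (δ : SeriesEnd) h := by
    rw [one_smul, map_smul]
  rw [mul_flow hδ.filtered (by norm_num) hδ.bracket,
    flow_congr _ (smul_mem_ordIdeal 2 hδh) e2] at h1
  have h2 : flow (smul_mem_ordIdeal 2 hδh) = flow (smul_mem_ordIdeal 2 hh') := by
    have := congrArg (· * (↑δ⁻¹ : SeriesEnd)) h1
    simpa only [mul_assoc, Units.mul_inv, mul_one] using this
  have hd := dropConst_mem (smul_mem_ordIdeal 2 hδh)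
  have hd' := dropConst_mem (smul_mem_ordIdeal 2 hh')
  have h3 : dropConst ((2 : ℝ) • (δ : SeriesEnd) h) = dropConst ((2 : ℝ) • h') := by
    refine flow_injective hd hd' (coeff_dropConst_zero _) (coeff_dropConst_zero _) ?_
    rw [flow_congr_lieOp hd (smul_mem_ordIdeal 2 hδh) (lieOp_dropConst _),
      flow_congr_lieOp hd' (smul_mem_ordIdeal 2 hh') (lieOp_dropConst _), h2]
  have h4 : lieOp ((δ : SeriesEnd) h) = lieOp h' := by
    have := lieOp_dropConst ((2 : ℝ) • (δ : SeriesEnd) h)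
    rw [h3, lieOp_dropConst, lieOp_smul, lieOp_smul] at this
    exact (smul_right_injective _ (two_ne_zero (α := ℝ)) this).symm
  -- With equal Lie derivatives the flows cancel from the conjugacy equation, and only commutation
  -- with the reflection is left.
  have hcomm : reflEnd * (δ : SeriesEnd) = δ * reflEnd := by
    rw [← mul_assoc, mul_flow hδ.filtered (by norm_num) hδ.bracket,
      flow_congr _ hδh (one_smul _ _), flow_congr_lieOp hδh hh' h4, mul_assoc, mul_assoc] at H
    have := congrArg (flow (neg_mem hh') * ·) H
    simp only [← mul_assoc, flow_neg_mul_flow, one_mul] at this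
    exact this.symm
  have hs : IsSymmetricAut δ := ⟨hδ, hcomm⟩
  refine ⟨hs, ?_⟩
  -- Both Hamiltonians are now odd in x, so the ambiguity by a function of ε disappears.
  rw [← (hs.oddInX ho).dropConst_eq, ← ho'.dropConst_eq]
  have hdd := dropConst_mem hδh
  have hdd' := dropConst_mem hh'
  refine flow_injective hdd hdd' (coeff_dropConst_zero _) (coeff_dropConst_zero _) ?_
  exact flow_congr_lieOp _ _ (by rw [lieOp_dropConst, lieOp_dropConst, h4])

/-! ### Uniqueness of the simplified Hamiltonian -/

/-- Symmetry makes the linear part diagonal, say diag(p, q), and area preservation gives pq = 1.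
Both coefficients of xy² are one, so pq² = 1 and hence p = q = 1. -/
lemma cong_one_of_isSimplified {δ : SeriesEndˣ} (hδ : IsSymmetricAut δ) {a a' : ℝ}
    {g g' : FSeries} (hg : IsSimplified a g) (hg' : IsSimplified a' g')
    (h : (δ : SeriesEnd) g = g') : Cong 1 (δ : SeriesEnd) 1 := by
  set u := (δ : SeriesEnd) (X 0)
  set v := (δ : SeriesEnd) (X 1)
  have hum : u ∈ ordIdeal 1 := hδ.filtered.mem X_zero_mem
  have hvm : v ∈ ordIdeal 1 := hδ.filtered.mem X_one_mem
  have hRu : reflEnd u = -u := by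
    rw [← AlgHom.mul_apply, hδ.comm, AlgHom.mul_apply, reflEnd_X_zero, map_neg]
  have hRv : reflEnd v = v := by
    rw [← AlgHom.mul_apply, hδ.comm, AlgHom.mul_apply, reflEnd_X_one]
  have hu := sub_linear_mem hum
  have hv := sub_linear_mem hvm
  rw [oddInX_iff_coeff.1 (oddInX_iff.2 hRu) 0 1 0 (by decide), map_zero, zero_mul, add_zero] at hu
  have hv1 : coeff (expo 1 0 0) v = 0 := by
    have := coeff_reflEnd 1 0 0 v
    rw [hRv] at this
    linarith
  rw [hv1, map_zero, zero_mul, zero_add] at hv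
  set p := coeff (expo 1 0 0) u
  set q := coeff (expo 0 1 0) v
  have hpq : p * q = 1 := by
    have h1 : bracket u v = 1 := by
      rw [← hδ.map_bracket, bracket_X, map_one]
    have h2 : bracket (u - C p * X 0) v + bracket (p • X 0) (v - C q * X 1) ∈ ordIdeal 1 :=
      add_mem (bracket_mem hu hvm) (bracket_mem (smul_mem_ordIdeal p X_zero_mem) hv)
    have h3 : bracket (u - C p * X 0) v + bracket (p • X 0) (v - C q * X 1) = 1 - C (p * q) := by
      rw [bracket_sub_left, bracket_sub_right, h1, smul_eq_C_mul]
      have : bracket (C p * X 0) (C q * X 1) = C p * C q * bracket (X 0) (X 1) := by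
        simp only [bracket, pderiv_mul', pderiv_C]; ring
      rw [this, bracket_X, map_mul]; ring
    rw [h3] at h2
    have h4 := mem_ordIdeal_expo.1 h2 0 0 0 (by omega)
    rw [map_sub, ← map_one C, coeff_C_expo, coeff_C_expo] at h4
    simp only [and_self, if_true] at h4
    linarith
  obtain ⟨s, hs, hs0, hs1⟩ := exists_linear_canonical (a := p) (b := 0) (c := 0) (d := q)
    (by linarith)
  rw [map_zero, zero_mul, add_zero] at hs0
  rw [map_zero, zero_mul, zero_add] at hs1
  have hc : Cong 1 (δ : SeriesEnd) s :=
    cong_of_generators hδ.filtered hs.filtered (by rw [hs0]; exact hu) (by rw [hs1]; exact hv)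
  rw [← smul_eq_C_mul] at hs0 hs1
  have hl : ∀ {a g}, IsSimplified a g → coeff (expo 1 2 0) g = 1 := by
    intro a g hg
    have := mem_ordIdeal_expo.1 hg.sub_mem 1 2 0 (by omega)
    rw [map_sub, coeff_leadingHam] at this
    simpa [sub_eq_zero] using this
  have h5 := mem_ordIdeal_expo.1 (hc hg.mem) 1 2 0 (by omega)
  rw [map_sub, h, hl hg', coeff_of_diagonal hs.filtered hs0 hs1, hl hg] at h5
  have hq : q = 1 := by
    have : p * q * q = 1 := by linarith
    rwa [hpq, one_mul] at this
  have hp : p = 1 := by rwa [hq, mul_one] at hpq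
  refine cong_of_generators hδ.filtered IsFiltered.one ?_ ?_
  · rw [hp, map_one, one_mul] at hu; exact hu
  · rw [hq, map_one, one_mul] at hv; exact hv

/-- At its lowest order g^s is (xy² + ax³)^s. Every choice of ax³ raises the power of x by two, so
(xy²)^s is the only monomial there with x-degree at most s. -/
lemma coeff_pow_resonant {a : ℝ} {g : FSeries} (hg : g - leadingHam a ∈ ordIdeal 4) (s : ℕ) :
    ∀ i l m, i + l + 3 * m = 3 * s → i ≤ s →
      coeff (expo i l m) (g ^ s) = if i = s ∧ l = 2 * s ∧ m = 0 then 1 else 0 := by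
  induction s with
  | zero =>
    intro i l m hw _
    obtain ⟨rfl, rfl, rfl⟩ : i = 0 ∧ l = 0 ∧ m = 0 := by omega
    rw [pow_zero, ← map_one C, coeff_C_expo]
  | succ s ih =>
    intro i l m hw his
    have h1 := mul_mem_ordIdeal hg (pow_mem_ordIdeal (mem_of_sub_leadingHam_mem hg) s)
    have h2 : g ^ (s + 1) = monomial (expo 1 2 0) 1 * g ^ s + monomial (expo 3 0 0) a * g ^ s +
        (g - leadingHam a) * g ^ s := by
      rw [leadingHam]; ring
    rw [h2, map_add, mem_ordIdeal_expo.1 h1 i l m (by omega), add_zero, map_add,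
      coeff_monomial_mul_expo, coeff_monomial_mul_expo, one_mul]
    have h3 : (if 3 ≤ i ∧ 0 ≤ l ∧ 0 ≤ m then
        a * coeff (expo (i - 3) (l - 0) (m - 0)) (g ^ s) else 0) = 0 := by
      split_ifs with h
      · rw [ih _ _ _ (by omega) (by omega), if_neg (by omega), mul_zero]
      · rfl
    rw [h3, add_zero]
    split_ifs with h h' h'
    · rw [ih _ _ _ (by omega) (by omega), if_pos (by omega)]
    · rw [ih _ _ _ (by omega) (by omega), if_neg (by omega)]
    · omega
    · rfl

/-- The resonant part of `q`, written in terms of the powers of `g`. -/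
def resonantPart (g q : FSeries) (n : ℕ) : FSeries :=
  ∑ p ∈ Finset.HasAntidiagonal.antidiagonal n,
    monomial (expo 0 0 p.2) (coeff (expo p.1 (2 * p.1) p.2) q) * g ^ p.1

lemma resonantPart_mem {k : ℕ} {g q : FSeries} (hg : g ∈ ordIdeal 3) (hq : q ∈ ordIdeal k) :
    resonantPart g q (k / 3) ∈ ordIdeal k := by
  refine sum_mem fun p hp => ?_
  have hp' : p.1 + p.2 = k / 3 := Finset.HasAntidiagonal.mem_antidiagonal.1 hp
  -- Resonant monomials have orders divisible by three. When k is not, the coefficients of `q` that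
  -- are used lie below its order and vanish.
  by_cases h : 3 * (k / 3) = k
  · exact mem_of_le (mul_mem_ordIdeal (monomial_mem_ordIdeal 0 0 p.2 _)
      (pow_mem_ordIdeal hg p.1)) (by omega)
  · rw [mem_ordIdeal_expo.1 hq _ _ _ (by omega), map_zero, zero_mul]
    exact zero_mem _

lemma oddInX_resonantPart {g q : FSeries} (hg : OddInX g) (hq : OddInX q) (n : ℕ) :
    OddInX (resonantPart g q n) := by
  rw [oddInX_iff, resonantPart, map_sum, ← Finset.sum_neg_distrib]
  refine Finset.sum_congr rfl fun p _ => ?_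
  by_cases hp : Odd p.1
  · have h1 : ∀ c, reflEnd (monomial (expo 0 0 p.2) c) = monomial (expo 0 0 p.2) c := by
      classical
      refine fun c => series_ext fun k l m => ?_
      rw [coeff_reflEnd]
      simp only [coeff_monomial, expo_inj]
      split_ifs with h
      · rw [h.1, pow_zero, one_mul]
      · rw [mul_zero]
    rw [map_mul, map_pow, h1, oddInX_iff.1 hg, hp.neg_pow, mul_neg]
  · rw [oddInX_iff_coeff.1 hq _ _ _ hp, map_zero, zero_mul, map_zero, neg_zero]

/-- A polynomial in `g` and ε Poisson-commutes with `g`; its flow is therefore a symmetry of `g`. -/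
lemma lieOp_resonantPart (g q : FSeries) (n : ℕ) : lieOp (resonantPart g q n) g = 0 := by
  rw [lieOp_antisymm, neg_eq_zero, resonantPart, map_sum]
  refine Finset.sum_eq_zero fun p _ => ?_
  have h1 : ∀ c, lieOp g (monomial (expo 0 0 p.2) c) = 0 := by
    classical
    intro c
    have h0 : pderiv ℝ 0 (monomial (expo 0 0 p.2) c : FSeries) = 0 := by
      refine series_ext fun i j n => ?_
      rw [coeff_pderiv_zero, coeff_monomial, if_neg, zero_mul, map_zero]
      rw [expo_inj]; omega
    rw [lieOp_apply, h0, pderiv_monomial_one_zero]; ring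
  have h2 : ∀ s : ℕ, lieOp g (g ^ s) = 0 := by
    intro s
    induction s with
    | zero => rw [pow_zero, ← map_one C, lieOp_apply, pderiv_C, pderiv_C]; ring
    | succ s ih => rw [pow_succ, lieOp_mul, ih, lieOp_self]; ring
  rw [lieOp_mul, h1, h2]; ring

lemma coeff_resonantPart {a : ℝ} {g : FSeries} (hg : g - leadingHam a ∈ ordIdeal 4) (q : FSeries)
    (i m : ℕ) : coeff (expo i (2 * i) m) (resonantPart g q (i + m)) =
      coeff (expo i (2 * i) m) q := by
  rw [resonantPart, map_sum, Finset.sum_eq_single (i, m)]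
  · rw [coeff_monomial_mul_expo, if_pos ⟨Nat.zero_le _, Nat.zero_le _, le_rfl⟩,
      coeff_pow_resonant hg _ _ _ _ (by simp only; omega) (by simp), if_pos (by simp), mul_one]
  · rintro ⟨s, n⟩ hp hne
    have hp' : s + n = i + m := Finset.HasAntidiagonal.mem_antidiagonal.1 hp
    rw [coeff_monomial_mul_expo]
    split_ifs with h
    -- Here n ≤ m gives s ≥ i, so the x-degree is in the range of `coeff_pow_resonant`; for s ≠ i
    -- the coefficient is zero.
    · simp only at h
      have hsi : i ≠ s := by
        rintro rfl
        exact hne (Prod.ext rfl (by simp only; omega))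
      rw [coeff_pow_resonant hg _ _ _ _ (by simp only; omega) (by simp only; omega),
        if_neg (by simp only; omega), mul_zero]
    · rfl
  · intro h
    exact absurd (Finset.HasAntidiagonal.mem_antidiagonal.2
      (show (i, m).1 + (i, m).2 = i + m from rfl)) h

/-- To leading order g' - g is {h₀, q}, and a first integral f of `g` with the resonant coefficients
of q may be subtracted from q. The rest p satisfies the homological equation with zero right-hand
side at all non-resonant places, so it vanishes at order k + 2. -/
lemma uniqueness_step {a : ℝ} {g g' : FSeries} (hg : IsSimplified a g) (hg' : IsSimplified a g')
    {k : ℕ} (hk : 1 ≤ k) {δ : SeriesEndˣ} (hδ : IsSymmetricAut δ) (hc : Cong k (δ : SeriesEnd) 1)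
    (h : (δ : SeriesEnd) g = g') :
    g' - g ∈ ordIdeal (k + 4) ∧ ∃ δ' : SeriesEndˣ, IsSymmetricAut δ' ∧
      Cong (k + 1) (δ' : SeriesEnd) 1 ∧ (δ' : SeriesEnd) g = g' := by
  obtain ⟨q, hq, hqo, hqc⟩ := exists_cong_flow hk hδ.filtered hδ.bracket hc
  have hqo := hqo hδ.comm
  have hq3 : q ∈ ordIdeal 3 := mem_of_le hq (by omega)
  have hqc := hqc hq3
  have hd : g' - g - lieOp q (leadingHam a) ∈ ordIdeal (k + 4) := by
    have h1 := flow_sub_sub_lieOp_leadingHam_mem hk hg.sub_mem hq3 hq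
    have h2 := hqc hg.mem
    rw [h] at h2
    have : g' - g - lieOp q (leadingHam a) =
      (g' - flow hq3 g) + (flow hq3 g - g - lieOp q (leadingHam a)) := by ring
    rw [this]
    exact add_mem (mem_of_le h2 (by omega)) h1
  set f := resonantPart g q ((k + 2) / 3) with hf
  have hfm : f ∈ ordIdeal (k + 2) := resonantPart_mem hg.mem hq
  have hf3 : f ∈ ordIdeal 3 := mem_of_le hfm (by omega)
  have hfo : OddInX f := oddInX_resonantPart hg.odd hqo _
  have hfg : lieOp f g = 0 := lieOp_resonantPart _ _ _
  set p := q - f with hp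
  have hpm : p ∈ ordIdeal (k + 2) := sub_mem hq hfm
  have hd' : g' - g - lieOp p (leadingHam a) ∈ ordIdeal (k + 4) := by
    have h1 := lieOp_mem hfm hg.sub_mem
    rw [map_sub, hfg, zero_sub, neg_mem_iff] at h1
    have e : q = p + f := by rw [hp]; ring
    have : g' - g - lieOp p (leadingHam a) =
        (g' - g - lieOp q (leadingHam a)) + lieOp f (leadingHam a) := by
      rw [e, lieOp_add, LinearMap.add_apply]; ring
    rw [this]
    exact add_mem hd (mem_of_le h1 (by omega))
  -- Induction on the x-degree, by triangularity of the homological operator. At l = 2i the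
  -- coefficient was subtracted; otherwise the factor l - 2i is nonzero.
  have hp0 : ∀ i l m, i + l + 3 * m = k + 2 → coeff (expo i l m) p = 0 := by
    intro i
    induction i using Nat.strong_induction_on with
    | _ i ih =>
      intro l m hw
      by_cases hl : l = 2 * i
      · subst hl
        rw [hp, map_sub, hf, show (k + 2) / 3 = i + m by omega, coeff_resonantPart hg.sub_mem,
          sub_self]
      · have h1 := mem_ordIdeal_expo.1 hd' i (l + 1) m (by omega)
        have h2 : g' - g = (g' - leadingHam a) - (g - leadingHam a) := by ring
        rw [map_sub, h2, map_sub, hg.coeff_eq_zero i l m hl, hg'.coeff_eq_zero i l m hl, sub_zero,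
          zero_sub, neg_eq_zero, coeff_lieOp_leadingHam] at h1
        have h3 : (if 2 ≤ i then 3 * a * (l + 2) * coeff (expo (i - 2) (l + 2) m) p else 0) =
            0 := by
          split_ifs with h
          · rw [ih (i - 2) (by omega) (l + 2) m (by omega), mul_zero]
          · rfl
        rw [h3, add_zero] at h1
        refine (mul_eq_zero.1 h1).resolve_left ?_
        exact sub_ne_zero.2 (by exact_mod_cast hl)
  have hpm' : p ∈ ordIdeal (k + 1 + 2) := by
    rw [mem_ordIdeal_expo] at hpm ⊢
    intro i l m hw
    by_cases hw' : i + l + 3 * m < k + 2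
    · exact hpm _ _ _ hw'
    · exact hp0 _ _ _ (by omega)
  -- The flow of -f fixes `g`, so the image is still `g'`, while the product is to leading order the
  -- flow of q - f = p.
  refine ⟨?_, δ * flowUnit (neg_mem hf3), hδ.mul (flowUnit_symmetric _ ?_), ?_, ?_⟩
  · rw [← sub_add_cancel (g' - g) (lieOp p (leadingHam a))]
    exact add_mem hd' (mem_of_le (lieOp_mem hpm' (leadingHam_mem a)) (by omega))
  · rw [oddInX_iff, map_neg, oddInX_iff.1 hfo]
  · have hqf : q + -f ∈ ordIdeal 3 := add_mem hq3 (neg_mem hf3)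
    exact ((hqc.mul_right (flow_filtered (neg_mem hf3))).trans
      (flow_mul_flow_cong hq3 (neg_mem hf3) (neg_mem hfm) hk hqf)).trans
      (cong_flow_one hqf (by rw [← sub_eq_add_neg]; exact hpm'))
  · rw [Units.val_mul, AlgHom.mul_apply, coe_flowUnit, flow_apply_of_lieOp_eq_zero, h]
    rw [← neg_one_smul ℝ f, lieOp_smul, LinearMap.smul_apply, hfg, smul_zero]

/-- Symmetric canonical changes of variables do not alter simplified Hamiltonians. -/
lemma IsSimplified.eq_of_map_eq {a a' : ℝ} {g g' : FSeries} (hg : IsSimplified a g)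
    (hg' : IsSimplified a' g') {δ : SeriesEndˣ} (hδ : IsSymmetricAut δ)
    (h : (δ : SeriesEnd) g = g') : g = g' := by
  have hc := cong_one_of_isSimplified hδ hg hg' h
  obtain rfl : a = a' := by
    have h1 := hc hg.mem
    rw [h, AlgHom.one_apply] at h1
    have h2 := add_mem (_root_.sub_mem hg.sub_mem hg'.sub_mem) h1
    have h3 := mem_ordIdeal_expo.1 h2 3 0 0 (by omega)
    simp only [map_add, map_sub, coeff_leadingHam] at h3
    norm_num at h3
    linarith
  have key : ∀ k, ∃ δ : SeriesEndˣ, IsSymmetricAut δ ∧ Cong (k + 1) (δ : SeriesEnd) 1 ∧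
      (δ : SeriesEnd) g = g' := by
    intro k
    induction k with
    | zero => exact ⟨δ, hδ, hc, h⟩
    | succ k ih =>
      obtain ⟨δ, hδ, hc, h⟩ := ih
      exact (uniqueness_step hg hg' (by omega) hδ hc h).2
  refine (eq_of_forall_sub_mem fun n => ?_).symm
  obtain ⟨δ, hδ, hc, h⟩ := key n
  exact mem_of_le (uniqueness_step hg hg' (by omega) hδ hc h).1 (by omega)

/-! ### The normal form of a formal family -/

lemma existsUnique_normalHam {F : FormalMap} (hF : IsFormalReversingFamily F)
    (hb : NondegenerateLeadingOrder F) :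
    ∃! p : ℝ × MvPowerSeries (Fin 2) ℝ × MvPowerSeries (Fin 2) ℝ,
      AdmissibleA p.2.1 ∧ AdmissibleB p.2.2 ∧
        ConjToReflectedFlow F (normalHam p.1 p.2.1 p.2.2) := by
  have hF0 := hF.fixesOrigin
  obtain ⟨β, h, hh, hβ, ho, hc⟩ := exists_takens_of_family hF
  have hb0 := hb h ⟨ho, orderAtLeastThree_iff.2 hh,
    (conjToReflectedFlow_iff hF0 hh).2 ⟨β, hβ, hc⟩⟩
  obtain ⟨δ₁, hδ₁, hδ₁c⟩ := exists_scaling hb0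
  have h120 : coeff (expo 1 2 0) ((δ₁ : SeriesEnd) h) = 1 := by
    rw [hδ₁c]; field_simp
  obtain ⟨a, δ, hδ, hs⟩ : ∃ (a : ℝ) (δ : SeriesEndˣ), IsSymmetricAut δ ∧
      IsSimplified a ((δ : SeriesEnd) h) := by
    obtain ⟨δ₂, hδ₂, hs⟩ := exists_simplified (hδ₁.oddInX ho)
      (sub_leadingHam_mem (hδ₁.oddInX ho) (hδ₁.filtered.mem hh) h120)
    exact ⟨_, δ₂ * δ₁, hδ₂.mul hδ₁, hs⟩
  obtain ⟨A, B, hA, hB, hg'⟩ := hs.exists_normalHam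
  refine ⟨(a, A, B), ⟨hA, hB, ?_⟩, ?_⟩
  · have hs' : normalHam a A B ∈ ordIdeal 3 := (isSimplified_normalHam hA hB).mem
    have hδh : (δ : SeriesEnd) h ∈ ordIdeal 3 := hδ.filtered.mem hh
    refine (conjToReflectedFlow_iff hF0 hs').2 ⟨β * δ⁻¹, hβ.mul hδ.inv, ?_⟩
    have e1 := hδ.conj hh hδh
    rw [flow_congr hδh hs' hg'] at e1
    calc pull hF0 * ((β * δ⁻¹ : SeriesEndˣ) : SeriesEnd)
        = pull hF0 * β * (↑δ⁻¹ : SeriesEnd) := by rw [Units.val_mul, mul_assoc]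
      _ = β * ((↑δ⁻¹ : SeriesEnd) * δ) * (flow hh * reflEnd) * (↑δ⁻¹ : SeriesEnd) := by
          rw [hc, Units.inv_mul, mul_one]
      _ = β * (↑δ⁻¹ : SeriesEnd) * ((δ : SeriesEnd) * (flow hh * reflEnd)) *
          (↑δ⁻¹ : SeriesEnd) := by simp only [mul_assoc]
      _ = _ := by rw [e1, Units.val_mul]; simp only [mul_assoc, Units.mul_inv, mul_one]
  · rintro ⟨a', A', B'⟩ ⟨hA', hB', hc'⟩
    have hs' := isSimplified_normalHam (a := a') hA' hB'
    obtain ⟨β', hβ', e'⟩ := (conjToReflectedFlow_iff hF0 hs'.mem).1 hc'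
    have hs0 := isSimplified_normalHam (a := a) hA hB
    -- Any other normal form is compared with the same Takens Hamiltonian `h`; composing with δ⁻¹
    -- then relates the two simplified Hamiltonians by a symmetric change.
    have hconj : ((β'⁻¹ * β : SeriesEndˣ) : SeriesEnd) * (flow hh * reflEnd) =
        flow hs'.mem * reflEnd * ((β'⁻¹ * β : SeriesEndˣ) : SeriesEnd) := by
      calc ((β'⁻¹ * β : SeriesEndˣ) : SeriesEnd) * (flow hh * reflEnd)
          = (↑β'⁻¹ : SeriesEnd) * (pull hF0 * β) := by rw [Units.val_mul, hc, mul_assoc]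
        _ = (↑β'⁻¹ : SeriesEnd) * ((pull hF0 * β') * (↑β'⁻¹ : SeriesEnd)) * β := by
            rw [mul_assoc (pull hF0), Units.mul_inv, mul_one, mul_assoc]
        _ = ((↑β'⁻¹ : SeriesEnd) * β') * (flow hs'.mem * reflEnd) * ((↑β'⁻¹ : SeriesEnd) * β) := by
            rw [e']; simp only [mul_assoc]
        _ = _ := by rw [Units.inv_mul, one_mul, Units.val_mul]
    obtain ⟨hη, hηh⟩ := symmetric_of_conj (hβ'.inv.mul hβ) hh hs'.mem ho hs'.odd hconj
    have hδ' : IsSymmetricAut δ⁻¹ := by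
      refine ⟨hδ.inv, ?_⟩
      calc reflEnd * (↑δ⁻¹ : SeriesEnd) = (↑δ⁻¹ : SeriesEnd) * (δ * reflEnd) * ↑δ⁻¹ := by
            rw [← mul_assoc, Units.inv_mul, one_mul]
        _ = (↑δ⁻¹ : SeriesEnd) * reflEnd := by
            rw [← hδ.comm, mul_assoc, mul_assoc, Units.mul_inv, mul_one]
    have hfin := hs0.eq_of_map_eq hs' (hη.mul hδ') (by
      rw [← hg', Units.val_mul, AlgHom.mul_apply, units_inv_apply, hηh])
    obtain ⟨rfl, rfl, rfl⟩ := normalHam_injective hA hB hA' hB' hfin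
    rfl

/-! ### Taylor series of smooth functions -/

open scoped ContDiff Topology

lemma contDiffAt_partialD {f : (Fin 3 → ℝ) → ℝ} {p : Fin 3 → ℝ} (hf : ContDiffAt ℝ ∞ f p)
    (i : Fin 3) : ContDiffAt ℝ ∞ (partialD i f) p :=
  (hf.fderiv_right (m := ∞) le_rfl).clm_apply contDiffAt_const

lemma contDiffAt_iterate_partialD {f : (Fin 3 → ℝ) → ℝ} {p : Fin 3 → ℝ}
    (hf : ContDiffAt ℝ ∞ f p) (i : Fin 3) (k : ℕ) : ContDiffAt ℝ ∞ ((partialD i)^[k] f) p := by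
  induction k with
  | zero => exact hf
  | succ k ih => rw [Function.iterate_succ_apply']; exact contDiffAt_partialD ih i

lemma partialD_congr {f g : (Fin 3 → ℝ) → ℝ} {p : Fin 3 → ℝ} (h : f =ᶠ[𝓝 p] g) (i : Fin 3) :
    partialD i f =ᶠ[𝓝 p] partialD i g := by
  filter_upwards [h.fderiv (𝕜 := ℝ)] with x hx
  rw [partialD, partialD, hx]

lemma iterate_partialD_congr {f g : (Fin 3 → ℝ) → ℝ} {p : Fin 3 → ℝ} (h : f =ᶠ[𝓝 p] g)
    (i : Fin 3) (k : ℕ) : (partialD i)^[k] f =ᶠ[𝓝 p] (partialD i)^[k] g := by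
  induction k with
  | zero => exact h
  | succ k ih =>
    rw [Function.iterate_succ_apply', Function.iterate_succ_apply']; exact partialD_congr ih i

lemma eventually_differentiableAt {f : (Fin 3 → ℝ) → ℝ} {p : Fin 3 → ℝ}
    (hf : ContDiffAt ℝ ∞ f p) : ∀ᶠ x in 𝓝 p, DifferentiableAt ℝ f x := by
  have h1 : ContDiffAt ℝ 1 f p := hf.of_le (by exact_mod_cast le_top)
  filter_upwards [h1.eventually (by simp)] with x hx
  exact hx.differentiableAt (by simp)

lemma partialD_comm {f : (Fin 3 → ℝ) → ℝ} {p : Fin 3 → ℝ} (hf : ContDiffAt ℝ ∞ f p)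
    (i j : Fin 3) : partialD i (partialD j f) =ᶠ[𝓝 p] partialD j (partialD i f) := by
  have h2 : ContDiffAt ℝ 2 f p := hf.of_le
    (show ((2 : ℕ∞) : WithTop ℕ∞) ≤ ((⊤ : ℕ∞) : WithTop ℕ∞) from WithTop.coe_le_coe.2 le_top)
  filter_upwards [h2.eventually (by simp)] with x hx
  have hd : DifferentiableAt ℝ (fderiv ℝ f) x :=
    (hx.fderiv_right (m := 1) (by norm_num)).differentiableAt (by simp)
  have hsymm : IsSymmSndFDerivAt ℝ f x := hx.isSymmSndFDerivAt (by simp)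
  have key : ∀ i j, partialD i (partialD j f) x =
      fderiv ℝ (fderiv ℝ f) x (Pi.single i 1) (Pi.single j 1) := by
    intro i j
    have : HasFDerivAt (partialD j f)
        ((ContinuousLinearMap.apply ℝ ℝ (Pi.single j (1 : ℝ) : Fin 3 → ℝ)).comp
          (fderiv ℝ (fderiv ℝ f) x)) x :=
      (ContinuousLinearMap.apply ℝ ℝ (Pi.single j (1 : ℝ) : Fin 3 → ℝ)).hasFDerivAt.comp x
        hd.hasFDerivAt
    rw [partialD, this.fderiv]; rfl
  rw [key, key]
  exact hsymm _ _

lemma iterate_partialD_comm {f : (Fin 3 → ℝ) → ℝ} {p : Fin 3 → ℝ} (hf : ContDiffAt ℝ ∞ f p)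
    (i j : Fin 3) (k : ℕ) :
    (partialD i)^[k] (partialD j f) =ᶠ[𝓝 p] partialD j ((partialD i)^[k] f) := by
  induction k with
  | zero => rfl
  | succ k ih =>
    rw [Function.iterate_succ_apply', Function.iterate_succ_apply']
    exact (partialD_congr ih i).trans (partialD_comm (contDiffAt_iterate_partialD hf i k) i j)

lemma coeff_taylorSeries (f : (Fin 3 → ℝ) → ℝ) (k l m : ℕ) :
    coeff (expo k l m) (taylorSeries f) =
      ((partialD 0)^[k] ((partialD 1)^[l] ((partialD 2)^[m] f))) 0 /
        (k.factorial * l.factorial * m.factorial : ℝ) := rfl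

lemma taylorSeries_congr {f g : (Fin 3 → ℝ) → ℝ} (h : f =ᶠ[𝓝 0] g) :
    taylorSeries f = taylorSeries g := by
  refine series_ext fun k l m => ?_
  rw [coeff_taylorSeries, coeff_taylorSeries, (iterate_partialD_congr (iterate_partialD_congr
    (iterate_partialD_congr h 2 m) 1 l) 0 k).eq_of_nhds]

lemma coeff_pderiv_two (f : FSeries) (k l m : ℕ) :
    coeff (expo k l m) (pderiv ℝ 2 f) = coeff (expo k l (m + 1)) f * (m + 1) := by
  rw [coeff_pderiv, single_two_eq, expo_add]; rfl

/-- The coefficients use derivatives in a fixed order, so the extra derivative has to be commuted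
through the others, which holds near the origin by symmetry of second derivatives. -/
lemma pderiv_taylorSeries {f : (Fin 3 → ℝ) → ℝ} (hf : ContDiffAt ℝ ∞ f 0) (i : Fin 3) :
    pderiv ℝ i (taylorSeries f) = taylorSeries (partialD i f) := by
  refine series_ext fun k l m => ?_
  have h2 := contDiffAt_iterate_partialD hf 2 m
  fin_cases i
  · rw [Fin.zero_eta, coeff_pderiv_zero, coeff_taylorSeries, coeff_taylorSeries,
      Function.iterate_succ_apply]
    have e := (iterate_partialD_congr (((iterate_partialD_congr
      (iterate_partialD_comm hf 2 0 m) 1 l).trans (iterate_partialD_comm h2 1 0 l))) 0 k).eq_of_nhds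
    rw [e, Nat.factorial_succ]
    have := Nat.factorial_pos k
    have := Nat.factorial_pos l
    have := Nat.factorial_pos m
    push_cast
    field_simp
  · rw [Fin.mk_one, coeff_pderiv_one, coeff_taylorSeries, coeff_taylorSeries,
      Function.iterate_succ_apply]
    have e := (iterate_partialD_congr (iterate_partialD_congr
      (iterate_partialD_comm hf 2 1 m) 1 l) 0 k).eq_of_nhds
    rw [e, Nat.factorial_succ]
    have := Nat.factorial_pos k
    have := Nat.factorial_pos l
    have := Nat.factorial_pos m
    push_cast
    field_simp
  · change coeff (expo k l m) (pderiv ℝ 2 (taylorSeries f)) =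
      coeff (expo k l m) (taylorSeries (partialD 2 f))
    rw [coeff_pderiv_two, coeff_taylorSeries, coeff_taylorSeries,
      Function.iterate_succ_apply, Nat.factorial_succ]
    have := Nat.factorial_pos k
    have := Nat.factorial_pos l
    have := Nat.factorial_pos m
    push_cast
    field_simp

lemma iterate_partialD_lin {f g : (Fin 3 → ℝ) → ℝ} {p : Fin 3 → ℝ} (hf : ContDiffAt ℝ ∞ f p)
    (hg : ContDiffAt ℝ ∞ g p) (c : ℝ) (i : Fin 3) (k : ℕ) :
    (partialD i)^[k] (fun x => f x + c * g x) =ᶠ[𝓝 p]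
      fun x => (partialD i)^[k] f x + c * (partialD i)^[k] g x := by
  induction k with
  | zero => rfl
  | succ k ih =>
    simp only [Function.iterate_succ_apply']
    refine (partialD_congr ih i).trans ?_
    filter_upwards [eventually_differentiableAt (contDiffAt_iterate_partialD hf i k),
      eventually_differentiableAt (contDiffAt_iterate_partialD hg i k)] with x h1 h2
    have : HasFDerivAt (fun x => (partialD i)^[k] f x + c * (partialD i)^[k] g x)
        (fderiv ℝ ((partialD i)^[k] f) x + c • fderiv ℝ ((partialD i)^[k] g) x) x :=
      h1.hasFDerivAt.add (h2.hasFDerivAt.const_mul c)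
    rw [partialD, this.fderiv]
    rfl

lemma taylorSeries_lin {f g : (Fin 3 → ℝ) → ℝ} (hf : ContDiffAt ℝ ∞ f 0)
    (hg : ContDiffAt ℝ ∞ g 0) (c : ℝ) :
    taylorSeries (fun x => f x + c * g x) = taylorSeries f + c • taylorSeries g := by
  refine series_ext fun k l m => ?_
  have e := (((iterate_partialD_congr (iterate_partialD_congr
    (iterate_partialD_lin hf hg c 2 m) 1 l) 0 k).trans (iterate_partialD_congr
    (iterate_partialD_lin (contDiffAt_iterate_partialD hf 2 m)
      (contDiffAt_iterate_partialD hg 2 m) c 1 l) 0 k)).trans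
    (iterate_partialD_lin
      (contDiffAt_iterate_partialD (contDiffAt_iterate_partialD hf 2 m) 1 l)
      (contDiffAt_iterate_partialD (contDiffAt_iterate_partialD hg 2 m) 1 l) c 0 k)).eq_of_nhds
  rw [map_add, map_smul, coeff_taylorSeries, coeff_taylorSeries, coeff_taylorSeries, e,
    smul_eq_mul]
  ring

lemma partialD_mul {f g : (Fin 3 → ℝ) → ℝ} {p : Fin 3 → ℝ} (hf : ContDiffAt ℝ ∞ f p)
    (hg : ContDiffAt ℝ ∞ g p) (i : Fin 3) : partialD i (fun x => f x * g x) =ᶠ[𝓝 p]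
      fun x => f x * partialD i g x + 1 * (partialD i f x * g x) := by
  filter_upwards [eventually_differentiableAt hf, eventually_differentiableAt hg] with x h1 h2
  have : HasFDerivAt (fun x => f x * g x) (f x • fderiv ℝ g x + g x • fderiv ℝ f x) x :=
    h1.hasFDerivAt.mul h2.hasFDerivAt
  rw [partialD, this.fderiv]
  simp [partialD, mul_comm]

lemma constantCoeff_taylorSeries (f : (Fin 3 → ℝ) → ℝ) :
    constantCoeff (taylorSeries f) = f 0 := by
  have h0 : (0 : Fin 3 →₀ ℕ) = expo 0 0 0 := by ext i; fin_cases i <;> rfl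
  rw [← coeff_zero_eq_constantCoeff_apply, h0, coeff_taylorSeries]
  simp

/-- A class of series without constant terms that is stable, up to sums of two members, under
partial differentiation consists of zero. -/
lemma eq_zero_of_pderiv_mem (P : FSeries → Prop) (h0 : ∀ s, P s → constantCoeff s = 0)
    (h : ∀ s i, P s → ∃ t t', P t ∧ P t' ∧ pderiv ℝ i s = t + t') {s : FSeries} (hs : P s) :
    s = 0 := by
  have key : ∀ n s, P s → ∀ k l m, k + l + m = n → coeff (expo k l m) s = 0 := by
    intro n
    induction n with
    | zero =>
      intro s hs k l m hn
      obtain ⟨rfl, rfl, rfl⟩ : k = 0 ∧ l = 0 ∧ m = 0 := by omega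
      have e0 : (0 : Fin 3 →₀ ℕ) = expo 0 0 0 := by ext i; fin_cases i <;> rfl
      rw [← e0, coeff_zero_eq_constantCoeff_apply, h0 s hs]
    | succ n ih =>
      intro s hs k l m hn
      have hz : ∀ i k l m, k + l + m = n → coeff (expo k l m) (pderiv ℝ i s) = 0 := by
        intro i k l m hn
        obtain ⟨t, t', ht, ht', e⟩ := h s i hs
        rw [e, map_add, ih t ht k l m hn, ih t' ht' k l m hn, add_zero]
      rcases k with _ | k
      · rcases l with _ | l
        · obtain ⟨m, rfl⟩ : ∃ m', m = m' + 1 := ⟨n, by omega⟩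
          have h1 := hz 2 0 0 m (by omega)
          rw [coeff_pderiv_two] at h1
          exact (mul_eq_zero.1 h1).resolve_right (by positivity)
        · have h1 := hz 1 0 l m (by omega)
          rw [coeff_pderiv_one] at h1
          exact (mul_eq_zero.1 h1).resolve_right (by positivity)
      · have h1 := hz 0 k l m (by omega)
        rw [coeff_pderiv_zero] at h1
        exact (mul_eq_zero.1 h1).resolve_right (by positivity)
  exact series_ext fun k l m => by rw [key _ s hs k l m rfl, map_zero]

/-- The defects T(fg) - T(f)T(g) have no constant term, and a derivative of the defect of (f, g) is
the sum of the defects of (f, ∂g) and (∂f, g). This replaces the Leibniz formula for higher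
derivatives. -/
lemma taylorSeries_mul {f g : (Fin 3 → ℝ) → ℝ} (hf : ContDiffAt ℝ ∞ f 0)
    (hg : ContDiffAt ℝ ∞ g 0) :
    taylorSeries (fun x => f x * g x) = taylorSeries f * taylorSeries g := by
  refine sub_eq_zero.1 (eq_zero_of_pderiv_mem (fun s => ∃ f g, ContDiffAt ℝ ∞ f 0 ∧
    ContDiffAt ℝ ∞ g 0 ∧ s = taylorSeries (fun x => f x * g x) - taylorSeries f * taylorSeries g)
    ?_ ?_ ⟨f, g, hf, hg, rfl⟩)
  · rintro s ⟨f, g, -, -, rfl⟩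
    rw [map_sub, map_mul, constantCoeff_taylorSeries, constantCoeff_taylorSeries,
      constantCoeff_taylorSeries, sub_self]
  · rintro s i ⟨f, g, hf, hg, rfl⟩
    have hf' := contDiffAt_partialD hf i
    have hg' := contDiffAt_partialD hg i
    refine ⟨_, _, ⟨f, partialD i g, hf, hg', rfl⟩, ⟨partialD i f, g, hf', hg, rfl⟩, ?_⟩
    rw [map_sub, pderiv_mul', pderiv_taylorSeries (hf.mul hg), pderiv_taylorSeries hf,
      pderiv_taylorSeries hg, taylorSeries_congr (partialD_mul hf hg i),
      taylorSeries_lin (hf.mul hg') (hf'.mul hg), one_smul]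
    ring

lemma taylorSeries_const (c : ℝ) : taylorSeries (fun _ => c) = C c := by
  have h1 : ∀ i, partialD i (fun _ => (0 : ℝ)) = fun _ => 0 := by
    intro i; funext x; simp [partialD]
  have h0 : taylorSeries (fun _ => (0 : ℝ)) = 0 := by
    have h2 : ∀ i k, (partialD i)^[k] (fun _ => (0 : ℝ)) = fun _ => 0 := by
      intro i k
      induction k with
      | zero => rfl
      | succ k ih => rw [Function.iterate_succ_apply', ih, h1]
    refine series_ext fun k l m => ?_
    rw [coeff_taylorSeries, h2, h2, h2, zero_div, map_zero]
  refine sub_eq_zero.1 (eq_zero_of_pderiv_mem (fun s => s = 0 ∨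
    ∃ c, s = taylorSeries (fun _ => c) - C c) ?_ ?_ (Or.inr ⟨c, rfl⟩))
  · rintro s (rfl | ⟨c, rfl⟩)
    · simp
    · simp [constantCoeff_taylorSeries]
  · rintro s i (rfl | ⟨c, rfl⟩)
    · exact ⟨0, 0, Or.inl rfl, Or.inl rfl, by simp⟩
    · refine ⟨0, 0, Or.inl rfl, Or.inl rfl, ?_⟩
      have h3 : partialD i (fun _ => c) = fun _ => (0 : ℝ) := by funext x; simp [partialD]
      rw [map_sub, pderiv_taylorSeries contDiffAt_const, pderiv_C, h3, h0]; simp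

/-- The Taylor series of a smooth family is a formal family. -/
lemma IsReversingFamilyOn.isFormalReversingFamily {r : WithTop ℕ∞} {U : Set (Fin 3 → ℝ)}
    {G : (Fin 3 → ℝ) → Fin 2 → ℝ} (hr : r = ∞ ∨ r = ω) (hG : IsReversingFamilyOn r U G) :
    IsFormalReversingFamily (taylorMap G) := by
  have hU : U ∈ 𝓝 (0 : Fin 3 → ℝ) := hG.isOpen.mem_nhds hG.zero_mem
  have hr' : (∞ : WithTop ℕ∞) ≤ r := by
    rcases hr with rfl | rfl
    · exact le_rfl
    · exact le_top
  have hG0 : ContDiffAt ℝ ∞ G 0 := (hG.contDiffOn.contDiffAt hU).of_le hr'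
  have hGi : ∀ i, ContDiffAt ℝ ∞ (fun p => G p i) 0 := fun i => contDiffAt_pi.1 hG0 i
  have hjac : ∀ᶠ p in 𝓝 (0 : Fin 3 → ℝ), ∀ i j,
      jacobian G p i j = partialD j.castSucc (fun p => G p i) p := by
    have h1 : ContDiffAt ℝ 1 G 0 := hG0.of_le (by exact_mod_cast le_top)
    filter_upwards [h1.eventually (by simp)] with p hp i j
    have hd := hp.differentiableAt (by simp)
    rw [partialD, jacobian, Matrix.of_apply]
    rw [(hasFDerivAt_pi'.1 hd.hasFDerivAt i).fderiv]
    rfl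
  refine ⟨?_, fun i => ?_, ?_⟩
  -- The determinant is written in the shape f + c g of `taylorSeries_lin`, and it equals -1 on a
  -- neighbourhood, so all its derivatives at the origin are known.
  · have hdet : (fun p => partialD 0 (fun p => G p 0) p * partialD 1 (fun p => G p 1) p +
        (-1) * (partialD 1 (fun p => G p 0) p * partialD 0 (fun p => G p 1) p)) =ᶠ[𝓝 0]
        fun _ => -1 := by
      filter_upwards [hjac, hU] with p hp hpU
      have := hG.det_jacobian p hpU
      rw [Matrix.det_fin_two, hp, hp, hp, hp] at this
      simp only [Fin.castSucc_zero, Fin.castSucc_one] at this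
      linarith
    have h00 := contDiffAt_partialD (hGi 0) 0
    have h01 := contDiffAt_partialD (hGi 0) 1
    have h10 := contDiffAt_partialD (hGi 1) 0
    have h11 := contDiffAt_partialD (hGi 1) 1
    have := taylorSeries_congr hdet
    rw [taylorSeries_lin (h00.mul h11) (h01.mul h10), taylorSeries_mul h00 h11,
      taylorSeries_mul h01 h10, taylorSeries_const, neg_one_smul, ← sub_eq_add_neg, map_neg,
      map_one, ← pderiv_taylorSeries (hGi 0), ← pderiv_taylorSeries (hGi 0),
      ← pderiv_taylorSeries (hGi 1), ← pderiv_taylorSeries (hGi 1)] at this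
    exact this
  · rw [taylorMap, constantCoeff_taylorSeries, hG.map_zero]; rfl
  · have : linearPart (taylorMap G) = jacobian G 0 := by
      ext i j
      rw [hjac.self_of_nhds i j, linearPart, Matrix.of_apply, taylorMap]
      fin_cases j
      · rw [show Fin.castSucc (⟨0, by decide⟩ : Fin 2) = (0 : Fin 3) from rfl, single_zero_eq,
          coeff_taylorSeries]
        simp
      · rw [show Fin.castSucc (⟨1, by decide⟩ : Fin 2) = (1 : Fin 3) from rfl, single_one_eq,
          coeff_taylorSeries]
        simp
    rw [this]
    exact hG.eigenvalues

end

end ReversingMaps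

/-! ### The theorem for formal, smooth and analytic families -/

open ReversingMaps in
open scoped ContDiff in
theorem theorem5 (F : FormalMap)
    (hF : IsFormalReversingFamily F ∨
      ∃ (r : WithTop ℕ∞) (U : Set (Fin 3 → ℝ)) (G : (Fin 3 → ℝ) → Fin 2 → ℝ),
        (r = ∞ ∨ r = ω) ∧ IsReversingFamilyOn r U G ∧ F = taylorMap G)
    (hb : NondegenerateLeadingOrder F) :
    ∃! p : ℝ × MvPowerSeries (Fin 2) ℝ × MvPowerSeries (Fin 2) ℝ,
      AdmissibleA p.2.1 ∧ AdmissibleB p.2.2 ∧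
        ConjToReflectedFlow F (normalHam p.1 p.2.1 p.2.2) := by
  refine existsUnique_normalHam ?_ hb
  rcases hF with hF | ⟨r, U, G, hr, hG, rfl⟩
  · exact hF
  · exact hG.isFormalReversingFamily hr
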